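/- All graphs are finite, simple and undirected. In a rooted forest $F$ every vertex is an ancestor of itself; the depth of a vertex is the number of its ancestors (so roots have depth $1$), and the depth of $F$ is the maximum depth of a vertex ($0$ if $F$ is empty). An elimination forest of a graph $G$ is a rooted forest $F$ on the vertex set $V(G)$ such that for every edge $uv\in E(G)$ one of $u,v$ is an ancestor of the other in $F$. The treedepth $\mathrm{td}(G)$ is the least depth of an elimination forest of $G$. Computations are on the word RAM: unit-cost arithmetic, bitwise, shift, comparison, load, store and branching operations on $w$-bit words. The word length $w$ may be any number with $w\ge c(\lfloor\log_2 \max(n,1)\rfloor+1)$, where $n$ is the number of vertices of the input graph and $c\geq 1$ is a constant depending only on the algorithm, such that the input number $d$ fits in one word. The input graph has vertex set $\{0,\dots,n-1\}$ and is given by $n$ and its adjacency matrix; rooted forests are given by parent arrays. Statement: There is an algorithm that, given an $n$-vertex graph $G$, an elimination forest $T$ of $G$ of depth at most $k$, and an integer $d\ge 0$, runs in time $2^{O(dk)}\cdot n^{O(1)}$, uses $n^{O(1)}$ words of memory, and either correctly concludes that $\mathrm{td}(G)>d$ or returns an elimination forest of $G$ of depth at most $d$. Precisely, there is a single program and a constant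 $C$ such that on all such inputs the program halts after at most $C\cdot 2^{C d k}\cdot (n+1)^{C}$ steps and accesses only the first $C(n+1)^{C}$ memory cells. -/

import Mathlib

/-! ### Rooted forests, elimination forests, treedepth -/

/-- A rooted forest on the vertex set `V`, given by its parent function (`none` marks a root);
the parent relation has no infinite upward chain (for finite `V`: it is acyclic). -/
structure RootedForest (V : Type*) where
  parent : V → Option V
  wf : WellFounded fun u v : V => parent v = some u

namespace RootedForest

variable {V : Type*}

/-- `F.IsAncestor u v`: `u` is an ancestor of `v`; every vertex is an ancestor of itself. -/
def IsAncestor (F : RootedForest V) : V → V → Prop :=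
  Relation.ReflTransGen fun u v => F.parent v = some u

/-- The depth of a vertex is the number of its ancestors, itself included (roots have depth 1). -/
noncomputable def vertexDepth (F : RootedForest V) (v : V) : ℕ :=
  {u | F.IsAncestor u v}.ncard

/-- The depth of a forest is the maximum depth of a vertex (0 for the empty forest). -/
noncomputable def depth [Fintype V] (F : RootedForest V) : ℕ :=
  Finset.univ.sup F.vertexDepth

/-- `F` is an elimination forest of `G`: the endpoints of every edge are in
ancestor-descendant relation. -/
def IsElimForest (F : RootedForest V) (G : SimpleGraph V) : Prop :=
  ∀ u v, G.Adj u v → F.IsAncestor u v ∨ F.IsAncestor v u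

end RootedForest

/-- The treedepth of a finite graph: the least depth of an elimination forest. -/
noncomputable def SimpleGraph.treedepth {V : Type*} [Fintype V] (G : SimpleGraph V) : ℕ :=
  sInf {h | ∃ F : RootedForest V, F.IsElimForest G ∧ F.depth = h}

/-! ### The word RAM with `w`-bit words

Words are natural numbers below `2 ^ w`. A machine has registers and a memory, whose cells are
addressed by words. A program mentions only finitely many registers. -/

namespace WordRAM

/-- The unit-cost operations on words. -/
inductive BinOp
  | add | sub | mul | div | mod | band | bor | bxor | shl | shr | lt | eq

/-- Arithmetic is modulo `2 ^ w`; comparisons return 1 (true) or 0 (false). -/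
def BinOp.eval (w : ℕ) : BinOp → ℕ → ℕ → ℕ
  | add, x, y => (x + y) % 2 ^ w
  | sub, x, y => (x + 2 ^ w - y) % 2 ^ w
  | mul, x, y => (x * y) % 2 ^ w
  | div, x, y => x / y
  | mod, x, y => x % y
  | band, x, y => x &&& y
  | bor, x, y => x ||| y
  | bxor, x, y => x ^^^ y
  | shl, x, y => (x <<< y) % 2 ^ w
  | shr, x, y => x >>> y
  | lt, x, y => if x < y then 1 else 0
  | eq, x, y => if x = y then 1 else 0

/-- Programs of the word RAM, in structured form. -/
inductive Prog
  /-- do nothing -/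
  | skip
  /-- `reg r := a` -/
  | const (r a : ℕ)
  /-- `reg r := reg a ∘ reg b` -/
  | op (o : BinOp) (r a b : ℕ)
  /-- `reg r := mem (reg a)` -/
  | load (r a : ℕ)
  /-- `mem (reg a) := reg b` -/
  | store (a b : ℕ)
  /-- `p` and then `q` -/
  | seq (p q : Prog)
  /-- if `reg r ≠ 0` then `p` else `q` -/
  | ite (r : ℕ) (p q : Prog)
  /-- while `reg r ≠ 0` do `p` -/
  | loop (r : ℕ) (p : Prog)

/-- The contents of the registers and of the memory. -/
structure State where
  reg : ℕ → ℕ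
  mem : ℕ → ℕ

/-- The state `s` after writing `x` into register `r`. -/
def State.setReg (s : State) (r x : ℕ) : State :=
  { s with reg := Function.update s.reg r x }

/-- The state `s` after writing `x` into memory cell `a`. -/
def State.setMem (s : State) (a x : ℕ) : State :=
  { s with mem := Function.update s.mem a x }

/-- `Exec w S p s t s'`: on a machine with `w`-bit words, program `p` started in state `s` halts
after exactly `t` steps in state `s'`, and accesses only the memory cells `0, …, S - 1`.
Every instruction and every evaluation of a branch or loop condition is one step. -/
inductive Exec (w S : ℕ) : Prog → State → ℕ → State → Prop
  | skip (s : State) : Exec w S Prog.skip s 1 s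
  | const (s : State) (r a : ℕ) : Exec w S (Prog.const r a) s 1 (s.setReg r (a % 2 ^ w))
  | op (s : State) (o : BinOp) (r a b : ℕ) :
      Exec w S (Prog.op o r a b) s 1 (s.setReg r (o.eval w (s.reg a) (s.reg b)))
  | load (s : State) (r a : ℕ) (h : s.reg a < S) :
      Exec w S (Prog.load r a) s 1 (s.setReg r (s.mem (s.reg a)))
  | store (s : State) (a b : ℕ) (h : s.reg a < S) :
      Exec w S (Prog.store a b) s 1 (s.setMem (s.reg a) (s.reg b))
  | seq {p q : Prog} {s s' s'' : State} {t t' : ℕ}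
      (h : Exec w S p s t s') (h' : Exec w S q s' t' s'') :
      Exec w S (Prog.seq p q) s (t + t') s''
  | iteTrue {r : ℕ} {p q : Prog} {s s' : State} {t : ℕ} (hr : s.reg r ≠ 0)
      (h : Exec w S p s t s') : Exec w S (Prog.ite r p q) s (t + 1) s'
  | iteFalse {r : ℕ} {p q : Prog} {s s' : State} {t : ℕ} (hr : s.reg r = 0)
      (h : Exec w S q s t s') : Exec w S (Prog.ite r p q) s (t + 1) s'
  | loopDone {r : ℕ} {p : Prog} {s : State} (hr : s.reg r = 0) :
      Exec w S (Prog.loop r p) s 1 s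
  | loopStep {r : ℕ} {p : Prog} {s s' s'' : State} {t t' : ℕ} (hr : s.reg r ≠ 0)
      (h : Exec w S p s t s') (h' : Exec w S (Prog.loop r p) s' t' s'') :
      Exec w S (Prog.loop r p) s (t + 1 + t') s''

/-- The start state with the list `l` in the memory cells `0, 1, …`; everything else is 0. -/
def State.ofList (l : List ℕ) : State where
  reg := fun _ => 0
  mem := fun a => l.getD a 0

end WordRAM

/-! ### Input and output of the algorithm -/

/-- The number that represents the parent of `v`: 0 if `v` is a root, `u + 1` if it is `u`. -/
def RootedForest.parentCode {n : ℕ} (F : RootedForest (Fin n)) (v : Fin n) : ℕ :=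
  match F.parent v with
  | none => 0
  | some u => u.val + 1

open Classical in
/-- The input `(G, T, d)`: the number `n`, the number `d`, the parent array of `T`, and the
adjacency matrix of `G` row by row. -/
noncomputable def encodeInput {n : ℕ} (G : SimpleGraph (Fin n)) (T : RootedForest (Fin n))
    (d : ℕ) : List ℕ :=
  [n, d] ++ List.ofFn T.parentCode ++
    List.ofFn fun e : Fin (n * n) => if G.Adj e.divNat e.modNat then 1 else 0

/-- The memory holds the answer `no`: cell 0 contains 0. -/
def AnswersNo (s : WordRAM.State) : Prop :=
  s.mem 0 = 0

/-- The memory holds the forest `F` as answer: cell 0 contains 1, and the cells `1, …, n` contain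
the parent array of `F`. -/
def AnswersForest {n : ℕ} (s : WordRAM.State) (F : RootedForest (Fin n)) : Prop :=
  s.mem 0 = 1 ∧ ∀ v : Fin n, s.mem (1 + v.val) = F.parentCode v

/-! ### A small imperative language with arrays, compiled to the word RAM -/

/-! Iterative compression reduces the problem to one step. Vertices arrive one at a time. An
elimination forest of depth at most `dd` of the earlier vertices, with the new vertex put on top, is
an elimination tree of depth at most `dd + 1` of the current induced subgraph. With its help a
forest of depth at most `dd` has to be found or excluded in time exponential in `dd ^ 2` and in
polynomial space. The bounds `dd = 0, 1, …, min d n` are tried until the first success. Since `T`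
itself witnesses depth at most `k`, every `dd` that is reached is at most `d` and at most `k`, so
`dd ^ 2 ≤ d * k`.

The core is a count of configurations by branching along the tree. Every vertex has a chain of
places at height indices below `dd`. A place is either taken over from the chain of a chosen tree
ancestor (`base`) or new, and a new place may be declared a node; the vertex sits at the last place
of its chain, which has to be a node. A code of `2 * dd` base-4 digits describes the choices of one
vertex, and whether they are valid depends only on the codes of its tree ancestors. The condition
that is not local, one vertex at each node, is enforced by signs and degrees. A node carries a flag,
allowed (factor `X`) or forbidden (factor `-X`), and only allowed nodes may be used. Toggling the
flag of an unoccupied node cancels all configurations that have one (`sum_unhit`,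
`sum_prod_weight`). The surviving ones have weight `X` to the number of nodes, which is at most the
number `nv` of vertices, with equality exactly if the vertices occupy the nodes bijectively. So the
coefficient of `X ^ nv` is positive if and only if an elimination order of depth at most `dd` exists
(`elimOrder_of_sol`, `sol_of_elimOrder`).

This coefficient times `nv!` is the `nv`-th finite difference of the generating function at 0. It
does not fit into a word, but a nonzero number of this size is not divisible by all small moduli
(`exists_not_dvd`), so its residues suffice. The generating function is a sum of products along the
tree (`prod_treeSum`), and a depth-first traversal evaluates it modulo `m` while storing one code,
one sum and one product for each vertex (`traverse_root`, `sum_travTime_le`).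

The decision procedure yields a forest by self-reduction: height indices are fixed vertex by vertex
(`greedy_spec`), and they determine how a forest can be assembled from the deepest vertices upwards
(`rebuild_spec`).

The algorithm is written in a small language with arrays, verified by weakest preconditions (`WP`),
and compiled (`Cmd.comp_exec`). All values stay below the polynomial `bnd n`. The only unbounded
loop is the traversal, and it is not nested in another one, so its exponential iteration count
enters the running time as a single factor (`cost_mainC`). -/

namespace TD

/-- The operations of the language on natural numbers; `sub` is truncated. -/
inductive Op
  | add | sub | mul | mod | lt | eq

def Op.eval : Op → ℕ → ℕ → ℕ
  | add, x, y => x + y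
  | sub, x, y => x - y
  | mul, x, y => x * y
  | mod, x, y => x % y
  | lt, x, y => if x < y then 1 else 0
  | eq, x, y => if x = y then 1 else 0

/-- Expressions: literals, scalar variables, array entries and operations. -/
inductive Expr
  | lit (c : ℕ)
  | var (x : ℕ)
  | get (a : ℕ) (e : Expr)
  | bin (o : Op) (e₁ e₂ : Expr)

/-- A state assigns values to the scalar variables and to the array entries. -/
structure St where
  var : ℕ → ℕ
  arr : ℕ → ℕ → ℕ

def St.set (s : St) (x v : ℕ) : St := { s with var := Function.update s.var x v }

def St.put (s : St) (a i v : ℕ) : St :=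
  { s with arr := Function.update s.arr a (Function.update (s.arr a) i v) }

namespace Expr

def val (s : St) : Expr → ℕ
  | lit c => c
  | var x => s.var x
  | get a e => s.arr a (e.val s)
  | bin o e₁ e₂ => o.eval (e₁.val s) (e₂.val s)

/-- All array indices that occur are below `K`. -/
def ok (K : ℕ) (s : St) : Expr → Prop
  | lit _ => True
  | var _ => True
  | get _ e => e.ok K s ∧ e.val s < K
  | bin _ e₁ e₂ => e₁.ok K s ∧ e₂.ok K s

/-- An array entry counts as one leaf whatever its index is, because stored values are below `K`;
the value of an expression is then below `K ^ leaves` (`val_lt_pow`). -/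
def leaves : Expr → ℕ
  | lit _ => 1
  | var _ => 1
  | get _ _ => 1
  | bin _ e₁ e₂ => e₁.leaves + e₂.leaves

/-- The static conditions: small literals, small array names, few leaves. -/
def wf : Expr → Bool
  | lit c => decide (c < 256)
  | var _ => true
  | get a e => decide (a < 16) && decide (e.leaves ≤ 6) && e.wf
  | bin _ e₁ e₂ => e₁.wf && e₂.wf

def cost : Expr → ℕ
  | lit _ => 1
  | var _ => 2
  | get _ e => e.cost + 4
  | bin _ e₁ e₂ => e₁.cost + e₂.cost + 3

end Expr

/-- Commands. `loopLt x l c` is `while x < l do (c; x := x + 1)`. -/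
inductive Cmd
  | skip
  | set (x : ℕ) (e : Expr)
  | put (a : ℕ) (i e : Expr)
  | seq (p q : Cmd)
  | ite (e : Expr) (p q : Cmd)
  | loopLt (x l : ℕ) (c : Cmd)
  | whl (x : ℕ) (c : Cmd)

-- Padding with `skip` makes every operation cost three steps. Truncated subtraction multiplies the
-- machine difference by the bit that tells whether the subtrahend is smaller.
open WordRAM in
def Op.code (t : ℕ) : Op → Prog
  | add => .seq (.op .add (2*t+1) (2*t+1) (2*t+3)) (.seq .skip .skip)
  | sub => .seq (.op .lt (2*t+5) (2*t+3) (2*t+1)) (.seq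
      (.op .sub (2*t+1) (2*t+1) (2*t+3)) (.op .mul (2*t+1) (2*t+5) (2*t+1)))
  | mul => .seq (.op .mul (2*t+1) (2*t+1) (2*t+3)) (.seq .skip .skip)
  | mod => .seq (.op .mod (2*t+1) (2*t+1) (2*t+3)) (.seq .skip .skip)
  | lt => .seq (.op .lt (2*t+1) (2*t+1) (2*t+3)) (.seq .skip .skip)
  | eq => .seq (.op .eq (2*t+1) (2*t+1) (2*t+3)) (.seq .skip .skip)

open WordRAM in
/-- Replaces the index in temporary `t` by the address of that entry of array `a`. -/
def addrCode (a t : ℕ) : Prog :=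
  .seq (.const (2*t+3) a) (.seq (.op .mul (2*t+3) (2*t+3) 1) (.op .add (2*t+1) (2*t+3) (2*t+1)))

-- The odd registers from 3 on serve as a stack of temporaries: `t` is the current height, and the
-- result is left in register `2 * t + 1`.
open WordRAM in
def Expr.comp : Expr → ℕ → Prog
  | lit c, t => .const (2*t+1) c
  | var x, t => .seq (.const (2*t+1) 0) (.op .add (2*t+1) (2*x) (2*t+1))
  | get a e, t => .seq (e.comp t) (.seq (addrCode a t) (.load (2*t+1) (2*t+1)))
  | bin o e₁ e₂, t => .seq (e₁.comp t) (.seq (e₂.comp (t+1)) (o.code t))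

namespace Cmd

open WordRAM in
def comp : Cmd → Prog
  | skip => .skip
  | set x e => .seq (e.comp 1) (.seq (.const 5 0) (.op .add (2*x) 3 5))
  | put a i e => .seq (i.comp 1) (.seq (addrCode a 1) (.seq (e.comp 2) (.store 3 5)))
  | seq p q => .seq p.comp q.comp
  | ite e p q => .seq (e.comp 1) (.ite 3 p.comp q.comp)
  | loopLt x l c => .seq (.op .lt 3 (2*x) (2*l)) (.loop 3 (.seq c.comp (.seq (.const 5 1) (.seq
      (.op .add (2*x) (2*x) 5) (.op .lt 3 (2*x) (2*l))))))
  | whl x c => .loop (2*x) c.comp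

def wf : Cmd → Bool
  | skip => true
  | set _ e => e.wf && decide (e.leaves ≤ 8)
  | put a i e => decide (a < 16) && i.wf && decide (i.leaves ≤ 8) && e.wf && decide (e.leaves ≤ 8)
  | seq p q => p.wf && q.wf
  | ite e p q => e.wf && decide (e.leaves ≤ 8) && p.wf && q.wf
  | loopLt x l c => decide (x ≠ l) && c.wf
  | whl _ c => c.wf

/-- The step bound when values are below `K` and every `whl` makes at most `F` iterations. -/
def cost (K F : ℕ) : Cmd → ℕ
  | skip => 1
  | set _ e => e.cost + 2
  | put _ i e => i.cost + e.cost + 4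
  | seq p q => p.cost K F + q.cost K F
  | ite e p q => e.cost + 1 + p.cost K F + q.cost K F
  | loopLt _ _ c => K * (c.cost K F + 4) + 2
  | whl _ c => F * (c.cost K F + 1) + 1

end Cmd

/-- `BS K F j c s s'`: the command `c` takes `s` to `s'`, all assigned values and indices being
below `K`; `j` is the number of iterations if `c` is a `whl` loop, and nested ones make at most
`F` iterations. -/
inductive BS (K F : ℕ) : ℕ → Cmd → St → St → Prop
  | skip (s) : BS K F 0 .skip s s
  | set (s x e) (h : e.ok K s) (hv : e.val s < K) : BS K F 0 (.set x e) s (s.set x (e.val s))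
  | put (s a i e) (hi : i.ok K s) (he : e.ok K s) (hiv : i.val s < K) (hv : e.val s < K) :
      BS K F 0 (.put a i e) s (s.put a (i.val s) (e.val s))
  | seq {s s' s'' p q j j'} (hj : j ≤ F) (hj' : j' ≤ F) (h : BS K F j p s s')
      (h' : BS K F j' q s' s'') : BS K F 0 (.seq p q) s s''
  | iteTrue {s s' e p q j} (hj : j ≤ F) (he : e.ok K s) (hv : e.val s ≠ 0) (h : BS K F j p s s') :
      BS K F 0 (.ite e p q) s s'
  | iteFalse {s s' e p q j} (hj : j ≤ F) (he : e.ok K s) (hv : e.val s = 0)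
      (h : BS K F j q s s') : BS K F 0 (.ite e p q) s s'
  | loopDone {s x l c} (h : s.var l ≤ s.var x) : BS K F 0 (.loopLt x l c) s s
  | loopStep {s s' s'' x l c j} (hj : j ≤ F) (hlt : s.var x < s.var l) (h : BS K F j c s s')
      (hx : s'.var x = s.var x) (hl : s'.var l = s.var l)
      (h' : BS K F 0 (.loopLt x l c) (s'.set x (s'.var x + 1)) s'') :
      BS K F 0 (.loopLt x l c) s s''
  | whlDone {s x c} (h : s.var x = 0) : BS K F 0 (.whl x c) s s
  | whlStep {s s' s'' x c j i} (hj : j ≤ F) (hx : s.var x ≠ 0) (h : BS K F j c s s')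
      (h' : BS K F i (.whl x c) s' s'') : BS K F (i + 1) (.whl x c) s s''

/-- All values are below `K`. -/
def St.Bdd (K : ℕ) (s : St) : Prop := (∀ x, s.var x < K) ∧ ∀ a i, s.arr a i < K

theorem St.Bdd.set {K : ℕ} {s : St} (h : s.Bdd K) {x v : ℕ} (hv : v < K) : (s.set x v).Bdd K := by
  refine ⟨fun y => ?_, h.2⟩
  by_cases hy : y = x
  · subst hy; simpa [St.set] using hv
  · simpa [St.set, hy] using h.1 y

theorem St.Bdd.put {K : ℕ} {s : St} (h : s.Bdd K) {a i v : ℕ} (hv : v < K) :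
    (s.put a i v).Bdd K := by
  refine ⟨h.1, fun b k => ?_⟩
  by_cases hb : b = a
  · subst hb
    by_cases hk : k = i
    · subst hk; simpa [St.put] using hv
    · simpa [St.put, hk] using h.2 b k
  · simpa [St.put, hb] using h.2 b k

/-- Assignments in `BS` carry their own bounds. The implicit increment of a loop counter does not,
but the counter never exceeds the loop limit, which is itself a stored value. -/
theorem BS.bdd {K F j : ℕ} {c : Cmd} {s s' : St} (h : BS K F j c s s') (hb : s.Bdd K) :
    s'.Bdd K := by
  induction h with
  | skip => exact hb
  | set s x e h hv => exact hb.set hv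
  | put s a i e hi he hiv hv => exact hb.put hv
  | seq hj hj' h h' ih ih' => exact ih' (ih hb)
  | iteTrue hj he hv h ih => exact ih hb
  | iteFalse hj he hv h ih => exact ih hb
  | loopDone h => exact hb
  | @loopStep s s' s'' x l c j hj hlt h hx hl h' ih ih' =>
    refine ih' ((ih hb).set ?_)
    have := (ih hb).1 l
    omega
  | whlDone h => exact hb
  | whlStep hj hx h h' ih ih' => exact ih' (ih hb)

/-- Exponents add even for sums, since two numbers that are at least 2 have a sum not exceeding
their product. -/
theorem Op.eval_lt {K a b x y : ℕ} (hK : 2 ≤ K) (ha : 1 ≤ a) (hb : 1 ≤ b) (hx : x < K ^ a)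
    (hy : y < K ^ b) (o : Op) : o.eval x y < K ^ (a + b) := by
  have h1 : K ^ a ≤ K ^ (a + b) := Nat.pow_le_pow_right (by omega) (by omega)
  have hab : K ^ (a + b) = K ^ a * K ^ b := pow_add _ _ _
  have h2 : 2 ≤ K ^ a := le_trans hK (Nat.le_self_pow (by omega) K)
  have h3 : 2 ≤ K ^ b := le_trans hK (Nat.le_self_pow (by omega) K)
  cases o <;> simp only [Op.eval]
  · rw [hab]; nlinarith
  · omega
  · rw [hab]; exact Nat.mul_lt_mul'' hx hy
  · exact lt_of_le_of_lt (Nat.mod_le _ _) (by omega)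
  · split_ifs <;> omega
  · split_ifs <;> omega

theorem Expr.one_le_leaves (e : Expr) : 1 ≤ e.leaves := by
  induction e with
  | bin o e₁ e₂ h₁ h₂ => simp only [leaves]; omega
  | _ => simp [leaves]

theorem Expr.val_lt_pow {K : ℕ} (hK : 256 ≤ K) {s : St} (hb : s.Bdd K) (e : Expr) (hw : e.wf = true) :
    e.val s < K ^ e.leaves := by
  induction e with
  | lit c => simp only [wf, decide_eq_true_eq] at hw; simp only [val, leaves, pow_one]; omega
  | var x => simpa [val, leaves] using hb.1 x
  | get a e ih => simpa [val, leaves] using hb.2 a _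
  | bin o e₁ e₂ h₁ h₂ =>
    simp only [wf, Bool.and_eq_true] at hw
    exact o.eval_lt (by omega) e₁.one_le_leaves e₂.one_le_leaves (h₁ hw.1) (h₂ hw.2)

/-! ### Simulation of the language on the word RAM -/

open WordRAM

/-- The representation of states of the language: scalar `x` in register `2 * x`, the stride `K`
in register `1`, entry `i` of array `a` in cell `a * K + i`. -/
def Rel (K : ℕ) (s : St) (σ : State) : Prop :=
  (∀ x, σ.reg (2 * x) = s.var x) ∧ σ.reg 1 = K ∧ ∀ a < 16, ∀ i < K, σ.mem (a * K + i) = s.arr a i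

/-- `σ'` differs from `σ` only in temporaries from `t` on. -/
def TempEq (t : ℕ) (σ σ' : State) : Prop :=
  σ'.mem = σ.mem ∧ ∀ r, (r % 2 = 0 ∨ r < 2 * t + 1) → σ'.reg r = σ.reg r

theorem TempEq.trans {t : ℕ} {σ σ' σ'' : State} (h : TempEq t σ σ') (h' : TempEq t σ' σ'') :
    TempEq t σ σ'' :=
  ⟨h'.1.trans h.1, fun r hr => (h'.2 r hr).trans (h.2 r hr)⟩

theorem TempEq.mono {t u : ℕ} (htu : t ≤ u) {σ σ' : State} (h : TempEq u σ σ') : TempEq t σ σ' :=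
  ⟨h.1, fun r hr => h.2 r (by omega)⟩

theorem TempEq.setReg (t r x : ℕ) (σ : State) (hr : r % 2 = 1) (ht : 2 * t + 1 ≤ r) :
    TempEq t σ (σ.setReg r x) :=
  ⟨rfl, fun r' hr' => by simp only [State.setReg]; rw [Function.update_of_ne]; omega⟩

theorem Rel.tempEq {K t : ℕ} {s : St} {σ σ' : State} (h : Rel K s σ) (ht : 1 ≤ t)
    (h' : TempEq t σ σ') : Rel K s σ' := by
  refine ⟨fun x => ?_, ?_, fun a ha i hi => ?_⟩
  · rw [h'.2 _ (by omega), h.1]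
  · rw [h'.2 _ (by omega), h.2.1]
  · rw [h'.1, h.2.2 a ha i hi]

@[simp] theorem setReg_reg_self (s : State) (r x : ℕ) : (s.setReg r x).reg r = x := by
  simp [State.setReg]

theorem setReg_reg_ne (s : State) {r r' x : ℕ} (h : r' ≠ r) : (s.setReg r x).reg r' = s.reg r' := by
  simp [State.setReg, h]

@[simp] theorem setReg_mem (s : State) (r x : ℕ) : (s.setReg r x).mem = s.mem := rfl

section Compile

variable {w K F : ℕ}

theorem Op.code_exec (o : Op) (t S : ℕ) (σ : State)
    (h2 : σ.reg (2*t+3) < 2 ^ w)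
    (h : o.eval (σ.reg (2*t+1)) (σ.reg (2*t+3)) < 2 ^ w) :
    ∃ σ', Exec w S (o.code t) σ 3 σ' ∧ TempEq t σ σ' ∧
      σ'.reg (2*t+1) = o.eval (σ.reg (2*t+1)) (σ.reg (2*t+3)) := by
  cases o
  case sub =>
    refine ⟨_, .seq (.op _ _ _ _ _) (.seq (.op _ _ _ _ _) (.op _ _ _ _ _)), ?_, ?_⟩
    · refine ((TempEq.setReg t _ _ _ ?_ ?_).trans (TempEq.setReg t _ _ _ ?_ ?_)).trans
        (TempEq.setReg t _ _ _ ?_ ?_) <;> omega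
    · have e1 : 2*t+3 ≠ 2*t+5 := by omega
      have e2 : 2*t+1 ≠ 2*t+5 := by omega
      have e3 : 2*t+5 ≠ 2*t+1 := by omega
      simp only [Op.eval] at h
      simp only [setReg_reg_self, setReg_reg_ne _ e1, setReg_reg_ne _ e2, setReg_reg_ne _ e3,
        BinOp.eval, Op.eval]
      by_cases hlt : σ.reg (2*t+3) < σ.reg (2*t+1)
      · rw [if_pos hlt, one_mul, Nat.mod_mod]
        have : σ.reg (2*t+1) + 2 ^ w - σ.reg (2*t+3) =
          (σ.reg (2*t+1) - σ.reg (2*t+3)) + 2 ^ w := by omega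
        rw [this, Nat.add_mod_right, Nat.mod_eq_of_lt h]
      · rw [if_neg hlt, zero_mul, Nat.zero_mod]; omega
  all_goals
    refine ⟨_, .seq (.op _ _ _ _ _) (.seq (.skip _) (.skip _)), ?_, ?_⟩
    · exact TempEq.setReg t _ _ _ (by omega) (by omega)
    · simp only [Op.eval] at h ⊢
      simp [setReg_reg_self, BinOp.eval, Nat.mod_eq_of_lt h]

theorem addrCode_exec (a t S : ℕ) (ha : a < 16) (ht : 1 ≤ t) (σ : State) (hK : σ.reg 1 = K)
    (h256 : 256 ≤ K) (hw : K ^ 8 ≤ 2 ^ w) (hi : σ.reg (2*t+1) < K) :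
    ∃ σ', Exec w S (addrCode a t) σ 3 σ' ∧ TempEq t σ σ' ∧
      σ'.reg (2*t+1) = a * K + σ.reg (2*t+1) := by
  have hK2 : K * K ≤ 2 ^ w := by
    refine le_trans ?_ hw
    calc K * K = K ^ 2 := by ring
      _ ≤ K ^ 8 := Nat.pow_le_pow_right (by omega) (by norm_num)
  refine ⟨_, .seq (.const _ _ _) (.seq (.op _ _ _ _ _) (.op _ _ _ _ _)), ?_, ?_⟩
  · refine ((TempEq.setReg t _ _ _ ?_ ?_).trans (TempEq.setReg t _ _ _ ?_ ?_)).trans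
        (TempEq.setReg t _ _ _ ?_ ?_) <;> omega
  · have e1 : 2*t+1 ≠ 2*t+3 := by omega
    have e2 : 1 ≠ 2*t+3 := by omega
    have h1 : a < 2 ^ w := by nlinarith
    have h2 : a * K + σ.reg (2*t+1) < 2 ^ w := by nlinarith
    have h3 : a * K < 2 ^ w := by omega
    simp only [setReg_reg_self, setReg_reg_ne _ e1, setReg_reg_ne _ e2, BinOp.eval, hK]
    rw [Nat.mod_eq_of_lt h1, Nat.mod_eq_of_lt h3, Nat.mod_eq_of_lt h2]

/-- At most eight leaves and `K ^ 8 ≤ 2 ^ w` exclude overflow, so machine arithmetic agrees with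
arithmetic in `ℕ`. The second operand is computed one temporary higher and leaves the first intact.
-/
theorem Expr.comp_exec (h256 : 256 ≤ K) (hw : K ^ 8 ≤ 2 ^ w) {s : St} (hb : s.Bdd K) (e : Expr) :
    ∀ (t : ℕ), 1 ≤ t → e.wf = true → e.leaves ≤ 8 → e.ok K s → ∀ (σ : State), Rel K s σ →
    ∃ σ', Exec w (16 * K) (e.comp t) σ e.cost σ' ∧ TempEq t σ σ' ∧ σ'.reg (2*t+1) = e.val s := by
  have hKw : ∀ m ≤ 8, K ^ m ≤ 2 ^ w := fun m hm =>
    le_trans (Nat.pow_le_pow_right (by omega) hm) hw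
  have hK1 : K ≤ 2 ^ w := by simpa using hKw 1 (by norm_num)
  induction e with
  | lit c =>
    intro t ht hwf _ _ σ hr
    simp only [wf, decide_eq_true_eq] at hwf
    refine ⟨_, .const _ _ _, TempEq.setReg t _ _ _ (by omega) (by omega), ?_⟩
    rw [setReg_reg_self, Nat.mod_eq_of_lt (by omega)]; rfl
  | var x =>
    intro t ht _ _ _ σ hr
    refine ⟨_, .seq (.const _ _ _) (.op _ _ _ _ _), ?_, ?_⟩
    · refine (TempEq.setReg t _ _ _ ?_ ?_).trans (TempEq.setReg t _ _ _ ?_ ?_) <;> omega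
    · have e1 : 2 * x ≠ 2*t+1 := by omega
      have := hb.1 x
      simp only [setReg_reg_self, setReg_reg_ne _ e1, BinOp.eval, hr.1, Nat.zero_mod, add_zero]
      rw [Nat.mod_eq_of_lt (by omega)]; rfl
  | get a e ih =>
    intro t ht hwf _ hok σ hr
    simp only [wf, Bool.and_eq_true, decide_eq_true_eq] at hwf
    obtain ⟨σ1, hx1, ht1, hv1⟩ := ih t ht hwf.2 (by omega) hok.1 σ hr
    have hr1 := hr.tempEq ht ht1
    obtain ⟨σ2, hx2, ht2, hv2⟩ := addrCode_exec (w := w) a t (16 * K) hwf.1.1 ht σ1 hr1.2.1 h256 hw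
      (by rw [hv1]; exact hok.2)
    have hr2 := hr1.tempEq ht ht2
    rw [hv1] at hv2
    refine ⟨_, .seq hx1 (.seq hx2 (.load _ _ _ ?_)), (ht1.trans ht2).trans
      (TempEq.setReg t _ _ _ (by omega) (by omega)), ?_⟩
    · have := hok.2
      have := hwf.1.1
      rw [hv2]
      nlinarith
    · rw [setReg_reg_self, hv2, hr2.2.2 a hwf.1.1 _ hok.2]; rfl
  | bin o e₁ e₂ h₁ h₂ =>
    intro t ht hwf hl hok σ hr
    have hvl := val_lt_pow h256 hb (.bin o e₁ e₂) hwf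
    simp only [wf, Bool.and_eq_true] at hwf
    simp only [leaves] at hl
    obtain ⟨σ1, hx1, ht1, hv1⟩ := h₁ t ht hwf.1 (by omega) hok.1 σ hr
    have hr1 := hr.tempEq ht ht1
    obtain ⟨σ2, hx2, ht2, hv2⟩ := h₂ (t+1) (by omega) hwf.2 (by omega) hok.2 σ1 hr1
    have hv1' : σ2.reg (2*t+1) = e₁.val s := by rw [ht2.2 _ (by omega), hv1]
    have hv2' : σ2.reg (2*t+3) = e₂.val s := hv2

    have b2 := lt_of_lt_of_le (val_lt_pow h256 hb e₂ hwf.2) (hKw _ (by omega))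
    obtain ⟨σ3, hx3, ht3, hv3⟩ := o.code_exec (w := w) t (16 * K) σ2
      (by rw [hv2']; exact b2)
      (by rw [hv1', hv2']; exact lt_of_lt_of_le hvl (hKw _ hl))
    refine ⟨σ3, ?_, (ht1.trans (ht2.mono (by omega))).trans ht3, ?_⟩
    · have := Exec.seq hx1 (.seq hx2 hx3)
      rw [← add_assoc] at this
      exact this
    · rw [hv3, hv1', hv2']; rfl

/-- The step bound for a command that makes `j` iterations if it is a `whl` loop. -/
def Cmd.costAt (K F j : ℕ) (s : St) : Cmd → ℕ
  | loopLt x l c => (s.var l - s.var x) * (c.cost K F + 4) + 2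
  | whl _ c => j * (c.cost K F + 1) + 1
  | c => c.cost K F

theorem Cmd.costAt_le {j : ℕ} (hj : j ≤ F) {s : St} (hb : s.Bdd K) (c : Cmd) :
    c.costAt K F j s ≤ c.cost K F := by
  cases c <;> simp only [costAt, cost, le_refl]
  · rename_i x l c
    have := hb.1 l
    gcongr
    omega
  · gcongr

theorem Rel.set {s : St} {σ : State} (h : Rel K s σ) (x v : ℕ) :
    Rel K (s.set x v) (σ.setReg (2 * x) v) := by
  refine ⟨fun y => ?_, ?_, h.2.2⟩
  · by_cases hy : y = x
    · subst hy; simp [St.set]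
    · rw [setReg_reg_ne _ (by omega), h.1]; simp [St.set, hy]
  · rw [setReg_reg_ne _ (by omega), h.2.1]

theorem Rel.put {s : St} {σ : State} (h : Rel K s σ) {a i : ℕ} (ha : a < 16) (hi : i < K) (v : ℕ) :
    Rel K (s.put a i v) (σ.setMem (a * K + i) v) := by
  refine ⟨h.1, h.2.1, fun b hb k hk => ?_⟩
  by_cases hba : b = a
  · subst hba
    by_cases hki : k = i
    · subst hki; simp [St.put, State.setMem]
    · have : b * K + k ≠ b * K + i := by omega
      simp [St.put, State.setMem, hki, h.2.2 b hb k hk]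
  · have : b * K + k ≠ a * K + i := by
      intro heq
      rcases Nat.lt_or_gt_of_ne hba with h1 | h1
      · nlinarith [Nat.mul_le_mul_right K h1]
      · nlinarith [Nat.mul_le_mul_right K h1]
    simp [St.put, State.setMem, hba, this, h.2.2 b hb k hk]

/-- The test that opens the run on the incremented state is the same instruction as the test that
closes the loop body. It is therefore shifted into the preceding iteration. -/
theorem Cmd.comp_exec_loopStep {S : ℕ} {x l : ℕ} {p : Prog} {σ σ₁ σ₂ : State} {t₁ t₂ : ℕ}
    (hlt : σ.reg (2 * x) < σ.reg (2 * l)) (h : Exec w S p (σ.setReg 3 1) t₁ σ₁)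
    (hw : σ₁.reg (2 * x) + 1 < 2 ^ w)
    (h' : Exec w S (.seq (.op .lt 3 (2*x) (2*l)) (.loop 3 (.seq p (.seq (.const 5 1) (.seq
      (.op .add (2*x) (2*x) 5) (.op .lt 3 (2*x) (2*l)))))))
      ((σ₁.setReg 5 1).setReg (2 * x) (σ₁.reg (2 * x) + 1)) t₂ σ₂) :
    ∃ t, Exec w S (.seq (.op .lt 3 (2*x) (2*l)) (.loop 3 (.seq p (.seq (.const 5 1) (.seq
      (.op .add (2*x) (2*x) 5) (.op .lt 3 (2*x) (2*l))))))) σ t σ₂ ∧ t = t₁ + t₂ + 4 := by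
  cases h' with
  | seq ha hb =>
  cases ha
  rename_i t
  have e0 : (1 : ℕ) % 2 ^ w = 1 := Nat.mod_eq_of_lt (by omega)
  have h1 := Exec.op (w := w) (S := S) σ .lt 3 (2*x) (2*l)
  simp only [BinOp.eval, if_pos hlt] at h1
  have h3 := Exec.const (w := w) (S := S) σ₁ 5 1
  rw [e0] at h3
  have h4 := Exec.op (w := w) (S := S) (σ₁.setReg 5 1) .add (2*x) (2*x) 5
  simp only [BinOp.eval, setReg_reg_self] at h4
  rw [setReg_reg_ne _ (by omega), Nat.mod_eq_of_lt hw] at h4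
  refine ⟨_, .seq h1 (.loopStep ?_ (.seq h (.seq h3 (.seq h4 (.op _ _ _ _ _)))) hb), by omega⟩
  simp

/-- The bound is `costAt` because the induction unrolls loops one iteration at a time and has to
charge only for those still to come; for whole commands `costAt_le` returns to `cost`. -/
theorem Cmd.comp_exec (h256 : 256 ≤ K) (hw : K ^ 8 ≤ 2 ^ w) {j : ℕ} {c : Cmd} {s s' : St}
    (h : BS K F j c s s') (hwf : c.wf = true) (hb : s.Bdd K) (σ : State) (hr : Rel K s σ) :
    ∃ t σ', Exec w (16 * K) c.comp σ t σ' ∧ Rel K s' σ' ∧ t ≤ c.costAt K F j s := by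
  have hK1 : K < 2 ^ w := by
    calc K = K ^ 1 := (pow_one K).symm
      _ < K ^ 8 := Nat.pow_lt_pow_right (by omega) (by norm_num)
      _ ≤ 2 ^ w := hw
  induction h generalizing σ with
  | skip s => exact ⟨_, _, .skip _, hr, le_refl _⟩
  | set s x e hok hv =>
    simp only [wf, Bool.and_eq_true, decide_eq_true_eq] at hwf
    obtain ⟨σ1, hx1, ht1, hv1⟩ := e.comp_exec h256 hw hb 1 le_rfl hwf.1 hwf.2 hok σ hr
    have hr1 := hr.tempEq le_rfl ht1
    refine ⟨_, _, .seq hx1 (.seq (.const _ _ _) (.op _ _ _ _ _)), ?_, ?_⟩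
    · have e1 : 3 ≠ 5 := by omega
      have h2 : Rel K s (σ1.setReg 5 0) := hr1.tempEq le_rfl (TempEq.setReg 1 _ _ _ rfl (by omega))
      have := h2.set x (e.val s)
      simp only [mul_one] at hv1
      simpa [BinOp.eval, setReg_reg_ne _ e1, hv1, Nat.mod_eq_of_lt (lt_trans hv hK1)] using this
    · simp only [costAt, cost]; omega
  | put s a i e hi he hiv hv =>
    simp only [wf, Bool.and_eq_true, decide_eq_true_eq] at hwf
    obtain ⟨σ1, hx1, ht1, hv1⟩ := i.comp_exec h256 hw hb 1 le_rfl hwf.1.1.1.2 hwf.1.1.2 hi σ hr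
    have hr1 := hr.tempEq le_rfl ht1
    obtain ⟨σ2, hx2, ht2, hv2⟩ := addrCode_exec (w := w) a 1 (16 * K) hwf.1.1.1.1 le_rfl σ1 hr1.2.1
      h256 hw (by rw [hv1]; exact hiv)
    have hr2 := hr1.tempEq le_rfl ht2
    obtain ⟨σ3, hx3, ht3, hv3⟩ := e.comp_exec h256 hw hb 2 (by omega) hwf.1.2 hwf.2 he σ2 hr2
    have hr3 := hr2.tempEq (by omega) ht3
    have hv2' : σ3.reg 3 = a * K + i.val s := by rw [ht3.2 3 (by omega), ← hv1, ← hv2]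
    have hv3' : σ3.reg 5 = e.val s := hv3
    refine ⟨_, _, .seq hx1 (.seq hx2 (.seq hx3 (.store _ _ _ ?_))), ?_, ?_⟩
    · have := hwf.1.1.1.1
      rw [hv2']; nlinarith
    · rw [hv2', hv3']; exact hr3.put hwf.1.1.1.1 hiv _
    · simp only [costAt, cost]; omega
  | @seq s s' s'' p q j j' hj hj' h h' ih ih' =>
    simp only [wf, Bool.and_eq_true] at hwf
    obtain ⟨t1, σ1, hx1, hr1, hc1⟩ := ih hwf.1 hb σ hr
    obtain ⟨t2, σ2, hx2, hr2, hc2⟩ := ih' hwf.2 (h.bdd hb) σ1 hr1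
    refine ⟨_, _, .seq hx1 hx2, hr2, ?_⟩
    have := p.costAt_le hj hb
    have := q.costAt_le hj' (h.bdd hb)
    simp only [costAt, cost]; omega
  | @iteTrue s s' e p q j hj he hv h ih =>
    simp only [wf, Bool.and_eq_true, decide_eq_true_eq] at hwf
    obtain ⟨σ1, hx1, ht1, hv1⟩ := e.comp_exec h256 hw hb 1 le_rfl hwf.1.1.1 hwf.1.1.2 he σ hr
    obtain ⟨t2, σ2, hx2, hr2, hc2⟩ := ih hwf.1.2 hb σ1 (hr.tempEq le_rfl ht1)
    refine ⟨_, _, .seq hx1 (.iteTrue (by rwa [show (3:ℕ) = 2*1+1 from rfl, hv1]) hx2), hr2, ?_⟩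
    have := p.costAt_le hj hb
    simp only [costAt, cost]; omega
  | @iteFalse s s' e p q j hj he hv h ih =>
    simp only [wf, Bool.and_eq_true, decide_eq_true_eq] at hwf
    obtain ⟨σ1, hx1, ht1, hv1⟩ := e.comp_exec h256 hw hb 1 le_rfl hwf.1.1.1 hwf.1.1.2 he σ hr
    obtain ⟨t2, σ2, hx2, hr2, hc2⟩ := ih hwf.2 hb σ1 (hr.tempEq le_rfl ht1)
    refine ⟨_, _, .seq hx1 (.iteFalse (by rwa [show (3:ℕ) = 2*1+1 from rfl, hv1]) hx2), hr2, ?_⟩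
    have := q.costAt_le hj hb
    simp only [costAt, cost]; omega
  | @loopDone s x l c h =>
    refine ⟨_, _, .seq (.op _ _ _ _ _) (.loopDone ?_), ?_, ?_⟩
    · rw [setReg_reg_self]
      simp only [BinOp.eval, hr.1]
      rw [if_neg (by omega)]
    · exact hr.tempEq le_rfl (TempEq.setReg 1 _ _ _ rfl (by omega))
    · simp only [costAt]; omega
  | @loopStep s s' s'' x l c j hj hlt h hx hl h' ih ih' =>
    have hwf' := hwf
    simp only [wf, Bool.and_eq_true, decide_eq_true_eq] at hwf
    have hb1 := h.bdd hb
    have hxl : s'.var x + 1 < K := by have := hb1.1 l; omega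
    obtain ⟨t1, σ1, hx1, hr1, hc1⟩ := ih hwf.2 hb (σ.setReg 3 1)
      (hr.tempEq le_rfl (TempEq.setReg 1 _ _ _ rfl (by omega)))
    have hr1' : Rel K (s'.set x (s'.var x + 1)) ((σ1.setReg 5 1).setReg (2*x) (s'.var x + 1)) :=
      (hr1.tempEq le_rfl (TempEq.setReg 1 5 1 _ rfl (by omega))).set x _
    obtain ⟨t2, σ2, hx2, hr2, hc2⟩ := ih' hwf' (hb1.set hxl) _ hr1'
    obtain ⟨t, hxt, rfl⟩ := comp_exec_loopStep (w := w) (S := 16 * K) (x := x) (l := l) (σ := σ)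
      (by rw [hr.1, hr.1]; exact hlt) hx1 (by rw [hr1.1]; omega) (by rw [hr1.1]; exact hx2)
    refine ⟨_, _, hxt, hr2, ?_⟩
    have := c.costAt_le hj hb
    have e1 : (s'.set x (s'.var x + 1)).var x = s.var x + 1 := by simp [St.set, hx]
    have e2 : (s'.set x (s'.var x + 1)).var l = s.var l := by
      rw [← hl]; simp [St.set, Ne.symm hwf.1]
    simp only [costAt, e1, e2] at hc2 ⊢
    have e3 : s.var l - s.var x = (s.var l - (s.var x + 1)) + 1 := by omega
    rw [e3, add_mul, one_mul]
    omega
  | whlDone h =>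
    refine ⟨_, _, .loopDone (by rw [hr.1]; exact h), hr, by simp only [costAt]; omega⟩
  | @whlStep s s' s'' x c j i hj hx h h' ih ih' =>
    have hwf' := hwf
    simp only [wf] at hwf
    obtain ⟨t1, σ1, hx1, hr1, hc1⟩ := ih hwf hb σ hr
    obtain ⟨t2, σ2, hx2, hr2, hc2⟩ := ih' hwf' (h.bdd hb) σ1 hr1
    refine ⟨_, _, .loopStep (by rw [hr.1]; exact hx) hx1 hx2, hr2, ?_⟩
    have := c.costAt_le hj hb
    simp only [costAt] at hc2 ⊢
    rw [add_mul, one_mul]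
    omega

end Compile

end TD

namespace TD

/-! ### Weakest preconditions -/

instance : Add Expr := ⟨.bin .add⟩
instance : Sub Expr := ⟨.bin .sub⟩
instance : Mul Expr := ⟨.bin .mul⟩
instance : Mod Expr := ⟨.bin .mod⟩
instance (n : ℕ) : OfNat Expr n := ⟨.lit n⟩

/-- 1 if `a < b`, else 0. -/
def Expr.lt (a b : Expr) : Expr := .bin .lt a b

/-- 1 if `a = b`, else 0. -/
def Expr.eq (a b : Expr) : Expr := .bin .eq a b

namespace Expr

variable (s : St) (K : ℕ) (a b : Expr)

@[simp] theorem val_var (x : ℕ) : (Expr.var x).val s = s.var x := rfl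
@[simp] theorem val_ofNat (n : ℕ) : Expr.val s (no_index (OfNat.ofNat n)) = OfNat.ofNat n := rfl
@[simp] theorem val_get (k : ℕ) : (Expr.get k a).val s = s.arr k (a.val s) := rfl
@[simp] theorem val_add : (a + b).val s = a.val s + b.val s := rfl
@[simp] theorem val_sub : (a - b).val s = a.val s - b.val s := rfl
@[simp] theorem val_mul : (a * b).val s = a.val s * b.val s := rfl
@[simp] theorem val_mod : (a % b).val s = a.val s % b.val s := rfl
@[simp] theorem val_lt : (lt a b).val s = if a.val s < b.val s then 1 else 0 := rfl
@[simp] theorem val_eq : (eq a b).val s = if a.val s = b.val s then 1 else 0 := rfl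

@[simp] theorem ok_var (x : ℕ) : (Expr.var x).ok K s ↔ True := Iff.rfl
@[simp] theorem ok_ofNat (n : ℕ) : Expr.ok K s (no_index (OfNat.ofNat n)) ↔ True := Iff.rfl
@[simp] theorem ok_get (k : ℕ) : (Expr.get k a).ok K s ↔ a.ok K s ∧ a.val s < K := Iff.rfl
@[simp] theorem ok_add : (a + b).ok K s ↔ a.ok K s ∧ b.ok K s := Iff.rfl
@[simp] theorem ok_sub : (a - b).ok K s ↔ a.ok K s ∧ b.ok K s := Iff.rfl
@[simp] theorem ok_mul : (a * b).ok K s ↔ a.ok K s ∧ b.ok K s := Iff.rfl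
@[simp] theorem ok_mod : (a % b).ok K s ↔ a.ok K s ∧ b.ok K s := Iff.rfl
@[simp] theorem ok_lt : (lt a b).ok K s ↔ a.ok K s ∧ b.ok K s := Iff.rfl
@[simp] theorem ok_eq : (eq a b).ok K s ↔ a.ok K s ∧ b.ok K s := Iff.rfl

end Expr

@[simp] theorem St.set_var (s : St) (x v y : ℕ) :
    (s.set x v).var y = if y = x then v else s.var y := by
  simp [St.set, Function.update_apply]

@[simp] theorem St.set_arr (s : St) (x v : ℕ) : (s.set x v).arr = s.arr := rfl

@[simp] theorem St.put_var (s : St) (a i v : ℕ) : (s.put a i v).var = s.var := rfl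

@[simp] theorem St.put_arr (s : St) (a i v b : ℕ) :
    (s.put a i v).arr b = if b = a then Function.update (s.arr a) i v else s.arr b := by
  by_cases h : b = a
  · subst h; simp [St.put]
  · simp [St.put, h]

/-- The scalar variables that a command may change. -/
def Cmd.mods : Cmd → List ℕ
  | skip => []
  | set x _ => [x]
  | put _ _ _ => []
  | seq p q => p.mods ++ q.mods
  | ite _ p q => p.mods ++ q.mods
  | loopLt x _ c => x :: c.mods
  | whl _ c => c.mods

/-- The arrays that a command may change. -/
def Cmd.marrs : Cmd → List ℕ
  | skip => []
  | set _ _ => []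
  | put a _ _ => [a]
  | seq p q => p.marrs ++ q.marrs
  | ite _ p q => p.marrs ++ q.marrs
  | loopLt _ _ c => c.marrs
  | whl _ c => c.marrs

/-- `s'` differs from `s` only in what `c` may change. -/
def Same (c : Cmd) (s s' : St) : Prop :=
  (∀ y, y ∉ c.mods → s'.var y = s.var y) ∧ ∀ a, a ∉ c.marrs → s'.arr a = s.arr a

theorem BS.same {K F j : ℕ} {c : Cmd} {s s' : St} (h : BS K F j c s s') : Same c s s' := by
  induction h with
  | skip s => exact ⟨fun _ _ => rfl, fun _ _ => rfl⟩
  | set s x e hok hv =>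
    exact ⟨fun y hy => by simp only [Cmd.mods, List.mem_singleton] at hy; simp [hy], fun _ _ => rfl⟩
  | put s a i e hi he hiv hv =>
    exact ⟨fun _ _ => rfl, fun b hb => by
      simp only [Cmd.marrs, List.mem_singleton] at hb; simp [hb]⟩
  | seq hj hj' h h' ih ih' =>
    refine ⟨fun y hy => ?_, fun b hb => ?_⟩
    · simp only [Cmd.mods, List.mem_append, not_or] at hy
      rw [ih'.1 y hy.2, ih.1 y hy.1]
    · simp only [Cmd.marrs, List.mem_append, not_or] at hb
      rw [ih'.2 b hb.2, ih.2 b hb.1]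
  | iteTrue hj he hv h ih =>
    refine ⟨fun y hy => ?_, fun b hb => ?_⟩
    · simp only [Cmd.mods, List.mem_append, not_or] at hy
      exact ih.1 y hy.1
    · simp only [Cmd.marrs, List.mem_append, not_or] at hb
      exact ih.2 b hb.1
  | iteFalse hj he hv h ih =>
    refine ⟨fun y hy => ?_, fun b hb => ?_⟩
    · simp only [Cmd.mods, List.mem_append, not_or] at hy
      exact ih.1 y hy.2
    · simp only [Cmd.marrs, List.mem_append, not_or] at hb
      exact ih.2 b hb.2
  | loopDone h => exact ⟨fun _ _ => rfl, fun _ _ => rfl⟩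
  | loopStep hj hlt h hx hl h' ih ih' =>
    refine ⟨fun y hy => ?_, fun b hb => ?_⟩
    · rw [ih'.1 y hy]
      simp only [Cmd.mods, List.mem_cons, not_or] at hy
      rw [St.set_var, if_neg hy.1, ih.1 y hy.2]
    · rw [ih'.2 b hb]
      exact ih.2 b hb
  | whlDone h => exact ⟨fun _ _ => rfl, fun _ _ => rfl⟩
  | whlStep hj hx h h' ih ih' =>
    exact ⟨fun y hy => by rw [ih'.1 y hy, ih.1 y hy], fun b hb => by rw [ih'.2 b hb, ih.2 b hb]⟩

/-- From `s`, the command `c` halts in a state that satisfies `Q`. -/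
def WP (K F : ℕ) (c : Cmd) (s : St) (Q : St → Prop) : Prop :=
  ∃ j ≤ F, ∃ s', BS K F j c s s' ∧ Q s'

/-- From `s`, the loop `whl x c` halts after `N` iterations in a state that satisfies `Q`. -/
def WPN (K F N x : ℕ) (c : Cmd) (s : St) (Q : St → Prop) : Prop :=
  ∃ s', BS K F N (.whl x c) s s' ∧ Q s'

/-- `for x < l do c` -/
def Cmd.for_ (x l : ℕ) (c : Cmd) : Cmd := .seq (.set x 0) (.loopLt x l c)

section

variable {K F : ℕ} {s : St} {Q : St → Prop}

/-- Consequence and frame rule in one: the new postcondition may use that `c` left alone everything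
outside `mods` and `marrs`. Specifications therefore mention only results. -/
theorem WP.mono {c : Cmd} {Q' : St → Prop} (h : WP K F c s Q') (hb : s.Bdd K)
    (hQ : ∀ s', Same c s s' → s'.Bdd K → Q' s' → Q s') : WP K F c s Q := by
  obtain ⟨j, hj, s', hs, hq⟩ := h
  exact ⟨j, hj, s', hs, hQ s' hs.same (hs.bdd hb) hq⟩

theorem WP_skip : WP K F .skip s Q ↔ Q s := by
  constructor
  · rintro ⟨j, hjF, s', hs, hq⟩
    cases hs
    exact hq
  · exact fun h => ⟨0, by omega, s, .skip s, h⟩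

theorem WP_set {x : ℕ} {e : Expr} :
    WP K F (.set x e) s Q ↔ e.ok K s ∧ e.val s < K ∧ Q (s.set x (e.val s)) := by
  constructor
  · rintro ⟨j, hjF, s', hs, hq⟩
    cases hs with
    | set _ _ _ h hv => exact ⟨h, hv, hq⟩
  · exact fun h => ⟨0, by omega, _, .set s x e h.1 h.2.1, h.2.2⟩

theorem WP_put {a : ℕ} {i e : Expr} : WP K F (.put a i e) s Q ↔
    i.ok K s ∧ e.ok K s ∧ i.val s < K ∧ e.val s < K ∧ Q (s.put a (i.val s) (e.val s)) := by
  constructor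
  · rintro ⟨j, hjF, s', hs, hq⟩
    cases hs with
    | put _ _ _ _ h1 h2 h3 h4 => exact ⟨h1, h2, h3, h4, hq⟩
  · exact fun h => ⟨0, by omega, _, .put s a i e h.1 h.2.1 h.2.2.1 h.2.2.2.1, h.2.2.2.2⟩

theorem WP_seq {p q : Cmd} : WP K F (.seq p q) s Q ↔ WP K F p s fun s' => WP K F q s' Q := by
  constructor
  · rintro ⟨j, hjF, s', hs, hq⟩
    cases hs with
    | seq hj hj' h h' => exact ⟨_, hj, _, h, _, hj', _, h', hq⟩
  · rintro ⟨_, hj, _, h, _, hj', _, h', hq⟩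
    exact ⟨0, by omega, _, .seq hj hj' h h', hq⟩

theorem WP_ite {e : Expr} {p q : Cmd} : WP K F (.ite e p q) s Q ↔
    e.ok K s ∧ (e.val s ≠ 0 → WP K F p s Q) ∧ (e.val s = 0 → WP K F q s Q) := by
  constructor
  · rintro ⟨j, hjF, s', hs, hq⟩
    cases hs with
    | iteTrue hj he hv h => exact ⟨he, fun _ => ⟨_, hj, _, h, hq⟩, fun h => absurd h hv⟩
    | iteFalse hj he hv h => exact ⟨he, fun h => absurd hv h, fun _ => ⟨_, hj, _, h, hq⟩⟩
  · rintro ⟨he, h1, h2⟩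
    by_cases hv : e.val s = 0
    · obtain ⟨j, hj, s', hs, hq⟩ := h2 hv
      exact ⟨0, by omega, _, .iteFalse hj he hv hs, hq⟩
    · obtain ⟨j, hj, s', hs, hq⟩ := h1 hv
      exact ⟨0, by omega, _, .iteTrue hj he hv hs, hq⟩

/-- Invariant rule, by recursion on the number `k` of remaining iterations. The premises on later
states retain `Same` relative to the initial state, so invariants need not repeat what the loop
cannot change. -/
theorem WP.loopLt {K F : ℕ} {Q : St → Prop} {x l : ℕ} {c : Cmd} (I : ℕ → St → Prop) (hx : x ∉ c.mods) (hl : l ∉ c.mods)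
    (hxl : x ≠ l) (N : ℕ) : ∀ (k : ℕ) (s : St), s.Bdd K → s.var l = N → s.var x + k = N →
    I (s.var x) s →
    (∀ i < N, ∀ s', Same (.loopLt x l c) s s' → s'.Bdd K → s'.var x = i → I i s' →
      WP K F c s' fun s'' => I (i + 1) (s''.set x (i + 1))) →
    (∀ s', Same (.loopLt x l c) s s' → s'.Bdd K → s'.var x = N → I N s' → Q s') →
    WP K F (.loopLt x l c) s Q
  | 0, s, hb, hN, hk, h0, _, hQ => by
    refine ⟨0, by omega, s, .loopDone (by omega), hQ s ⟨fun _ _ => rfl, fun _ _ => rfl⟩ hb ?_ ?_⟩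
    · omega
    · rwa [← hk, add_zero]
  | k + 1, s, hb, hN, hk, h0, hstep, hQ => by
    obtain ⟨j, hj, s1, hs1, hI⟩ := hstep _ (by omega) s ⟨fun _ _ => rfl, fun _ _ => rfl⟩ hb rfl h0
    have hx1 := hs1.same.1 x hx
    have hl1 := hs1.same.1 l hl
    have hb1 := hs1.bdd hb
    rw [← hx1] at hI
    have hsame : Same (.loopLt x l c) s (s1.set x (s1.var x + 1)) := by
      refine ⟨fun y hy => ?_, fun a ha => hs1.same.2 a ha⟩
      simp only [Cmd.mods, List.mem_cons, not_or] at hy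
      rw [St.set_var, if_neg hy.1, hs1.same.1 y hy.2]
    have htr : ∀ s', Same (.loopLt x l c) (s1.set x (s1.var x + 1)) s' →
        Same (.loopLt x l c) s s' := fun s' h =>
      ⟨fun y hy => (h.1 y hy).trans (hsame.1 y hy), fun a ha => (h.2 a ha).trans (hsame.2 a ha)⟩
    have hlb := hb1.1 l
    obtain ⟨j', hj', s', hs', hq⟩ := WP.loopLt (F := F) (Q := Q) I hx hl hxl N k
      (s1.set x (s1.var x + 1))
      (hb1.set (by omega)) (by simp [Ne.symm hxl]; omega) (by simp; omega) (by simpa using hI)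
      (fun i hi s' hs' => hstep i hi s' (htr s' hs'))
      (fun s' hs' => hQ s' (htr s' hs'))
    have : j' = 0 := by cases hs' <;> rfl
    subst this
    exact ⟨0, by omega, s', .loopStep hj (by omega) hs1 hx1 hl1 hs', hq⟩

theorem WP.for_ {x l : ℕ} {c : Cmd} (I : ℕ → St → Prop) (hx : x ∉ c.mods) (hl : l ∉ c.mods)
    (hxl : x ≠ l) (hb : s.Bdd K) (h0 : I 0 (s.set x 0))
    (hstep : ∀ i < s.var l, ∀ s', Same (.for_ x l c) s s' → s'.Bdd K → s'.var x = i → I i s' →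
      WP K F c s' fun s'' => I (i + 1) (s''.set x (i + 1)))
    (hQ : ∀ s', Same (.for_ x l c) s s' → s'.Bdd K → I (s.var l) s' → Q s') :
    WP K F (.for_ x l c) s Q := by
  have hK : 0 < K := lt_of_le_of_lt (Nat.zero_le _) (hb.1 0)
  have hs : ∀ s', Same (.loopLt x l c) (s.set x 0) s' → Same (.for_ x l c) s s' := by
    intro s' h
    refine ⟨fun y hy => ?_, fun a ha => h.2 a ha⟩
    simp only [Cmd.for_, Cmd.mods, List.cons_append, List.nil_append, List.mem_cons,
      not_or] at hy
    rw [h.1 y (by simp [Cmd.mods, hy.1, hy.2.2]), St.set_var, if_neg hy.1]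
  rw [Cmd.for_, WP_seq, WP_set]
  refine ⟨trivial, hK, ?_⟩
  exact WP.loopLt I hx hl hxl (s.var l) (s.var l) _ (hb.set hK) (by simp [Ne.symm hxl]) (by simp)
    (by simpa using h0) (fun i hi s' h => hstep i hi s' (hs s' h))
    (fun s' h hb _ hI => hQ s' (hs s' h) hb hI)

theorem WPN.zero {x : ℕ} {c : Cmd} (h : s.var x = 0) (hQ : Q s) : WPN K F 0 x c s Q :=
  ⟨s, .whlDone h, hQ⟩

theorem WPN.succ {x N : ℕ} {c : Cmd} (h : s.var x ≠ 0)
    (hc : WP K F c s fun s' => WPN K F N x c s' Q) : WPN K F (N + 1) x c s Q := by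
  obtain ⟨j, hj, s1, h1, s2, h2, hQ⟩ := hc
  exact ⟨s2, .whlStep hj h h1 h2, hQ⟩

theorem WPN.whl {x N : ℕ} {c : Cmd} (hN : N ≤ F) (h : WPN K F N x c s Q) :
    WP K F (.whl x c) s Q := by
  obtain ⟨s', h, hQ⟩ := h
  exact ⟨N, hN, s', h, hQ⟩

end

/-! ### Polynomial step bounds -/

/-- The nesting depth of the `loopLt` loops. -/
def Cmd.loopDepth : Cmd → ℕ
  | seq p q => max p.loopDepth q.loopDepth
  | ite _ p q => max p.loopDepth q.loopDepth
  | loopLt _ _ c => c.loopDepth + 1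
  | whl _ c => c.loopDepth
  | _ => 0

/-- The nesting depth of the `whl` loops. -/
def Cmd.whlDepth : Cmd → ℕ
  | seq p q => max p.whlDepth q.whlDepth
  | ite _ p q => max p.whlDepth q.whlDepth
  | loopLt _ _ c => c.whlDepth
  | whl _ c => c.whlDepth + 1
  | _ => 0

/-- Each nested `loopLt` contributes a factor `K`, each nested `whl` a factor `F + 1`. Keeping the
two apart matters because `K` will be polynomial and `F` exponential. -/
theorem Cmd.cost_le (c : Cmd) : ∃ A : ℕ, ∀ K F : ℕ, 1 ≤ K →
    c.cost K F ≤ A * (K ^ c.loopDepth * (F + 1) ^ c.whlDepth) := by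
  have key : ∀ (K F a b a' b' : ℕ), 1 ≤ K → a ≤ a' → b ≤ b' →
      K ^ a * (F + 1) ^ b ≤ K ^ a' * (F + 1) ^ b' := by
    intro K F a b a' b' hK ha hb
    exact Nat.mul_le_mul (Nat.pow_le_pow_right hK ha) (Nat.pow_le_pow_right (by omega) hb)
  induction c with
  | skip => exact ⟨1, fun K F _ => by simp [cost, loopDepth, whlDepth]⟩
  | set x e => exact ⟨e.cost + 2, fun K F _ => by simp [cost, loopDepth, whlDepth]⟩
  | put a i e => exact ⟨i.cost + e.cost + 4, fun K F _ => by simp [cost, loopDepth, whlDepth]⟩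
  | seq p q hp hq =>
    obtain ⟨A, hA⟩ := hp
    obtain ⟨B, hB⟩ := hq
    refine ⟨A + B, fun K F hK => ?_⟩
    rw [add_mul]
    exact Nat.add_le_add
      ((hA K F hK).trans (Nat.mul_le_mul_left _ (key _ _ _ _ _ _ hK (le_max_left _ _) (le_max_left _ _))))
      ((hB K F hK).trans (Nat.mul_le_mul_left _ (key _ _ _ _ _ _ hK (le_max_right _ _) (le_max_right _ _))))
  | ite e p q hp hq =>
    obtain ⟨A, hA⟩ := hp
    obtain ⟨B, hB⟩ := hq
    refine ⟨(e.cost + 1) + A + B, fun K F hK => ?_⟩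
    rw [add_mul, add_mul]
    refine Nat.add_le_add (Nat.add_le_add ?_
      ((hA K F hK).trans (Nat.mul_le_mul_left _ (key _ _ _ _ _ _ hK (le_max_left _ _) (le_max_left _ _)))))
      ((hB K F hK).trans (Nat.mul_le_mul_left _ (key _ _ _ _ _ _ hK (le_max_right _ _) (le_max_right _ _))))
    exact Nat.le_mul_of_pos_right _ (by positivity)
  | loopLt x l c hc =>
    obtain ⟨A, hA⟩ := hc
    refine ⟨A + 6, fun K F hK => ?_⟩
    simp only [cost, loopDepth, whlDepth, pow_succ]
    have h1 := Nat.mul_le_mul_left K (hA K F hK)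
    have h2 : 1 ≤ K ^ c.loopDepth * (F + 1) ^ c.whlDepth := Nat.one_le_iff_ne_zero.2 (by positivity)
    have h3 := Nat.mul_le_mul_left K h2
    nlinarith
  | whl x c hc =>
    obtain ⟨A, hA⟩ := hc
    refine ⟨A + 2, fun K F hK => ?_⟩
    simp only [cost, loopDepth, whlDepth, pow_succ]
    have h1 := Nat.mul_le_mul_left F (hA K F hK)
    have h2 : 1 ≤ K ^ c.loopDepth * (F + 1) ^ c.whlDepth := Nat.one_le_iff_ne_zero.2 (by positivity)
    have h3 := Nat.mul_le_mul_left F h2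
    have h4 := Nat.mul_le_mul_left A h2
    nlinarith

end TD

namespace TD

/-! ### Sums of products along a rooted tree -/

/-- The rooted tree on `0, …, nv` with root `0` and parent function `par`; `lvl` increases from
parents to children and is at most `H`. -/
structure RTree (nv H : ℕ) (par lvl : ℕ → ℕ) : Prop where
  par_zero : par 0 = 0
  lvl_zero : lvl 0 = 0
  par_le : ∀ u ∈ Finset.Icc 1 nv, par u ≤ nv
  lvl_par : ∀ u ∈ Finset.Icc 1 nv, lvl (par u) < lvl u
  lvl_le : ∀ u ∈ Finset.Icc 1 nv, lvl u ≤ H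

def children (par : ℕ → ℕ) (nv u : ℕ) : Finset ℕ := (Finset.Icc 1 nv).filter fun x => par x = u

section TreeSum

variable {R : Type*} [CommRing R] (par : ℕ → ℕ) (nv B : ℕ) (w : ℕ → (ℕ → ℕ) → R)

/-- The sum, over all choices of codes below `B` for the vertices of the subtree at `u`, of the
products of the weights `w` (the first argument bounds the height of the subtree). -/
def treeSum : ℕ → ℕ → (ℕ → ℕ) → R
  | 0, _, _ => 1
  | h + 1, u, γ => ∑ c ∈ Finset.range B, w u (Function.update γ u c) *
      ∏ x ∈ children par nv u, treeSum h x (Function.update γ u c)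

/-- The weight of a vertex depends only on the codes of its ancestors. -/
def IsLocal : Prop :=
  ∀ u γ γ', (∀ k, γ (par^[k] u) = γ' (par^[k] u)) → w u γ = w u γ'

variable {par nv B w}

theorem mem_children {u x : ℕ} : x ∈ children par nv u ↔ (1 ≤ x ∧ x ≤ nv) ∧ par x = u := by
  simp [children]

/-- By locality the weights in the subtree at `u` read only codes bound by the sum and codes of the
proper ancestors of `u`. -/
theorem treeSum_congr (hw : IsLocal par w) (h u : ℕ) (γ γ' : ℕ → ℕ)
    (hg : ∀ k, γ (par^[k + 1] u) = γ' (par^[k + 1] u)) :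
    treeSum par nv B w h u γ = treeSum par nv B w h u γ' := by
  induction h generalizing u γ γ' with
  | zero => rfl
  | succ h ih =>
    simp only [treeSum]
    refine Finset.sum_congr rfl fun c _ => ?_
    have key : ∀ k, Function.update γ u c (par^[k] u) = Function.update γ' u c (par^[k] u) := by
      intro k
      by_cases hk : par^[k] u = u
      · rw [hk]; simp
      · rw [Function.update_of_ne hk, Function.update_of_ne hk]
        cases k with
        | zero => exact absurd rfl hk
        | succ k => exact hg k
    rw [hw u _ _ key]
    congr 1
    refine Finset.prod_congr rfl fun x hx => ih x _ _ fun k => ?_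
    rw [Function.iterate_succ_apply, (mem_children.1 hx).2]
    exact key k

/-- Levels increase towards the children and stop at `H`, so with this much fuel the recursion ends
at childless vertices and never at fuel 0. -/
theorem treeSum_fuel {H : ℕ} {lvl : ℕ → ℕ} (hT : RTree nv H par lvl) (h h' u : ℕ) (γ : ℕ → ℕ)
    (hu : u ∈ Finset.Icc 1 nv) (h1 : H < h + lvl u) (h2 : H < h' + lvl u) :
    treeSum par nv B w h u γ = treeSum par nv B w h' u γ := by
  induction h generalizing h' u γ with
  | zero => have := hT.lvl_le u hu; omega
  | succ h ih =>
    cases h' with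
    | zero => have := hT.lvl_le u hu; omega
    | succ h' =>
      simp only [treeSum]
      refine Finset.sum_congr rfl fun c _ => ?_
      congr 1
      refine Finset.prod_congr rfl fun x hx => ?_
      have hx' := mem_children.1 hx
      have hx1 : x ∈ Finset.Icc 1 nv := Finset.mem_Icc.2 hx'.1
      have := hT.lvl_par x hx1
      rw [hx'.2] at this
      exact ih h' x _ hx1 (by omega) (by omega)

/-- Extension of a code function by zero. -/
def extend (γ : Fin (nv + 1) → ℕ) (u : ℕ) : ℕ := if h : u < nv + 1 then γ ⟨u, h⟩ else 0

theorem extend_update (γ : Fin (nv + 1) → ℕ) (x : Fin (nv + 1)) (c : ℕ) :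
    extend (Function.update γ x c) = Function.update (extend γ) x.val c := by
  funext u
  by_cases hu : u = x.val
  · subst hu; rw [extend, dif_pos x.2]; simp
  · rw [Function.update_of_ne hu]
    unfold extend
    split_ifs with h
    · rw [Function.update_of_ne]
      intro h'
      exact hu (by rw [← h'])
    · rfl

/-- The code functions that vanish outside `A`. -/
def codesOn (nv B : ℕ) (A : Finset ℕ) : Finset (Fin (nv + 1) → ℕ) :=
  Fintype.piFinset fun v => if v.val ∈ A then Finset.range B else {0}

theorem sum_codesOn_insert {A : Finset ℕ} {x : Fin (nv + 1)} (hx : x.val ∉ A)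
    (f : (Fin (nv + 1) → ℕ) → R) :
    ∑ γ ∈ codesOn nv B (insert x.val A), f γ =
      ∑ γ ∈ codesOn nv B A, ∑ c ∈ Finset.range B, f (Function.update γ x c) := by
  rw [← Finset.sum_product' (codesOn nv B A) (Finset.range B) fun γ c => f (Function.update γ x c)]
  refine Finset.sum_nbij' (fun γ => (Function.update γ x 0, γ x))
    (fun p => Function.update p.1 x p.2) ?_ ?_ ?_ ?_ ?_
  · intro γ hγ
    simp only [codesOn, Fintype.mem_piFinset, Finset.mem_product] at hγ ⊢
    refine ⟨fun v => ?_, ?_⟩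
    · by_cases hv : v = x
      · subst hv; simp [hx]
      · have := hγ v
        have hv' : v.val ≠ x.val := fun h => hv (Fin.ext h)
        rw [Function.update_of_ne hv]
        simpa [hv'] using this
    · simpa using hγ x
  · rintro ⟨γ, c⟩ hγ
    simp only [codesOn, Fintype.mem_piFinset, Finset.mem_product] at hγ ⊢
    intro v
    by_cases hv : v = x
    · subst hv; simpa using hγ.2
    · have hv' : v.val ≠ x.val := fun h => hv (Fin.ext h)
      rw [Function.update_of_ne hv]
      simpa [hv'] using hγ.1 v
  · intro γ hγ
    simp
  · rintro ⟨γ, c⟩ hγ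
    simp only [codesOn, Fintype.mem_piFinset, Finset.mem_product] at hγ
    have := hγ.1 x
    simp only [hx, if_false, Finset.mem_singleton] at this
    simp [← this]
  · intro γ hγ
    simp

theorem iterate_par_ne {H : ℕ} {lvl : ℕ → ℕ} (hT : RTree nv H par lvl) {u : ℕ} (hu : u ≤ nv)
    (k : ℕ) : par^[k] u ≤ nv ∧ (par^[k + 1] u = 0 ∨ lvl (par^[k + 1] u) < lvl u) := by
  induction k with
  | zero =>
    refine ⟨hu, ?_⟩
    rcases Nat.eq_zero_or_pos u with h | h
    · left; rw [h]; exact hT.par_zero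
    · right; exact hT.lvl_par u (Finset.mem_Icc.2 ⟨h, hu⟩)
  | succ k ih =>
    have hle : par^[k + 1] u ≤ nv := by
      rw [Function.iterate_succ_apply']
      rcases Nat.eq_zero_or_pos (par^[k] u) with h | h
      · rw [h, hT.par_zero]; omega
      · exact hT.par_le _ (Finset.mem_Icc.2 ⟨h, ih.1⟩)
    refine ⟨hle, ?_⟩
    rw [Function.iterate_succ_apply']
    rcases ih.2 with h | h
    · left; rw [h, hT.par_zero]
    · rcases Nat.eq_zero_or_pos (par^[k + 1] u) with h0 | h0
      · left; rw [h0, hT.par_zero]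
      · right; exact lt_trans (hT.lvl_par _ (Finset.mem_Icc.2 ⟨h0, hle⟩)) h

/-- Partial expansion of the tree sum: the vertices of the ancestor-closed set `A` have been
expanded, those whose parents lie in `A` have not. -/
theorem treeSum_expand {H : ℕ} {lvl : ℕ → ℕ} (hT : RTree nv H par lvl) (hw : IsLocal par w)
    (m : ℕ) : ∀ A ⊆ Finset.Icc 1 nv, (∀ u ∈ A, par u ∈ insert 0 A) →
    (Finset.Icc 1 nv \ A).card = m →
    ∑ γ ∈ codesOn nv B A, (∏ u ∈ A, w u (extend γ)) *
      ∏ x ∈ (Finset.Icc 1 nv \ A).filter (fun x => par x ∈ insert 0 A),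
        treeSum par nv B w (H + 1) x (extend γ) =
    ∑ γ ∈ codesOn nv B (Finset.Icc 1 nv), ∏ u ∈ Finset.Icc 1 nv, w u (extend γ) := by
  induction m with
  | zero =>
    intro A hA _ hc
    rw [Finset.card_eq_zero] at hc
    have : A = Finset.Icc 1 nv := hA.antisymm (Finset.sdiff_eq_empty_iff_subset.1 hc)
    subst this
    simp
  | succ m ih =>
    intro A hA hcl hc
    -- a vertex of least level outside `A`
    have hne : (Finset.Icc 1 nv \ A).Nonempty := by rw [← Finset.card_pos]; omega
    obtain ⟨x, hx, hmin⟩ := Finset.exists_min_image _ lvl hne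
    rw [Finset.mem_sdiff] at hx
    have hxI := Finset.mem_Icc.1 hx.1
    have hpx : par x ∈ insert 0 A := by
      by_contra hcon
      rw [Finset.mem_insert, not_or] at hcon
      have h1 := hT.par_le x hx.1
      have h2 := hmin (par x) (by
        rw [Finset.mem_sdiff, Finset.mem_Icc]; exact ⟨⟨by omega, h1⟩, hcon.2⟩)
      have := hT.lvl_par x hx.1
      omega
    have hx0 : x ∉ insert 0 A := by
      rw [Finset.mem_insert, not_or]; exact ⟨by omega, hx.2⟩
    have hanc : ∀ u ∈ insert 0 A, ∀ k, par^[k] u ∈ insert 0 A := by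
      intro u hu k
      induction k with
      | zero => exact hu
      | succ k ihk =>
        rw [Function.iterate_succ_apply']
        rcases Finset.mem_insert.1 ihk with h | h
        · rw [h, hT.par_zero]; simp
        · exact hcl _ h
    have hnanc : ∀ (γ : ℕ → ℕ) (c : ℕ), ∀ u ∈ insert 0 A, ∀ k,
        Function.update γ x c (par^[k] u) = γ (par^[k] u) := fun γ c u hu k =>
      Function.update_of_ne (fun h => hx0 (by rw [← h]; exact hanc u hu k)) _ _
    rw [← ih (insert x A) ?_ ?_ ?_]
    · have := sum_codesOn_insert (R := R) (B := B) (A := A) (x := (⟨x, by omega⟩ : Fin (nv + 1))) hx.2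
      simp only at this
      rw [this]
      refine Finset.sum_congr rfl fun γ _ => ?_
      have hset : (Finset.Icc 1 nv \ A).filter (fun y => par y ∈ insert 0 A) =
          insert x ((Finset.Icc 1 nv \ insert x A).filter fun y => par y ∈ insert 0 A) := by
        ext y
        simp only [Finset.mem_filter, Finset.mem_sdiff, Finset.mem_insert]
        constructor
        · rintro ⟨⟨h1, h2⟩, h3⟩
          by_cases hy : y = x
          · exact Or.inl hy
          · exact Or.inr ⟨⟨h1, by tauto⟩, h3⟩
        · rintro (rfl | ⟨⟨h1, h2⟩, h3⟩)
          · exact ⟨hx, by simpa using hpx⟩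
          · exact ⟨⟨h1, by tauto⟩, h3⟩
      have hset2 : (Finset.Icc 1 nv \ insert x A).filter (fun y => par y ∈ insert 0 (insert x A)) =
          ((Finset.Icc 1 nv \ insert x A).filter fun y => par y ∈ insert 0 A) ∪
            children par nv x := by
        ext y
        simp only [Finset.mem_filter, Finset.mem_sdiff, Finset.mem_insert, Finset.mem_union,
          children]
        constructor
        · rintro ⟨⟨h1, h2⟩, h3⟩
          tauto
        · rintro (⟨⟨h1, h2⟩, h3⟩ | ⟨h1, h2⟩)
          · tauto
          · refine ⟨⟨h1, ?_⟩, by tauto⟩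
            rintro (rfl | h)
            · have := hT.lvl_par y h1
              rw [h2] at this; omega
            · have := hcl y h
              rw [h2] at this
              exact hx0 this
      have hdisj : Disjoint ((Finset.Icc 1 nv \ insert x A).filter fun y => par y ∈ insert 0 A)
          (children par nv x) := by
        rw [Finset.disjoint_left]
        intro y hy hy'
        have h1 := (Finset.mem_filter.1 hy).2
        rw [(mem_children.1 hy').2] at h1
        exact hx0 h1
      -- The fuel at `x` is raised to `H + 2`, so that one unfolding gives the children of `x`,
      -- which now join the frontier, the fuel `H + 1`.
      rw [hset, hset2, Finset.prod_insert (by simp), ← treeSum_fuel hT (H + 2) _ _ _ hx.1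
        (by omega) (by have := hT.lvl_par x hx.1; omega), treeSum, ← mul_assoc,
        mul_comm _ (Finset.sum _ _), mul_assoc, Finset.sum_mul]
      refine Finset.sum_congr rfl fun c _ => ?_
      rw [extend_update, Finset.prod_insert hx.2, Finset.prod_union hdisj]
      have e1 : ∏ u ∈ A, w u (Function.update (extend γ) x c) = ∏ u ∈ A, w u (extend γ) :=
        Finset.prod_congr rfl fun u hu => hw u _ _ fun k =>
          hnanc _ c u (Finset.mem_insert_of_mem hu) k
      have e2 : ∏ y ∈ (Finset.Icc 1 nv \ insert x A).filter (fun y => par y ∈ insert 0 A),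
            treeSum par nv B w (H + 1) y (Function.update (extend γ) x c) =
          ∏ y ∈ (Finset.Icc 1 nv \ insert x A).filter (fun y => par y ∈ insert 0 A),
            treeSum par nv B w (H + 1) y (extend γ) :=
        Finset.prod_congr rfl fun y hy => treeSum_congr hw _ _ _ _ fun k => by
          rw [Function.iterate_succ_apply]
          exact hnanc _ c (par y) (Finset.mem_filter.1 hy).2 k
      simp only
      rw [e1, e2]
      ring
    · intro u hu
      rcases Finset.mem_insert.1 hu with rfl | h
      · exact hx.1
      · exact hA h
    · intro u hu
      rcases Finset.mem_insert.1 hu with rfl | h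
      · simp only [Finset.mem_insert] at hpx ⊢; tauto
      · have := hcl u h
        simp only [Finset.mem_insert] at this ⊢; tauto
    · have : Finset.Icc 1 nv \ insert x A = (Finset.Icc 1 nv \ A).erase x := by
        ext y; simp only [Finset.mem_sdiff, Finset.mem_insert, Finset.mem_erase]; tauto
      rw [this, Finset.card_erase_of_mem (Finset.mem_sdiff.2 hx), hc]; rfl

/-- Distributivity along the tree: these are the two extreme cases of `treeSum_expand`, nothing
expanded and everything expanded. -/
theorem prod_treeSum {H : ℕ} {lvl : ℕ → ℕ} (hT : RTree nv H par lvl) (hw : IsLocal par w) :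
    ∏ x ∈ children par nv 0, treeSum par nv B w (H + 1) x (fun _ => 0) =
    ∑ γ ∈ codesOn nv B (Finset.Icc 1 nv), ∏ u ∈ Finset.Icc 1 nv, w u (extend γ) := by
  rw [← treeSum_expand hT hw _ ∅ (by simp) (by simp) rfl]
  have h1 : codesOn nv B ∅ = {fun _ => 0} := by
    ext γ
    simp [codesOn, funext_iff]
  have h2 : extend (fun _ : Fin (nv + 1) => 0) = fun _ => 0 := by
    funext u; simp [extend]
  rw [h1, Finset.sum_singleton, h2]
  simp [children]

end TreeSum

end TD

namespace TD

/-! ### Configurations -/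

/-- An instance: the vertices are `1, …, nv`, the forest to be found has depth at most `dd`,
`par` is the parent function of the given elimination tree (with virtual root `0`), the label
`lab u = i + 1` prescribes that `u` gets height index `i` (`0`: no prescription). -/
structure Inst where
  nv : ℕ
  dd : ℕ
  par : ℕ → ℕ
  lab : ℕ → ℕ
  adj : ℕ → ℕ → Prop

/-- The digit `q` of the code of `u`, in base 4. -/
def dgt (γ : ℕ → ℕ) (u q : ℕ) : ℕ := γ u / 4 ^ q % 4

namespace Inst

variable (I : Inst) (δ : ℕ → ℕ → ℕ)

/-- The digits from `dd` on encode in unary how far above the parent of `u` its base lies; only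
whether they vanish matters. -/
def walk (u : ℕ) : ℕ → ℕ
  | 0 => I.par u
  | q + 1 => if δ u (I.dd + q) ≠ 0 then I.par (walk u q) else walk u q

/-- The ancestor whose chain of nodes is extended by `u`. -/
def base (u : ℕ) : ℕ := I.walk δ u I.dd

/-- Traces the place at height index `p` back to its origin: digit 1 says that the place is taken
over from the chain of the base. -/
def follow (p : ℕ) : ℕ → ℕ → ℕ
  | 0, u => u
  | k + 1, u => if δ (follow p k u) p = 1 then I.base δ (follow p k u) else follow p k u

/-- The vertex that created the node at height index `p` on the chain of `u`. -/
def cr (u p : ℕ) : ℕ := I.follow δ p (I.dd + 1) u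

/-- The default 0 for all-zero digits keeps the height index below `dd` whenever `0 < dd`. -/
def lastNZ (u : ℕ) : ℕ → ℕ
  | 0 => 0
  | q + 1 => if δ u q ≠ 0 then q else lastNZ u q

/-- The height index of `u`. -/
def ell (u : ℕ) : ℕ := lastNZ δ u I.dd

/-- The node at which `u` is placed. -/
def pos (u : ℕ) : ℕ × ℕ := (I.cr δ u (I.ell δ u), I.ell δ u)

/-- Comparability in the forest being built: the position of the vertex with the smaller height
index lies on the chain of the other. -/
def Fits (x u : ℕ) : Prop :=
  I.ell δ x ≠ I.ell δ u ∧
    I.cr δ x (min (I.ell δ x) (I.ell δ u)) = I.cr δ u (min (I.ell δ x) (I.ell δ u))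

/-- The first clause makes the places taken over an initial segment of the chain, which gives
coherence (`cr_cr`). The third requires the flag "allowed" at the position of `u`. The range `k ≤
dd` exhausts the proper ancestors in a tree with levels at most `dd + 1`. -/
def Valid (u : ℕ) : Prop :=
  (∀ q, q + 1 < I.dd → δ u (q + 1) = 1 → δ u q = 1) ∧
  (I.lab u = 0 ∨ I.lab u = I.ell δ u + 1) ∧
  δ (I.cr δ u (I.ell δ u)) (I.ell δ u) = 2 ∧
  ∀ k ≤ I.dd, I.par^[k + 1] u ≠ 0 → I.adj u (I.par^[k + 1] u) → I.Fits δ (I.par^[k + 1] u) u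

end Inst

/-- The factor of a digit: an allowed node, a forbidden node, no node. -/
def fac {R : Type*} [CommRing R] (X : R) (e : ℕ) : R := if e = 2 then X else if e = 3 then -X else 1

open Classical in
/-- The weight of vertex `u` in the configuration `δ`. -/
noncomputable def Inst.weight (I : Inst) {R : Type*} [CommRing R] (X : R) (δ : ℕ → ℕ → ℕ) (u : ℕ) :
    R := if I.Valid δ u then ∏ q ∈ Finset.range I.dd, fac X (δ u q) else 0

namespace Inst

variable {I : Inst} {δ δ' : ℕ → ℕ → ℕ}

theorem walk_anc (u q : ℕ) : ∃ k, I.walk δ u q = I.par^[k + 1] u := by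
  induction q with
  | zero => exact ⟨0, rfl⟩
  | succ q ih =>
    obtain ⟨k, hk⟩ := ih
    simp only [walk]
    split_ifs with h
    · exact ⟨k + 1, by rw [hk, Function.iterate_succ_apply' I.par (k + 1)]⟩
    · exact ⟨k, hk⟩

theorem follow_anc (p k u : ℕ) : ∃ j, I.follow δ p k u = I.par^[j] u := by
  induction k with
  | zero => exact ⟨0, rfl⟩
  | succ k ih =>
    obtain ⟨j, hj⟩ := ih
    simp only [follow]
    split_ifs with h
    · obtain ⟨i, hi⟩ := walk_anc (I := I) (δ := δ) (I.follow δ p k u) I.dd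
      exact ⟨(i + 1) + j, by rw [base, hi, hj, ← Function.iterate_add_apply]⟩
    · exact ⟨j, hj⟩

theorem walk_congr {u : ℕ} (h : ∀ q, δ u (I.dd + q) ≠ 0 ↔ δ' u (I.dd + q) ≠ 0) (q : ℕ) :
    I.walk δ u q = I.walk δ' u q := by
  induction q with
  | zero => rfl
  | succ q ih => simp only [walk, h, ih]

theorem follow_congr {u p : ℕ}
    (h : ∀ k q, δ (I.par^[k] u) (I.dd + q) ≠ 0 ↔ δ' (I.par^[k] u) (I.dd + q) ≠ 0)
    (h' : ∀ k, δ (I.par^[k] u) p = 1 ↔ δ' (I.par^[k] u) p = 1) (k : ℕ) :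
    I.follow δ p k u = I.follow δ' p k u := by
  induction k with
  | zero => rfl
  | succ k ih =>
    obtain ⟨j, hj⟩ := follow_anc (I := I) (δ := δ) p k u
    simp only [follow, ← ih]
    rw [hj]
    simp only [h' j, base, walk_congr (h j)]

theorem lastNZ_congr {u q : ℕ} (h : ∀ i < q, δ u i ≠ 0 ↔ δ' u i ≠ 0) :
    lastNZ δ u q = lastNZ δ' u q := by
  induction q with
  | zero => rfl
  | succ q ih => simp only [lastNZ, h q (by omega), ih fun i hi => h i (by omega)]

/-- Every vertex consulted by `Valid` is reached from `u` by iterating `par` (`walk_anc`,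
`follow_anc`). -/
theorem weight_local {R : Type*} [CommRing R] (X : R) {u : ℕ}
    (h : ∀ k, δ (I.par^[k] u) = δ' (I.par^[k] u)) : I.weight X δ u = I.weight X δ' u := by
  have hcr : ∀ k p, I.cr δ (I.par^[k] u) p = I.cr δ' (I.par^[k] u) p := fun k p =>
    follow_congr (fun j q => by rw [← Function.iterate_add_apply, h])
      (fun j => by rw [← Function.iterate_add_apply, h]) _
  have hl : ∀ k, I.ell δ (I.par^[k] u) = I.ell δ' (I.par^[k] u) := fun k =>
    lastNZ_congr fun i _ => by rw [h]
  have hcr0 := hcr 0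
  have hl0 := hl 0
  have h0 := h 0
  simp only [Function.iterate_zero, id] at hcr0 hl0 h0
  have hv : I.Valid δ u ↔ I.Valid δ' u := by
    obtain ⟨j, hj⟩ := follow_anc (I := I) (δ := δ') (I.ell δ' u) (I.dd + 1) u
    have hd : δ (I.cr δ' u (I.ell δ' u)) = δ' (I.cr δ' u (I.ell δ' u)) := by rw [cr, hj, h]
    unfold Valid Fits
    simp only [h0, hl0, hcr0, hl, hcr, hd]
  unfold weight
  by_cases h1 : I.Valid δ u
  · rw [if_pos h1, if_pos (hv.1 h1), h0]
  · rw [if_neg h1, if_neg (fun h => h1 (hv.2 h))]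

/-! ### Chains of places in a tree of bounded level -/

section Tree

variable {lvl : ℕ → ℕ} (hT : RTree I.nv (I.dd + 1) I.par lvl) (h0 : ∀ q, δ 0 q = 0)

include hT in
theorem anc_le {u : ℕ} (hu : u ≤ I.nv) (k : ℕ) : I.par^[k] u ≤ I.nv := (iterate_par_ne hT hu k).1

include hT in
theorem lvl_pos {u : ℕ} (hu : u ≤ I.nv) (h : u ≠ 0) : 1 ≤ lvl u := by
  have := hT.lvl_par u (Finset.mem_Icc.2 ⟨by omega, hu⟩)
  omega

include hT in
theorem iterate_lvl {u : ℕ} (hu : u ≤ I.nv) (k : ℕ) (hk : I.par^[k] u ≠ 0) :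
    lvl (I.par^[k] u) + k ≤ lvl u := by
  induction k with
  | zero => simp
  | succ k ih =>
    rw [Function.iterate_succ_apply'] at hk ⊢
    have h1 : I.par^[k] u ≠ 0 := fun h => hk (by rw [h, hT.par_zero])
    have h2 := anc_le hT hu k
    have := hT.lvl_par _ (Finset.mem_Icc.2 ⟨by omega, h2⟩)
    have := ih h1
    omega

include hT in
theorem iterate_eq_zero {u k : ℕ} (hu : u ≤ I.nv) (hk : I.dd < k) : I.par^[k] u = 0 := by
  by_contra h
  have h1 := iterate_lvl hT hu k h
  have h2 := lvl_pos hT (anc_le hT hu k) h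
  rcases Nat.eq_zero_or_pos u with h3 | h3
  · rw [h3, hT.lvl_zero] at h1; omega
  · have := hT.lvl_le u (Finset.mem_Icc.2 ⟨h3, hu⟩)
    omega

include hT in
theorem base_le {u : ℕ} (hu : u ≤ I.nv) : I.base δ u ≤ I.nv := by
  obtain ⟨k, hk⟩ := walk_anc (I := I) (δ := δ) u I.dd
  rw [base, hk]
  exact anc_le hT hu _

include hT in
theorem lvl_base {u : ℕ} (hu : u ≤ I.nv) (h : u ≠ 0) : lvl (I.base δ u) < lvl u := by
  obtain ⟨k, hk⟩ := walk_anc (I := I) (δ := δ) u I.dd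
  rw [base, hk]
  by_cases h1 : I.par^[k + 1] u = 0
  · rw [h1, hT.lvl_zero]; have := lvl_pos hT hu h; omega
  · have := iterate_lvl hT hu _ h1; omega

theorem follow_succ (p k u : ℕ) : I.follow δ p (k + 1) u =
    I.follow δ p k (if δ u p = 1 then I.base δ u else u) := by
  induction k with
  | zero => rfl
  | succ k ih => rw [follow, ih]; rfl

-- Every move to the base lowers the level, so `lvl u` moves reach the origin of the place; the zero
-- digits at the virtual root stop the search there.
include hT h0 in
theorem follow_stable {u : ℕ} (p k : ℕ) (hu : u ≤ I.nv) (hk : lvl u ≤ k) :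
    δ (I.follow δ p k u) p ≠ 1 := by
  have hz : ∀ k, I.follow δ p k 0 = 0 := by
    intro k
    induction k with
    | zero => rfl
    | succ k ih => simp [follow, ih, h0]
  induction k generalizing u with
  | zero =>
    have : u = 0 := by
      by_contra h
      have := lvl_pos hT hu h
      omega
    rw [this, hz, h0]; omega
  | succ k ih =>
    rw [follow_succ]
    split_ifs with h
    · by_cases hu0 : u = 0
      · rw [hu0, h0] at h; omega
      · exact ih (base_le hT hu) (by have := lvl_base (δ := δ) hT hu hu0; omega)
    · have : ∀ k, I.follow δ p k u = u := by
        intro k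
        induction k with
        | zero => rfl
        | succ k ih => simp [follow, ih, h]
      rw [this]; exact h

-- Recursion equation for `cr`: its fuel `dd + 1` is as large as any level, so spending one unit on
-- the move to the base loses nothing.
include hT h0 in
theorem cr_eq {u : ℕ} (hu : u ≤ I.nv) (p : ℕ) :
    I.cr δ u p = if δ u p = 1 then I.cr δ (I.base δ u) p else u := by
  have hle : lvl u ≤ I.dd + 1 := by
    rcases Nat.eq_zero_or_pos u with h | h
    · rw [h, hT.lvl_zero]; omega
    · exact hT.lvl_le u (Finset.mem_Icc.2 ⟨h, hu⟩)
  split_ifs with h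
  · have hu0 : u ≠ 0 := by rintro rfl; rw [h0] at h; omega
    have := follow_stable hT h0 p I.dd (base_le (δ := δ) hT hu)
      (by have := lvl_base (δ := δ) hT hu hu0; omega)
    rw [cr, follow_succ, if_pos h, cr, follow, if_neg this]
  · have : ∀ k, I.follow δ p k u = u := by
      intro k
      induction k with
      | zero => rfl
      | succ k ih => simp [follow, ih, h]
    rw [cr, this]

include hT h0 in
/-- Chains are coherent: a node determines the nodes above it. -/
theorem cr_cr {u p q : ℕ} (hv : ∀ u ∈ Finset.Icc 1 I.nv, I.Valid δ u) (hu : u ≤ I.nv) (hqp : q ≤ p)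
    (hp : p < I.dd) : I.cr δ (I.cr δ u p) q = I.cr δ u q := by
  induction hl : lvl u using Nat.strong_induction_on generalizing u with
  | _ n ih =>
    rw [cr_eq hT h0 hu p]
    split_ifs with h
    · have hu0 : u ≠ 0 := by rintro rfl; rw [h0] at h; omega
      have hq : δ u q = 1 := by
        -- If the place at `p` is taken over, so are all those above it, by the first clause of
        -- `Valid`. Both places then come from the base, where induction applies.
        have key : ∀ j, j ≤ p → δ u (p - j) = 1 := by
          intro j
          induction j with
          | zero => intro _; exact h
          | succ j ihj =>
            intro hj
            refine (hv u (Finset.mem_Icc.2 ⟨by omega, hu⟩)).1 _ (by omega) ?_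
            rw [show p - (j + 1) + 1 = p - j from by omega]
            exact ihj (by omega)
        have := key (p - q) (by omega)
        rwa [show p - (p - q) = q from by omega] at this
      rw [ih _ (by rw [← hl]; exact lvl_base hT hu hu0) (base_le hT hu) rfl, cr_eq hT h0 hu q,
        if_pos hq]
    · rfl

end Tree

end Inst

/-! ### Elimination orders -/

/-- `anc` is the ancestor relation of an elimination forest, or a relation that behaves like one,
with height indices `ell` below `dd`. -/
structure ElimOrder (nv dd : ℕ) (adj : ℕ → ℕ → Prop) (ell : ℕ → ℕ) (anc : ℕ → ℕ → Prop) :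
    Prop where
  lt : ∀ u ∈ Finset.Icc 1 nv, ell u < dd
  refl : ∀ u ∈ Finset.Icc 1 nv, anc u u
  comp : ∀ u ∈ Finset.Icc 1 nv, ∀ v ∈ Finset.Icc 1 nv, adj u v → anc u v ∨ anc v u
  ne : ∀ u ∈ Finset.Icc 1 nv, ∀ v ∈ Finset.Icc 1 nv, adj u v → ell u ≠ ell v
  le : ∀ u ∈ Finset.Icc 1 nv, ∀ v ∈ Finset.Icc 1 nv, anc u v → ell u ≤ ell v
  eq : ∀ u ∈ Finset.Icc 1 nv, ∀ v ∈ Finset.Icc 1 nv, anc u v → ell u = ell v → u = v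
  trans : ∀ u ∈ Finset.Icc 1 nv, ∀ v ∈ Finset.Icc 1 nv, ∀ w ∈ Finset.Icc 1 nv,
    anc u v → anc v w → anc u w
  down : ∀ u ∈ Finset.Icc 1 nv, ∀ v ∈ Finset.Icc 1 nv, ∀ w ∈ Finset.Icc 1 nv,
    anc u w → anc v w → ell u ≤ ell v → anc u v

/-- The height indices agree with the prescribed labels. -/
def Respects (nv : ℕ) (lab ell : ℕ → ℕ) : Prop :=
  ∀ u ∈ Finset.Icc 1 nv, lab u = 0 ∨ lab u = ell u + 1

/-- The given tree is an elimination tree. -/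
def Inst.Elim (I : Inst) : Prop :=
  ∀ u ∈ Finset.Icc 1 I.nv, ∀ v ∈ Finset.Icc 1 I.nv, I.adj u v →
    ∃ k, v = I.par^[k + 1] u ∨ u = I.par^[k + 1] v

namespace Inst

variable (I : Inst) (δ : ℕ → ℕ → ℕ)

/-- The nodes of a configuration. -/
def nodes : Finset (ℕ × ℕ) :=
  (Finset.Icc 1 I.nv ×ˢ Finset.range I.dd).filter fun p => δ p.1 p.2 = 2 ∨ δ p.1 p.2 = 3

/-- All vertices are placed validly, and there is a vertex at every node. -/
def Sol : Prop :=
  (∀ u ∈ Finset.Icc 1 I.nv, I.Valid δ u) ∧ I.nodes δ ⊆ (Finset.Icc 1 I.nv).image (I.pos δ)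

variable {I δ}

theorem lastNZ_lt {u q : ℕ} (hq : 0 < q) : lastNZ δ u q < q := by
  induction q with
  | zero => omega
  | succ q ih =>
    simp only [lastNZ]
    split_ifs
    · omega
    · rcases Nat.eq_zero_or_pos q with h | h
      · subst h; simp [lastNZ]
      · have := ih h; omega

/-- The `nv` vertices cover `nv` nodes, so no two vertices share a node. One vertex is above another
if its node lies on the other's chain; coherence of chains gives transitivity and comparability of
common ancestors. -/
theorem elimOrder_of_sol {lvl : ℕ → ℕ} (hT : RTree I.nv (I.dd + 1) I.par lvl)
    (h0 : ∀ q, δ 0 q = 0) (hdd : 0 < I.dd) (hE : I.Elim) (hsymm : ∀ u v, I.adj u v → I.adj v u)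
    (hS : I.Sol δ) (hc : (I.nodes δ).card = I.nv) :
    ElimOrder I.nv I.dd I.adj (I.ell δ) (fun u v => I.ell δ u ≤ I.ell δ v ∧
      I.cr δ u (I.ell δ u) = I.cr δ v (I.ell δ u)) ∧ Respects I.nv I.lab (I.ell δ) := by
  have hlt : ∀ u, I.ell δ u < I.dd := fun u => lastNZ_lt hdd
  have hinj : Set.InjOn (I.pos δ) (Finset.Icc 1 I.nv) := by
    refine Finset.injOn_of_card_image_eq (le_antisymm Finset.card_image_le ?_)
    calc (Finset.Icc 1 I.nv).card = I.nv := by simp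
      _ = (I.nodes δ).card := hc.symm
      _ ≤ _ := Finset.card_le_card hS.2
  have hco : ∀ u ∈ Finset.Icc 1 I.nv, ∀ v ∈ Finset.Icc 1 I.nv, ∀ p q, q ≤ p → p < I.dd →
      I.cr δ u p = I.cr δ v p → I.cr δ u q = I.cr δ v q := by
    intro u hu v hv p q hqp hp h
    rw [← cr_cr hT h0 hS.1 (Finset.mem_Icc.1 hu).2 hqp hp, h,
      cr_cr hT h0 hS.1 (Finset.mem_Icc.1 hv).2 hqp hp]
  -- In an elimination tree every edge joins a vertex to one of its ancestors, so the check of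
  -- adjacent ancestors in `Valid` covers all edges.
  have hadj : ∀ u ∈ Finset.Icc 1 I.nv, ∀ v ∈ Finset.Icc 1 I.nv, I.adj u v → I.Fits δ u v := by
    have hfs : ∀ u v, I.Fits δ u v → I.Fits δ v u := by
      rintro u v ⟨h1, h2⟩
      refine ⟨h1.symm, ?_⟩
      rw [min_comm]
      exact h2.symm
    have key : ∀ u ∈ Finset.Icc 1 I.nv, ∀ k, I.par^[k + 1] u ≠ 0 → I.adj u (I.par^[k + 1] u) →
        I.Fits δ (I.par^[k + 1] u) u := by
      intro u hu k hk ha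
      refine (hS.1 u hu).2.2.2 k ?_ hk ha
      by_contra h
      exact hk (iterate_eq_zero hT (Finset.mem_Icc.1 hu).2 (by omega))
    intro u hu v hv ha
    have hu' := Finset.mem_Icc.1 hu
    have hv' := Finset.mem_Icc.1 hv
    obtain ⟨k, rfl | rfl⟩ := hE u hu v hv ha
    · exact hfs _ _ (key u hu k (by omega) ha)
    · exact key v hv k (by omega) (hsymm _ _ ha)
  refine ⟨⟨fun u _ => hlt u, fun u _ => ⟨le_rfl, rfl⟩, ?_, ?_, ?_, ?_, ?_, ?_⟩, ?_⟩
  · intro u hu v hv ha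
    obtain ⟨h1, h2⟩ := hadj u hu v hv ha
    rcases le_total (I.ell δ u) (I.ell δ v) with h | h
    · left; rw [min_eq_left h] at h2; exact ⟨h, h2⟩
    · right; rw [min_eq_right h] at h2; exact ⟨h, h2.symm⟩
  · exact fun u hu v hv ha => (hadj u hu v hv ha).1
  · exact fun u hu v hv ha => ha.1
  · intro u hu v hv ha he
    refine hinj hu hv ?_
    have := ha.2
    simp only [pos]
    rw [this, he]
  · intro u hu v hv w hw h1 h2
    exact ⟨h1.1.trans h2.1, h1.2.trans (hco v hv w hw _ _ h1.1 (hlt v) h2.2)⟩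
  · intro u hu v hv w hw h1 h2 h3
    exact ⟨h3, h1.2.trans (hco v hv w hw _ _ h3 (hlt v) h2.2).symm⟩
  · exact fun u hu => (hS.1 u hu).2.1

end Inst

end TD

namespace TD

/-! ### The configuration of an elimination order -/

theorem exists_code (e : ℕ → ℕ) (he : ∀ i, e i < 4) (D : ℕ) :
    ∃ c < 4 ^ D, ∀ i < D, c / 4 ^ i % 4 = e i := by
  induction D with
  | zero => exact ⟨0, by norm_num, fun i hi => by omega⟩
  | succ D ih =>
    obtain ⟨c, hc, hd⟩ := ih
    have hpos : 0 < 4 ^ D := by positivity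
    refine ⟨c + 4 ^ D * e D, ?_, fun i hi => ?_⟩
    · have := he D
      rw [pow_succ]; nlinarith
    · rcases Nat.lt_succ_iff_lt_or_eq.1 hi with h | h
      · have e0 : 4 ^ D = 4 ^ i * (4 * 4 ^ (D - i - 1)) := by
          rw [← pow_succ', ← pow_add]; congr 1; omega
        have e1 : 4 ^ D * e D = 4 ^ i * (4 * (4 ^ (D - i - 1) * e D)) := by rw [e0]; ring
        rw [e1, Nat.add_mul_div_left _ _ (by positivity), Nat.add_mul_mod_self_left, hd i h]
      · subst h
        rw [Nat.add_mul_div_left _ _ hpos, Nat.div_eq_of_lt hc, zero_add, Nat.mod_eq_of_lt (he _)]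

namespace Inst

theorem lastNZ_eq {δ : ℕ → ℕ → ℕ} {u m q : ℕ} (hm : m < q) (h1 : δ u m ≠ 0)
    (h2 : ∀ i, m < i → i < q → δ u i = 0) : lastNZ δ u q = m := by
  induction q with
  | zero => omega
  | succ q ih =>
    simp only [lastNZ]
    rcases Nat.lt_succ_iff_lt_or_eq.1 hm with h | h
    · rw [h2 q h (by omega), if_neg (by simp), ih h fun i hi hi' => h2 i hi (by omega)]
    · subst h; rw [if_pos h1]

variable (I : Inst) (ell : ℕ → ℕ)

/-- Connectedness in the subgraph induced by the vertices of height index at least `p`. -/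
def Reach (p : ℕ) : ℕ → ℕ → Prop :=
  Relation.ReflTransGen fun a b => a ∈ Finset.Icc 1 I.nv ∧ b ∈ Finset.Icc 1 I.nv ∧ p ≤ ell a ∧
    p ≤ ell b ∧ I.adj a b

-- Index 0 always qualifies for `u ≠ 0`, and all iterates of `par` beyond `dd` are 0 in the trees
-- considered, so the search bound `dd + 1` loses no ancestor.
open Classical in
noncomputable def topIdx (p u : ℕ) : ℕ :=
  Nat.findGreatest (fun k => I.par^[k] u ≠ 0 ∧ I.Reach ell p u (I.par^[k] u)) (I.dd + 1)

/-- The highest ancestor of `u` in its component of the vertices of height index at least `p`. -/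
noncomputable def top (p u : ℕ) : ℕ := I.par^[I.topIdx ell p u] u

open Classical in
/-- The largest height index at which `u` does not start a new node. -/
noncomputable def lastOld (u : ℕ) : ℕ :=
  Nat.findGreatest (fun q => I.top ell q u ≠ u) (ell u)

-- The canonical configuration. A component of the vertices of height index at least `i` is
-- represented by its topmost tree vertex `top`. A vertex below this representative takes the place
-- over. The representative creates the place and declares it a node just if the component contains
-- a vertex of height index exactly `i`. The digits from `dd` on lead to the representative at the
-- last index that is taken over; one step is saved because the walk starts at the parent.
open Classical in
noncomputable def digitOf (u i : ℕ) : ℕ :=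
  if i < I.dd then
    if ell u < i then 0
    else if I.top ell i u ≠ u then 1
    else if ∃ w ∈ Finset.Icc 1 I.nv, I.Reach ell i u w ∧ ell w = i then 2 else 0
  else if i - I.dd + 1 < I.topIdx ell (I.lastOld ell u) u then 1 else 0

variable {I ell} {lvl : ℕ → ℕ}

theorem Reach.symm (hs : ∀ u v, I.adj u v → I.adj v u) {p u v : ℕ} (h : I.Reach ell p u v) :
    I.Reach ell p v u := by
  induction h with
  | refl => exact .refl
  | tail _ h ih => exact .head ⟨h.2.1, h.1, h.2.2.2.1, h.2.2.1, hs _ _ h.2.2.2.2⟩ ih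

theorem Reach.mono {p q u v : ℕ} (hqp : q ≤ p) (h : I.Reach ell p u v) : I.Reach ell q u v := by
  refine Relation.ReflTransGen.mono ?_ _ _ h
  exact fun _ _ h => ⟨h.1, h.2.1, hqp.trans h.2.2.1, hqp.trans h.2.2.2.1, h.2.2.2.2⟩

theorem Reach.mem {p u v : ℕ} (h : I.Reach ell p u v) (hu : u ∈ Finset.Icc 1 I.nv)
    (hp : p ≤ ell u) : v ∈ Finset.Icc 1 I.nv ∧ p ≤ ell v := by
  induction h with
  | refl => exact ⟨hu, hp⟩
  | tail _ h _ => exact ⟨h.2.1, h.2.2.2.1⟩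

/-- Edges join comparable vertices, and a path that stays at height indices at least that of `a`
cannot climb past `a`: a step downwards uses `trans`, a step upwards uses `down`. -/
theorem Reach.anc {anc : ℕ → ℕ → Prop}
    (hO : ElimOrder I.nv I.dd I.adj ell anc) {p a u v : ℕ} (h : I.Reach ell p u v)
    (ha : a ∈ Finset.Icc 1 I.nv) (hau : anc a u) (hp : ell a = p) : anc a v := by
  induction h with
  | refl => exact hau
  | @tail x y _ h ih =>
    obtain ⟨hx, hy, hpx, hpy, hadj⟩ := h
    rcases hO.comp x hx y hy hadj with h | h
    · exact hO.trans a ha x hx y hy ih h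
    · exact hO.down a ha y hy x hx ih h (by omega)

/-- A vertex of the minimal index `p` is above its whole component, so a component has at most one
such vertex. This ties nodes to vertices. -/
theorem Reach.eq {anc : ℕ → ℕ → Prop}
    (hO : ElimOrder I.nv I.dd I.adj ell anc) {p u v : ℕ} (h : I.Reach ell p u v)
    (hu : u ∈ Finset.Icc 1 I.nv) (hp : ell u = p) (hq : ell v = p) : u = v :=
  hO.eq u hu v (h.mem hu hp.ge).1 (h.anc hO hu (hO.refl u hu) hp) (by omega)

section

variable (hT : RTree I.nv (I.dd + 1) I.par lvl)

theorem topIdx_spec {p u : ℕ} (hu : u ≠ 0) :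
    I.top ell p u ≠ 0 ∧ I.Reach ell p u (I.top ell p u) := by
  classical
  exact Nat.findGreatest_spec (P := fun k => I.par^[k] u ≠ 0 ∧ I.Reach ell p u (I.par^[k] u))
    (Nat.zero_le _) ⟨hu, .refl⟩

include hT in
theorem le_topIdx {p u k : ℕ} (hu : u ∈ Finset.Icc 1 I.nv) (h : I.par^[k] u ≠ 0)
    (hr : I.Reach ell p u (I.par^[k] u)) : k ≤ I.topIdx ell p u := by
  classical
  refine Nat.le_findGreatest ?_ ⟨h, hr⟩
  by_contra hk
  exact h (iterate_eq_zero hT (Finset.mem_Icc.1 hu).2 (by omega))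

include hT in
theorem top_eq_of_anc (hs : ∀ u v, I.adj u v → I.adj v u) {p b k : ℕ}
    (hb : b ∈ Finset.Icc 1 I.nv) (h : I.par^[k] b ≠ 0) (hr : I.Reach ell p b (I.par^[k] b)) :
    I.top ell p b = I.top ell p (I.par^[k] b) := by
  have hle := anc_le hT (Finset.mem_Icc.1 hb).2 k
  have hk := le_topIdx hT hb h hr
  have hb0 : b ≠ 0 := by have := Finset.mem_Icc.1 hb; omega
  have h1 := topIdx_spec (I := I) (ell := ell) (p := p) hb0
  have h2 := topIdx_spec (I := I) (ell := ell) (p := p) h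
  have e1 : I.top ell p b = I.par^[I.topIdx ell p b - k] (I.par^[k] b) := by
    rw [← Function.iterate_add_apply, Nat.sub_add_cancel hk]; rfl
  have e2 : I.top ell p (I.par^[k] b) = I.par^[I.topIdx ell p (I.par^[k] b) + k] b := by
    rw [Function.iterate_add_apply]; rfl
  have h3 := le_topIdx hT (ell := ell) (p := p) (u := I.par^[k] b) (k := I.topIdx ell p b - k)
    (Finset.mem_Icc.2 ⟨by omega, hle⟩) (by rw [← e1]; exact h1.1)
    (by rw [← e1]; exact (hr.symm hs).trans h1.2)
  have h4 := le_topIdx hT (ell := ell) (p := p) hb (k := I.topIdx ell p (I.par^[k] b) + k)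
    (by rw [← e2]; exact h2.1) (by rw [← e2]; exact hr.trans h2.2)
  rw [e1, show I.topIdx ell p b - k = I.topIdx ell p (I.par^[k] b) from by omega]; rfl

-- Since the endpoints of an edge are comparable in the given tree, they have the same topmost
-- vertex. Hence `top` is a well-defined name for a component.
include hT in
theorem Reach.top_eq (hE : I.Elim) (hs : ∀ u v, I.adj u v → I.adj v u) {p u v : ℕ}
    (h : I.Reach ell p u v) : I.top ell p u = I.top ell p v := by
  induction h with
  | refl => rfl
  | @tail x y _ h ih =>
    rw [ih]
    have hr : I.Reach ell p x y := .single h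
    have hx := Finset.mem_Icc.1 h.1
    have hy := Finset.mem_Icc.1 h.2.1
    obtain ⟨k, rfl | rfl⟩ := hE x h.1 y h.2.1 h.2.2.2.2
    · exact top_eq_of_anc hT hs h.1 (by omega) hr
    · exact (top_eq_of_anc hT hs h.2.1 (by omega) (hr.symm hs)).symm

include hT in
theorem lastOld_spec {p u : ℕ} (hu : u ∈ Finset.Icc 1 I.nv) (hp : p ≤ ell u)
    (h : I.top ell p u ≠ u) :
    p ≤ I.lastOld ell u ∧ I.lastOld ell u ≤ ell u ∧ 1 ≤ I.topIdx ell (I.lastOld ell u) u ∧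
      I.topIdx ell (I.lastOld ell u) u ≤ I.dd := by
  classical
  have h1 : I.top ell (I.lastOld ell u) u ≠ u :=
    Nat.findGreatest_spec (P := fun q => I.top ell q u ≠ u) hp h
  refine ⟨Nat.le_findGreatest hp h, Nat.findGreatest_le _, ?_, ?_⟩
  · by_contra h2
    exact h1 (by rw [top, show I.topIdx ell (I.lastOld ell u) u = 0 from by omega]; rfl)
  · by_contra h2
    have hu' := Finset.mem_Icc.1 hu
    refine (topIdx_spec (I := I) (ell := ell) (p := I.lastOld ell u) (u := u) (by omega)).1 ?_
    exact iterate_eq_zero hT hu'.2 (by omega)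

include hT in
theorem base_of_digits {δ : ℕ → ℕ → ℕ} {p u : ℕ} (hu : u ∈ Finset.Icc 1 I.nv) (hp : p ≤ ell u)
    (h : I.top ell p u ≠ u) (hδ : ∀ i < 2 * I.dd, δ u i = I.digitOf ell u i) :
    I.base δ u = I.top ell (I.lastOld ell u) u := by
  obtain ⟨-, -, h1, h2⟩ := lastOld_spec hT hu hp h
  set t := I.topIdx ell (I.lastOld ell u) u with ht
  have key : ∀ q ≤ I.dd, I.walk δ u q = I.par^[1 + min q (t - 1)] u := by
    intro q
    induction q with
    | zero => intro _; simp [walk]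
    | succ q ih =>
      intro hq
      have hd : δ u (I.dd + q) = if q + 1 < t then 1 else 0 := by
        rw [hδ _ (by omega), digitOf, if_neg (by omega), Nat.add_sub_cancel_left]
      simp only [walk, hd, ih (by omega)]
      by_cases hc : q + 1 < t
      · simp only [if_pos hc]
        rw [if_pos one_ne_zero, ← Function.iterate_succ_apply' I.par]
        congr 1; omega
      · simp only [if_neg hc]
        rw [if_neg (by simp)]
        congr 1; omega
  rw [base, key _ le_rfl, top, ← ht]
  congr 1; omega

-- The base is the representative at an index at least `p`, so it lies in the same component as `u`
-- at `p` too. Both have the same representative, and induction on the level applies to the base.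
include hT in
theorem cr_of_digits {δ : ℕ → ℕ → ℕ} (h0 : ∀ q, δ 0 q = 0) (hE : I.Elim)
    (hs : ∀ u v, I.adj u v → I.adj v u)
    (hδ : ∀ u ∈ Finset.Icc 1 I.nv, ∀ i < 2 * I.dd, δ u i = I.digitOf ell u i)
    {p u : ℕ} (hu : u ∈ Finset.Icc 1 I.nv) (hp : p ≤ ell u) (hpd : p < I.dd) :
    I.cr δ u p = I.top ell p u := by
  classical
  induction hl : lvl u using Nat.strong_induction_on generalizing u with
  | _ n ih =>
    have hu' := Finset.mem_Icc.1 hu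
    rw [cr_eq hT h0 hu'.2, hδ u hu p (by omega), digitOf, if_pos hpd,
      if_neg (show ¬ ell u < p by omega)]
    by_cases h : I.top ell p u ≠ u
    · rw [if_pos h, if_pos rfl]
      obtain ⟨h1, h2, -, -⟩ := lastOld_spec hT hu hp h
      have hb := base_of_digits hT hu hp h (hδ u hu)
      have hsp := topIdx_spec (I := I) (ell := ell) (p := I.lastOld ell u) (u := u) (by omega)
      have hm := hsp.2.mem hu h2
      rw [hb, ih _ ?_ hm.1 (h1.trans hm.2) rfl]
      · exact ((hsp.2.mono h1).top_eq hT hE hs).symm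
      · rw [← hl, ← hb]; exact lvl_base hT hu'.2 (by omega)
    · rw [if_neg h]
      push Not at h
      have h2 : (if ∃ w ∈ Finset.Icc 1 I.nv, I.Reach ell p u w ∧ ell w = p then 2 else 0) ≠ 1 := by
        split_ifs <;> omega
      rw [if_neg h2, h]

-- Nodes are the components at some index `p` that contain a vertex of height index `p`. By
-- `Reach.eq` this vertex is unique, so the vertices occupy the nodes bijectively.
include hT in
theorem sol_of_elimOrder (hE : I.Elim) (hs : ∀ u v, I.adj u v → I.adj v u)
    {anc : ℕ → ℕ → Prop} (hO : ElimOrder I.nv I.dd I.adj ell anc)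
    (hL : Respects I.nv I.lab ell) {δ : ℕ → ℕ → ℕ} (h0 : ∀ q, δ 0 q = 0)
    (hδ : ∀ u ∈ Finset.Icc 1 I.nv, ∀ i < 2 * I.dd, δ u i = I.digitOf ell u i) :
    I.Sol δ ∧ (I.nodes δ).card = I.nv := by
  classical
  have hcr : ∀ {p u}, u ∈ Finset.Icc 1 I.nv → p ≤ ell u → p < I.dd → I.cr δ u p = I.top ell p u :=
    fun hu hp hpd => cr_of_digits hT h0 hE hs hδ hu hp hpd
  have hd : ∀ {p u}, u ∈ Finset.Icc 1 I.nv → p < I.dd → δ u p = I.digitOf ell u p :=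
    fun hu hp => hδ _ hu _ (by omega)
  have hne : ∀ {u}, u ∈ Finset.Icc 1 I.nv → u ≠ 0 := fun hu => by
    have := Finset.mem_Icc.1 hu; omega
  have hell : ∀ u ∈ Finset.Icc 1 I.nv, I.ell δ u = ell u := by
    intro u hu
    have hlt := hO.lt u hu
    refine lastNZ_eq hlt ?_ ?_
    · rw [hd hu hlt, digitOf, if_pos hlt, if_neg (by omega)]
      by_cases h : I.top ell (ell u) u ≠ u
      · rw [if_pos h]; omega
      · rw [if_neg h, if_pos ⟨u, hu, .refl, rfl⟩]; omega
    · intro i hi hi'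
      rw [hd hu hi', digitOf, if_pos hi', if_pos hi]
  have htop : ∀ {p u}, u ∈ Finset.Icc 1 I.nv → p ≤ ell u →
      I.Reach ell p u (I.top ell p u) ∧ I.top ell p u ∈ Finset.Icc 1 I.nv ∧
      p ≤ ell (I.top ell p u) ∧ I.top ell p (I.top ell p u) = I.top ell p u := by
    intro p u hu hp
    have h := (topIdx_spec (I := I) (ell := ell) (p := p) (hne hu)).2
    exact ⟨h, (h.mem hu hp).1, (h.mem hu hp).2, (h.top_eq hT hE hs).symm⟩
  have hpos : ∀ u ∈ Finset.Icc 1 I.nv, I.pos δ u = (I.top ell (ell u) u, ell u) := by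
    intro u hu
    rw [pos, hell u hu, hcr hu le_rfl (hO.lt u hu)]
  have hflag : ∀ u ∈ Finset.Icc 1 I.nv, δ (I.top ell (ell u) u) (ell u) = 2 := by
    intro u hu
    obtain ⟨h1, h2, h3, h4⟩ := htop hu le_rfl
    rw [hd h2 (hO.lt u hu), digitOf, if_pos (hO.lt u hu), if_neg (by omega), if_neg (by simp [h4]),
      if_pos ⟨u, hu, h1.symm hs, rfl⟩]
  have hvalid : ∀ u ∈ Finset.Icc 1 I.nv, I.Valid δ u := by
    intro u hu
    refine ⟨?_, ?_, ?_, ?_⟩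
    · intro q hq h1
      rw [hd hu hq, digitOf, if_pos hq] at h1
      have hq' : q < I.dd := by omega
      rw [hd hu hq', digitOf, if_pos hq']
      have h2 : ¬ ell u < q + 1 := by
        intro h; rw [if_pos h] at h1; omega
      rw [if_neg h2] at h1
      rw [if_neg (by omega), if_pos]
      intro h3
      by_cases h4 : I.top ell (q + 1) u ≠ u
      · have h5 := topIdx_spec (I := I) (ell := ell) (p := q + 1) (hne hu)
        -- Lowering the index enlarges the component, so its top can only move up. If it were `u` at
        -- index `q`, an iterate of `par` of positive order would fix `u`, against the levels.
        have h6 : I.topIdx ell (q + 1) u ≤ I.topIdx ell q u :=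
          le_topIdx hT hu h5.1 (h5.2.mono (by omega))
        have h7 := (lastOld_spec hT hu (by omega) h4)
        have h8 : I.topIdx ell (q + 1) u ≠ 0 := by
          intro h; exact h4 (by rw [top, h]; rfl)
        have h9 : I.par^[I.topIdx ell q u] u = u := h3
        have h10 := iterate_lvl hT (Finset.mem_Icc.1 hu).2 (I.topIdx ell q u)
          (by rw [h9]; exact hne hu)
        rw [h9] at h10
        omega
      · rw [if_neg h4] at h1
        split_ifs at h1
        omega
    · rw [hell u hu]; exact hL u hu
    · have := hflag u hu
      rw [hell u hu, hcr hu le_rfl (hO.lt u hu)]; exact this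
    · intro k _ hk hadj
      have hx : I.par^[k + 1] u ∈ Finset.Icc 1 I.nv :=
        Finset.mem_Icc.2 ⟨by omega, anc_le hT (Finset.mem_Icc.1 hu).2 _⟩
      generalize I.par^[k + 1] u = x at hk hadj hx
      have hlu := hO.lt u hu
      rw [Fits, hell u hu, hell x hx]
      refine ⟨(hO.ne u hu x hx hadj).symm, ?_⟩
      rw [hcr hx (min_le_left _ _) (by omega), hcr hu (min_le_right _ _) (by omega)]
      exact Reach.top_eq hT hE hs
        (.single ⟨hx, hu, min_le_left _ _, min_le_right _ _, hs _ _ hadj⟩)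
  have hsub : I.nodes δ ⊆ (Finset.Icc 1 I.nv).image (I.pos δ) := by
    rintro ⟨z, p⟩ hz
    simp only [nodes, Finset.mem_filter, Finset.mem_product, Finset.mem_range] at hz
    obtain ⟨⟨hz1, hz2⟩, hz3⟩ := hz
    rw [hd hz1 hz2, digitOf, if_pos hz2] at hz3
    by_cases h1 : ell z < p
    · rw [if_pos h1] at hz3; omega
    · rw [if_neg h1] at hz3
      by_cases h2 : I.top ell p z ≠ z
      · rw [if_pos h2] at hz3; omega
      · rw [if_neg h2] at hz3
        push Not at h2
        by_cases h3 : ∃ w ∈ Finset.Icc 1 I.nv, I.Reach ell p z w ∧ ell w = p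
        · obtain ⟨w, hw, hr, hlw⟩ := h3
          refine Finset.mem_image.2 ⟨w, hw, ?_⟩
          rw [hpos w hw, hlw, ← hr.top_eq hT hE hs, h2]
        · rw [if_neg h3] at hz3; omega
  have hinj : Set.InjOn (I.pos δ) (Finset.Icc 1 I.nv) := by
    intro u hu v hv h
    rw [hpos u hu, hpos v hv, Prod.mk.injEq] at h
    have h1 := htop hu le_rfl
    have h2 := htop (p := ell u) hv h.2.le
    refine Reach.eq hO (h1.1.trans ?_) hu rfl h.2.symm
    rw [h.1, ← h.2]
    exact h2.1.symm hs
  refine ⟨⟨hvalid, hsub⟩, ?_⟩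
  have : I.nodes δ = (Finset.Icc 1 I.nv).image (I.pos δ) := by
    refine hsub.antisymm fun x hx => ?_
    obtain ⟨u, hu, rfl⟩ := Finset.mem_image.1 hx
    rw [hpos u hu]
    simp only [nodes, Finset.mem_filter, Finset.mem_product, Finset.mem_range]
    exact ⟨⟨(htop hu le_rfl).2.1, hO.lt u hu⟩, Or.inl (hflag u hu)⟩
  rw [this, Finset.card_image_of_injOn hinj, Nat.card_Icc]; omega

include hT in
theorem exists_code_sol (hE : I.Elim) (hs : ∀ u v, I.adj u v → I.adj v u)
    {anc : ℕ → ℕ → Prop} (hO : ElimOrder I.nv I.dd I.adj ell anc)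
    (hL : Respects I.nv I.lab ell) :
    ∃ γ ∈ codesOn I.nv (4 ^ (2 * I.dd)) (Finset.Icc 1 I.nv),
      I.Sol (dgt (extend γ)) ∧ (I.nodes (dgt (extend γ))).card = I.nv := by
  have h4 : ∀ u i, I.digitOf ell u i < 4 := by
    intro u i
    unfold digitOf
    split_ifs <;> omega
  choose c hc hcd using fun u => exists_code (I.digitOf ell u) (h4 u) (2 * I.dd)
  refine ⟨fun v => if v.val = 0 then 0 else c v.val, ?_, sol_of_elimOrder hT hE hs hO hL ?_ ?_⟩
  · simp only [codesOn, Fintype.mem_piFinset]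
    intro v
    by_cases hv : v.val = 0
    · simp [hv]
    · have := v.2
      simp [hv, show 1 ≤ v.val by omega, show v.val ≤ I.nv by omega, hc]
  · intro q
    simp [dgt, extend]
  · intro u hu i hi
    have hu' := Finset.mem_Icc.1 hu
    rw [← hcd u i hi, dgt, extend, dif_pos (by omega), if_neg (by simp; omega)]

end

end Inst

end TD

namespace TD

/-! ### Inclusion and exclusion -/

/-- The number `4 ^ q` is bit `2 * q`, the lower bit of digit `q`; toggling it exchanges the flags 2
and 3 and affects no other digit. -/
theorem xor_div_mod_four (c q i : ℕ) :
    (c ^^^ 4 ^ q) / 4 ^ i % 4 = if i = q then (c / 4 ^ i % 4) ^^^ 1 else c / 4 ^ i % 4 := by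
  have h4 : ∀ j, 4 ^ j = 2 ^ (2 * j) := fun j => by rw [pow_mul]; norm_num
  have hm : ∀ x : ℕ, x % 4 = x % 2 ^ 2 := fun x => by norm_num
  rw [h4, h4, hm, hm, ← Nat.shiftRight_eq_div_pow, ← Nat.shiftRight_eq_div_pow,
    Nat.shiftRight_xor_distrib, Nat.xor_mod_two_pow]
  have key : (2 ^ (2 * q)) >>> (2 * i) % 2 ^ 2 = if i = q then 1 else 0 := by
    rw [Nat.shiftRight_eq_div_pow]
    split_ifs with h
    · subst h; rw [Nat.div_self (by positivity)]; norm_num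
    · rcases Nat.lt_or_gt_of_ne h with h | h
      · rw [Nat.pow_div (by omega) (by norm_num), show 2 * q - 2 * i = 2 * (q - i - 1) + 2 by omega,
          pow_add, Nat.mul_mod_left]
      · rw [Nat.div_eq_of_lt (Nat.pow_lt_pow_right (by norm_num) (by omega)), Nat.zero_mod]
  rw [key]
  split_ifs <;> simp

namespace Inst

variable {I : Inst}

/-- Two configurations that differ only in the flag of the node `x`. -/
structure FlipAt (δ δ' : ℕ → ℕ → ℕ) (x : ℕ × ℕ) : Prop where
  off : ∀ z i, (z, i) ≠ x → δ' z i = δ z i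
  on : δ x.1 x.2 = 2 ∧ δ' x.1 x.2 = 3 ∨ δ x.1 x.2 = 3 ∧ δ' x.1 x.2 = 2

section

variable {δ δ' : ℕ → ℕ → ℕ} {x : ℕ × ℕ} (h : FlipAt δ δ' x)

include h in
theorem FlipAt.ne_zero (z i : ℕ) : δ z i ≠ 0 ↔ δ' z i ≠ 0 := by
  by_cases hz : (z, i) = x
  · have := h.on; subst hz; simp only at this; omega
  · rw [h.off z i hz]

include h in
theorem FlipAt.eq_one (z i : ℕ) : δ z i = 1 ↔ δ' z i = 1 := by
  by_cases hz : (z, i) = x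
  · have := h.on; subst hz; simp only at this; omega
  · rw [h.off z i hz]

-- Chains and height indices only ask whether digits are 0 or 1 and never distinguish 2 from 3. The
-- placement of all vertices is therefore independent of the flags.
include h in
theorem FlipAt.cr_eq (u p : ℕ) : I.cr δ u p = I.cr δ' u p :=
  follow_congr (fun _ _ => h.ne_zero _ _) (fun _ => h.eq_one _ _) _

include h in
theorem FlipAt.ell_eq (u : ℕ) : I.ell δ u = I.ell δ' u := lastNZ_congr fun _ _ => h.ne_zero _ _

include h in
theorem FlipAt.pos_eq (u : ℕ) : I.pos δ u = I.pos δ' u := by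
  simp only [pos, h.ell_eq, h.cr_eq]

include h in
theorem FlipAt.nodes_eq : I.nodes δ = I.nodes δ' := by
  ext ⟨z, i⟩
  simp only [nodes, Finset.mem_filter]
  by_cases hz : (z, i) = x
  · have := h.on; subst hz; simp only at this ⊢
    simp only [and_congr_right_iff]; omega
  · rw [h.off z i hz]

include h in
theorem FlipAt.valid_iff {u : ℕ} (hu : I.pos δ u ≠ x) : I.Valid δ u ↔ I.Valid δ' u := by
  have h1 : δ' (I.cr δ' u (I.ell δ' u)) (I.ell δ' u) = δ (I.cr δ' u (I.ell δ' u)) (I.ell δ' u) := by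
    rw [h.pos_eq] at hu
    exact h.off _ _ hu
  simp only [Valid, Fits, h.eq_one, h.ell_eq, h.cr_eq, h1]

-- No vertex sits at `x`, so all validity conditions survive the flip and only the factor `X` or
-- `-X` of `x` itself changes sign.
include h in
theorem FlipAt.prod_weight {R : Type*} [CommRing R] (X : R) (hx1 : x.1 ∈ Finset.Icc 1 I.nv)
    (hx2 : x.2 < I.dd) (hx : ∀ u ∈ Finset.Icc 1 I.nv, I.pos δ u ≠ x) :
    ∏ u ∈ Finset.Icc 1 I.nv, I.weight X δ' u = -∏ u ∈ Finset.Icc 1 I.nv, I.weight X δ u := by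
  classical
  rw [← Finset.mul_prod_erase _ _ hx1, ← Finset.mul_prod_erase _ _ hx1, ← neg_mul]
  congr 1
  · unfold weight
    by_cases hv : I.Valid δ x.1
    · rw [if_pos hv, if_pos ((h.valid_iff (hx _ hx1)).1 hv),
        ← Finset.mul_prod_erase _ _ (Finset.mem_range.2 hx2),
        ← Finset.mul_prod_erase _ _ (Finset.mem_range.2 hx2), ← neg_mul]
      congr 1
      · rcases h.on with ⟨h1, h2⟩ | ⟨h1, h2⟩ <;> simp [h1, h2, fac]
      · refine Finset.prod_congr rfl fun q hq => ?_
        rw [h.off]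
        intro h'
        exact (Finset.mem_erase.1 hq).1 (by rw [← h'])
    · rw [if_neg hv, if_neg (fun h' => hv ((h.valid_iff (hx _ hx1)).2 h')), neg_zero]
  · refine Finset.prod_congr rfl fun u hu => ?_
    have hu' := Finset.mem_erase.1 hu
    unfold weight
    have hd : ∀ q, δ' u q = δ u q := fun q => h.off u q (fun h' => hu'.1 (by rw [← h']))
    simp only [h.valid_iff (hx u hu'.2), hd]

end

/-- In a solution every node is occupied and occupied nodes are allowed, so digit 3 does not occur
and every node contributes `X`. -/
theorem prod_weight_of_sol {R : Type*} [CommRing R] (X : R) {δ : ℕ → ℕ → ℕ}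
    (hS : I.Sol δ) :
    ∏ u ∈ Finset.Icc 1 I.nv, I.weight X δ u = X ^ (I.nodes δ).card := by
  have h3 : ∀ u ∈ Finset.Icc 1 I.nv, ∀ q < I.dd, δ u q ≠ 3 := by
    intro u hu q hq h
    have hm : (u, q) ∈ I.nodes δ := by
      simp only [nodes, Finset.mem_filter, Finset.mem_product, Finset.mem_range]
      exact ⟨⟨hu, hq⟩, Or.inr h⟩
    obtain ⟨v, hv, hp⟩ := Finset.mem_image.1 (hS.2 hm)
    have := (hS.1 v hv).2.2.1
    simp only [pos, Prod.mk.injEq] at hp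
    rw [hp.1, hp.2] at this
    omega
  have h1 : ∀ u ∈ Finset.Icc 1 I.nv, I.weight X δ u =
      ∏ q ∈ Finset.range I.dd, if δ u q = 2 ∨ δ u q = 3 then X else 1 := by
    intro u hu
    rw [weight, if_pos (hS.1 u hu)]
    refine Finset.prod_congr rfl fun q hq => ?_
    have := h3 u hu q (Finset.mem_range.1 hq)
    simp [fac, this]
  rw [Finset.prod_congr rfl h1, ← Finset.prod_product'
    (f := fun u q => if δ u q = 2 ∨ δ u q = 3 then X else 1), Finset.prod_ite, Finset.prod_const,
    Finset.prod_const_one, mul_one, nodes]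

variable (I) in
/-- The codes of all configurations. -/
def codes : Finset (Fin (I.nv + 1) → ℕ) := codesOn I.nv (4 ^ (2 * I.dd)) (Finset.Icc 1 I.nv)

/-- Changes the flag of the node `x`. -/
def flip (γ : Fin (I.nv + 1) → ℕ) (x : Fin (I.nv + 1) × ℕ) : Fin (I.nv + 1) → ℕ :=
  Function.update γ x.1 (γ x.1 ^^^ 4 ^ x.2)

theorem flip_flip (γ : Fin (I.nv + 1) → ℕ) (x : Fin (I.nv + 1) × ℕ) : flip (flip γ x) x = γ := by
  simp [flip]

theorem flip_ne (γ : Fin (I.nv + 1) → ℕ) (x : Fin (I.nv + 1) × ℕ) : flip γ x ≠ γ := by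
  intro h
  have h1 := congrFun h x.1
  simp only [flip, Function.update_self] at h1
  have h2 := congrArg (γ x.1 ^^^ ·) h1
  simp only [← Nat.xor_assoc, Nat.xor_self, Nat.zero_xor] at h2
  exact absurd h2 (by positivity)

theorem mem_codes {γ : Fin (I.nv + 1) → ℕ} : γ ∈ I.codes ↔
    ∀ v, γ v < 4 ^ (2 * I.dd) ∧ (v.val = 0 → γ v = 0) := by
  simp only [codes, codesOn, Fintype.mem_piFinset]
  refine forall_congr' fun v => ?_
  have := v.2
  by_cases hv : v.val = 0
  · simp only [hv, Finset.mem_Icc, show ¬ (1 ≤ 0 ∧ 0 ≤ I.nv) by omega, if_false,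
      Finset.mem_singleton]
    constructor
    · intro h; rw [h]; exact ⟨by positivity, fun _ => rfl⟩
    · exact fun h => h.2 trivial
  · simp [hv, show 1 ≤ v.val by omega, show v.val ≤ I.nv by omega]

theorem flip_mem {γ : Fin (I.nv + 1) → ℕ} {x : Fin (I.nv + 1) × ℕ} (hγ : γ ∈ I.codes)
    (h1 : x.1.val ≠ 0) (h2 : x.2 < I.dd) : flip γ x ∈ I.codes := by
  rw [mem_codes] at hγ ⊢
  intro v
  by_cases hv : v = x.1
  · subst hv
    refine ⟨?_, fun h => absurd h h1⟩
    have h4 : ∀ j, 4 ^ j = 2 ^ (2 * j) := fun j => by rw [pow_mul]; norm_num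
    simp only [flip, Function.update_self]
    have h3 := (hγ x.1).1
    rw [h4 (2 * I.dd)] at h3 ⊢
    refine Nat.xor_lt_two_pow h3 ?_
    rw [h4]
    exact Nat.pow_lt_pow_right (by norm_num) (by omega)
  · simp only [flip, Function.update_of_ne hv]; exact hγ v

theorem dgt_flip (γ : Fin (I.nv + 1) → ℕ) (x : Fin (I.nv + 1) × ℕ) (z i : ℕ) :
    dgt (extend (flip γ x)) z i =
      if (z, i) = (x.1.val, x.2) then dgt (extend γ) z i ^^^ 1 else dgt (extend γ) z i := by
  rw [flip, extend_update]
  by_cases hz : z = x.1.val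
  · subst hz
    simp only [dgt, Function.update_self]
    have : extend γ x.1.val = γ x.1 := by rw [extend, dif_pos x.1.2]
    rw [this, xor_div_mod_four]
    simp
  · simp [dgt, hz]

theorem flipAt_flip {γ : Fin (I.nv + 1) → ℕ} {x : Fin (I.nv + 1) × ℕ}
    (h : (x.1.val, x.2) ∈ I.nodes (dgt (extend γ))) :
    FlipAt (dgt (extend γ)) (dgt (extend (flip γ x))) (x.1.val, x.2) := by
  refine ⟨fun z i hz => by rw [dgt_flip, if_neg hz], ?_⟩
  simp only [nodes, Finset.mem_filter] at h
  simp only [dgt_flip, if_true]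
  rcases h.2 with h | h
  · left; rw [h]; exact ⟨rfl, rfl⟩
  · right; rw [h]; exact ⟨rfl, rfl⟩

theorem extend_zero {γ : Fin (I.nv + 1) → ℕ} (hγ : γ ∈ I.codes) (q : ℕ) :
    dgt (extend γ) 0 q = 0 := by
  have : extend γ 0 = 0 := by
    rw [extend, dif_pos (by omega)]
    exact (mem_codes.1 hγ _).2 rfl
  simp [dgt, this]

variable (I) in
/-- The nodes without a vertex. -/
def unhit (γ : Fin (I.nv + 1) → ℕ) : Finset (ℕ × ℕ) :=
  I.nodes (dgt (extend γ)) \ (Finset.Icc 1 I.nv).image (I.pos (dgt (extend γ)))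

open Classical in
/-- A choice of an element. -/
noncomputable def pick {n : ℕ} (S : Finset (ℕ × ℕ)) : Fin (n + 1) × ℕ :=
  if h : S.Nonempty then (Fin.ofNat (n + 1) h.choose.1, h.choose.2) else (0, 0)

theorem pick_mem {γ : Fin (I.nv + 1) → ℕ} (h : (I.unhit γ).Nonempty) :
    ((pick (n := I.nv) (I.unhit γ)).1.val, (pick (n := I.nv) (I.unhit γ)).2) ∈ I.unhit γ := by
  have h1 := h.choose_spec
  have h2 : h.choose.1 ≤ I.nv := by
    have := (Finset.mem_sdiff.1 h1).1
    simp only [nodes, Finset.mem_filter, Finset.mem_product, Finset.mem_Icc] at this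
    exact this.1.1.2
  simp only [pick, dif_pos h, Fin.ofNat, Nat.mod_eq_of_lt (Nat.lt_succ_of_le h2)]
  exact h1

theorem mem_unhit {γ : Fin (I.nv + 1) → ℕ} {x : ℕ × ℕ} (h : x ∈ I.unhit γ) :
    x.1 ∈ Finset.Icc 1 I.nv ∧ x.2 < I.dd ∧
      ∀ u ∈ Finset.Icc 1 I.nv, I.pos (dgt (extend γ)) u ≠ x := by
  have h1 := Finset.mem_sdiff.1 h
  have h2 := h1.1
  simp only [nodes, Finset.mem_filter, Finset.mem_product, Finset.mem_range] at h2
  exact ⟨h2.1.1, h2.1.2, fun u hu he => h1.2 (Finset.mem_image.2 ⟨u, hu, he⟩)⟩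

/-- Since the set of unoccupied nodes is invariant, `pick` selects the same node after the flip;
this is what makes the flip an involution. -/
theorem unhit_flip {γ : Fin (I.nv + 1) → ℕ} {x : Fin (I.nv + 1) × ℕ}
    (h : (x.1.val, x.2) ∈ I.unhit γ) : I.unhit (flip γ x) = I.unhit γ := by
  have hf := flipAt_flip (Finset.mem_sdiff.1 h).1
  unfold unhit
  rw [hf.nodes_eq]
  congr 1
  exact Finset.image_congr fun u _ => (hf.pos_eq u).symm

/-- Toggling the flag of the picked unoccupied node is a sign-reversing involution without fixed
points. -/
theorem sum_unhit {R : Type*} [CommRing R] (X : R) :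
    ∑ γ ∈ I.codes.filter (fun γ => (I.unhit γ).Nonempty),
      ∏ u ∈ Finset.Icc 1 I.nv, I.weight X (dgt (extend γ)) u = 0 := by
  refine Finset.sum_involution (fun γ _ => flip γ (pick (I.unhit γ))) ?_ ?_ ?_ ?_
  · intro γ hγ
    have h := pick_mem (Finset.mem_filter.1 hγ).2
    obtain ⟨h1, h2, h3⟩ := mem_unhit h
    rw [(flipAt_flip (Finset.mem_sdiff.1 h).1).prod_weight X h1 h2 h3, add_neg_cancel]
  · intro γ _ _
    exact flip_ne _ _
  · intro γ hγ
    rw [Finset.mem_filter] at hγ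
    have h := pick_mem hγ.2
    have hm := mem_unhit h
    have := Finset.mem_Icc.1 hm.1
    rw [Finset.mem_filter, unhit_flip h]
    exact ⟨flip_mem hγ.1 (by omega) hm.2.1, hγ.2⟩
  · intro γ hγ
    have h := pick_mem (Finset.mem_filter.1 hγ).2
    rw [unhit_flip h, flip_flip]

-- After the cancellation only configurations with all nodes occupied remain; among them, one with
-- an invalid vertex has product 0.
open Classical in
theorem sum_prod_weight {R : Type*} [CommRing R] (X : R) :
    ∑ γ ∈ I.codes, ∏ u ∈ Finset.Icc 1 I.nv, I.weight X (dgt (extend γ)) u =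
      ∑ γ ∈ I.codes.filter (fun γ => I.Sol (dgt (extend γ))),
        X ^ (I.nodes (dgt (extend γ))).card := by
  have hU : ∀ γ, (I.unhit γ).Nonempty ↔ ¬ I.nodes (dgt (extend γ)) ⊆
      (Finset.Icc 1 I.nv).image (I.pos (dgt (extend γ))) := fun γ => by
    rw [Finset.nonempty_iff_ne_empty, Ne, unhit, Finset.sdiff_eq_empty_iff_subset]
  rw [← Finset.sum_filter_add_sum_filter_not I.codes fun γ => (I.unhit γ).Nonempty, sum_unhit,
    zero_add]
  symm
  refine Finset.sum_subset_zero_on_sdiff ?_ ?_ ?_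
  · intro γ hγ
    rw [Finset.mem_filter] at hγ ⊢
    exact ⟨hγ.1, by rw [hU, not_not]; exact hγ.2.2⟩
  · intro γ hγ
    simp only [Finset.mem_sdiff, Finset.mem_filter, not_and] at hγ
    have : ¬ ∀ u ∈ Finset.Icc 1 I.nv, I.Valid (dgt (extend γ)) u :=
      fun h => hγ.2 hγ.1.1 ⟨h, by have := hγ.1.2; rwa [hU, not_not] at this⟩
    push Not at this
    obtain ⟨u, hu, hv⟩ := this
    exact Finset.prod_eq_zero hu (by rw [weight, if_neg hv])
  · intro γ hγ
    rw [Finset.mem_filter] at hγ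
    exact (prod_weight_of_sol X hγ.2).symm

end Inst

end TD

namespace TD

/-! ### Detecting configurations by counting modulo small numbers -/

/-- Every prime power dividing the central binomial coefficient of `r` is at most `2 * r`. If all
numbers up to `2 * r` divided `N`, so would this coefficient, which is at least `4 ^ r / (2 * r) ≥ 2
^ r > N`. -/
theorem exists_not_dvd {N r : ℕ} (hN : 0 < N) (hr : 1 ≤ r) (h : N < 2 ^ r) :
    ∃ m, 1 ≤ m ∧ m ≤ 2 * r ∧ ¬ m ∣ N := by
  by_contra hcon
  push Not at hcon
  have h1 : r.centralBinom ∣ N := by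
    rw [Nat.dvd_iff_prime_pow_dvd_dvd]
    intro p k hp hk
    refine hcon _ (Nat.one_le_pow _ _ hp.pos) ?_
    rw [hp.pow_dvd_iff_le_factorization (Nat.centralBinom_ne_zero r)] at hk
    calc p ^ k ≤ p ^ (r.centralBinom.factorization p) := Nat.pow_le_pow_right hp.pos hk
      _ ≤ 2 * r := by
        rw [Nat.centralBinom_eq_two_mul_choose]
        exact Nat.pow_factorization_choose_le (by omega)
  have h2 := Nat.le_of_dvd hN h1
  have h3 := Nat.four_pow_le_two_mul_self_mul_centralBinom r (by omega)
  have h4 : 4 ^ r = 2 ^ r * 2 ^ r := by rw [← mul_pow]; norm_num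
  have h5 : 2 * r ≤ 2 ^ r := by
    clear h h2 h3 h4 h1 hcon
    induction r with
    | zero => omega
    | succ r ih =>
      rcases Nat.eq_zero_or_pos r with h | h
      · subst h; norm_num
      · have := ih h; rw [pow_succ]; omega
  have h6 : 4 ^ r < 2 ^ r * 2 ^ r := by
    calc 4 ^ r ≤ 2 * r * r.centralBinom := h3
      _ ≤ 2 ^ r * N := Nat.mul_le_mul h5 h2
      _ < 2 ^ r * 2 ^ r := Nat.mul_lt_mul_of_pos_left h (by positivity)
  omega

-- The `n`-th difference kills lower powers and turns `x ^ n` into `n!`. It extracts the top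
-- coefficient from values at integers, without division, so it also works modulo `m`.
open Classical in
theorem iter_fwdDiff_sum_pow {ι : Type*} (S : Finset ι) (e : ι → ℕ) (n : ℕ)
    (he : ∀ i ∈ S, e i ≤ n) (x : ℤ) :
    (fwdDiff (1 : ℤ))^[n] (fun x => ∑ i ∈ S, x ^ e i) x =
      (n.factorial : ℤ) * ((S.filter fun i => e i = n).card : ℤ) := by
  have h1 : (fun x : ℤ => ∑ i ∈ S, x ^ e i) = ∑ i ∈ S, fun x : ℤ => x ^ e i := by
    funext x; simp
  rw [h1, fwdDiff_iter_finsetSum, Finset.sum_apply, Finset.card_filter, Nat.cast_sum,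
    Finset.mul_sum]
  refine Finset.sum_congr rfl fun i hi => ?_
  rcases Nat.lt_or_eq_of_le (he i hi) with h | h
  · rw [fwdDiff_iter_pow_eq_zero_of_lt h]; simp [h.ne]
  · rw [h, fwdDiff_iter_eq_factorial]; simp

namespace Inst

variable (I : Inst)

open Classical in
/-- The generating function of the solutions by the number of nodes. -/
noncomputable def genFun (x : ℤ) : ℤ :=
  ∑ γ ∈ I.codes.filter (fun γ => I.Sol (dgt (extend γ))), x ^ (I.nodes (dgt (extend γ))).card

/-- The leading difference of the generating function. -/
noncomputable def leading : ℤ := (fwdDiff (1 : ℤ))^[I.nv] I.genFun 0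

variable {I}

theorem card_nodes_le {δ : ℕ → ℕ → ℕ} (hS : I.Sol δ) : (I.nodes δ).card ≤ I.nv := by
  calc (I.nodes δ).card ≤ _ := Finset.card_le_card hS.2
    _ ≤ (Finset.Icc 1 I.nv).card := Finset.card_image_le
    _ = I.nv := by simp

/-- Here `N` counts the codes of solutions with exactly `nv` nodes. Nothing cancels among these, so
`N` vanishes only if there are none; the number of all codes bounds it. -/
theorem exists_leading : ∃ N : ℕ, I.leading = ((I.nv.factorial * N : ℕ) : ℤ) ∧
    N ≤ (4 ^ (2 * I.dd)) ^ (I.nv + 1) ∧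
    (0 < N ↔ ∃ γ ∈ I.codes, I.Sol (dgt (extend γ)) ∧ (I.nodes (dgt (extend γ))).card = I.nv) := by
  classical
  refine ⟨((I.codes.filter (fun γ => I.Sol (dgt (extend γ)))).filter
      fun γ => (I.nodes (dgt (extend γ))).card = I.nv).card, ?_, ?_, ?_⟩
  · rw [leading, Nat.cast_mul]
    exact iter_fwdDiff_sum_pow _ _ _ (fun γ hγ => card_nodes_le (Finset.mem_filter.1 hγ).2) 0
  · calc _ ≤ I.codes.card := (Finset.card_filter_le _ _).trans (Finset.card_filter_le _ _)
      _ ≤ _ := by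
        rw [codes, codesOn, Fintype.card_piFinset]
        refine (Finset.prod_le_prod' (g := fun _ => 4 ^ (2 * I.dd)) fun v _ => ?_).trans ?_
        · split_ifs
          · simp
          · simp only [Finset.card_singleton]; exact Nat.one_le_pow _ _ (by norm_num)
        · simp
  · rw [Finset.card_pos]
    constructor
    · rintro ⟨γ, hγ⟩
      simp only [Finset.mem_filter] at hγ
      exact ⟨γ, hγ.1.1, hγ.1.2, hγ.2⟩
    · rintro ⟨γ, h1, h2, h3⟩
      exact ⟨γ, by simp only [Finset.mem_filter]; exact ⟨⟨h1, h2⟩, h3⟩⟩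

/-- There is an elimination order that respects the labels if and only if the leading difference
does not vanish modulo some small number. -/
theorem exists_elimOrder_iff {lvl : ℕ → ℕ} (hT : RTree I.nv (I.dd + 1) I.par lvl)
    (hdd : 0 < I.dd) (hE : I.Elim) (hs : ∀ u v, I.adj u v → I.adj v u) {n : ℕ} (hn : I.nv ≤ n)
    (hdn : I.dd ≤ n) :
    (∃ m < 16 * (n + 1) ^ 2, ((I.leading : ℤ) : ZMod (m + 1)) ≠ 0) ↔
      ∃ ell anc, ElimOrder I.nv I.dd I.adj ell anc ∧ Respects I.nv I.lab ell := by
  obtain ⟨N, hN, hle, hiff⟩ := exists_leading (I := I)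
  have h1 : (∃ ell anc, ElimOrder I.nv I.dd I.adj ell anc ∧ Respects I.nv I.lab ell) ↔ 0 < N := by
    rw [hiff]
    constructor
    · rintro ⟨ell, anc, hO, hL⟩
      exact exists_code_sol hT hE hs hO hL
    · rintro ⟨γ, hγ, hS, hc⟩
      exact ⟨_, _, elimOrder_of_sol hT (extend_zero hγ) hdd hE hs hS hc⟩
  rw [h1, hN]
  constructor
  · rintro ⟨m, _, hm⟩
    rcases Nat.eq_zero_or_pos N with h | h
    · rw [h] at hm; simp at hm
    · exact h
  · intro hpos
    -- The factorial is at most `2 ^ (n * n)` and the number of codes at most `2 ^ (4 * n * (n +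
    -- 1))`. Twice the exponent `8 * (n + 1) ^ 2` is the bound on the moduli.
    have hlt : I.nv.factorial * N < 2 ^ (8 * (n + 1) ^ 2) := by
      have e1 : I.nv.factorial ≤ 2 ^ (n * n) := by
        calc I.nv.factorial ≤ I.nv ^ I.nv := Nat.factorial_le_pow _
          _ ≤ (2 ^ n) ^ I.nv := Nat.pow_le_pow_left (hn.trans Nat.lt_two_pow_self.le) _
          _ ≤ (2 ^ n) ^ n := Nat.pow_le_pow_right (by positivity) hn
          _ = 2 ^ (n * n) := by rw [← pow_mul]
      have e2 : N ≤ 2 ^ (4 * n * (n + 1)) := by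
        refine hle.trans ?_
        rw [show (4 : ℕ) = 2 ^ 2 by norm_num, ← pow_mul, ← pow_mul]
        refine Nat.pow_le_pow_right (by norm_num) ?_
        have := Nat.mul_le_mul hdn (Nat.succ_le_succ hn)
        simp only [Nat.succ_eq_add_one] at this
        nlinarith
      calc I.nv.factorial * N ≤ 2 ^ (n * n) * 2 ^ (4 * n * (n + 1)) := Nat.mul_le_mul e1 e2
        _ = 2 ^ (n * n + 4 * n * (n + 1)) := by rw [← pow_add]
        _ < 2 ^ (8 * (n + 1) ^ 2) := Nat.pow_lt_pow_right (by norm_num) (by nlinarith)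
    obtain ⟨m, hm1, hm2, hm3⟩ := exists_not_dvd (Nat.mul_pos (Nat.factorial_pos _) hpos)
      (Nat.mul_pos (by norm_num) (by positivity)) hlt
    -- Moduli are numbered from 0: index `m` stands for the modulus `m + 1`.
    refine ⟨m - 1, by omega, ?_⟩
    rw [show m - 1 + 1 = m by omega]
    rwa [Int.cast_natCast, Ne, ZMod.natCast_eq_zero_iff]

/-- The tree sum of the weights is the generating function. -/
theorem prod_treeSum_weight {R : Type*} [CommRing R] {lvl : ℕ → ℕ}
    (hT : RTree I.nv (I.dd + 1) I.par lvl) (x : ℕ) :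
    ∏ c ∈ children I.par I.nv 0, treeSum I.par I.nv (4 ^ (2 * I.dd))
      (fun u γ => I.weight (x : R) (dgt γ) u) (I.dd + 2) c (fun _ => 0) = ((I.genFun x : ℤ) : R) := by
  classical
  rw [prod_treeSum hT]
  · have := I.sum_prod_weight (x : R)
    rw [codes] at this
    rw [this, genFun, codes, Int.cast_sum]
    push_cast
    rfl
  · intro u γ γ' h
    refine I.weight_local _ fun k => ?_
    funext q
    simp only [dgt, h k]

end Inst

end TD

namespace TD

/-! ### Evaluating tree sums by a depth-first traversal -/

/-- The state of the traversal: the current vertex, the current codes, and for every vertex the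
sum over the codes tried, the product over the children visited, and the last child visited. -/
structure Trav (R : Type*) where
  cur : ℕ
  code : ℕ → ℕ
  sum : ℕ → R
  prod : ℕ → R
  ch : ℕ → ℕ

section

variable {R : Type*} [CommRing R] (par : ℕ → ℕ) (nv B : ℕ) (w : ℕ → (ℕ → ℕ) → R)

/-- Children are found by scanning all vertex numbers, and `ch` holds the last number scanned. A
step `enter` resets everything at the child except its code, which is already 0 because `leave`
restores it. Each vertex keeps data for a single code only, which is why polynomial space suffices.
-/
inductive Step : Trav R → Trav R → Prop
  | pass (S : Trav R) (h : S.ch S.cur < nv) (hp : par (S.ch S.cur + 1) ≠ S.cur) :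
      Step S { S with ch := Function.update S.ch S.cur (S.ch S.cur + 1) }
  | enter (S : Trav R) (h : S.ch S.cur < nv) (hp : par (S.ch S.cur + 1) = S.cur) :
      Step S { S with
        cur := S.ch S.cur + 1
        sum := Function.update S.sum (S.ch S.cur + 1) 0
        prod := Function.update S.prod (S.ch S.cur + 1) 1
        ch := Function.update (Function.update S.ch S.cur (S.ch S.cur + 1)) (S.ch S.cur + 1) 0 }
  | next (S : Trav R) (h : S.ch S.cur = nv) (h0 : S.cur ≠ 0) (hB : S.code S.cur + 1 < B) :
      Step S { S with
        code := Function.update S.code S.cur (S.code S.cur + 1)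
        sum := Function.update S.sum S.cur (S.sum S.cur + w S.cur S.code * S.prod S.cur)
        prod := Function.update S.prod S.cur 1
        ch := Function.update S.ch S.cur 0 }
  | leave (S : Trav R) (h : S.ch S.cur = nv) (h0 : S.cur ≠ 0) (hB : S.code S.cur + 1 = B) :
      Step S { S with
        cur := par S.cur
        code := Function.update S.code S.cur 0
        sum := Function.update S.sum S.cur (S.sum S.cur + w S.cur S.code * S.prod S.cur)
        prod := Function.update S.prod (par S.cur)
          (S.prod (par S.cur) * (S.sum S.cur + w S.cur S.code * S.prod S.cur)) }

/-- `N` steps of the traversal. -/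
inductive Steps : ℕ → Trav R → Trav R → Prop
  | zero (S) : Steps 0 S S
  | succ {N S S' S''} (h : Step par nv B w S S') (h' : Steps N S' S'') : Steps (N + 1) S S''

/-- The number of steps for the subtree at `u`. -/
def travTime : ℕ → ℕ → ℕ
  | 0, _ => 0
  | h + 1, u => B * (nv + 1 + ∑ x ∈ children par nv u, travTime h x)

/-- The children of `u` after `c`. -/
def childrenFrom (c u : ℕ) : Finset ℕ := (Finset.Icc (c + 1) nv).filter fun x => par x = u

variable {par nv B w}

theorem Steps.trans {M N : ℕ} {S S' S'' : Trav R} (h : Steps par nv B w M S S')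
    (h' : Steps par nv B w N S' S'') : Steps par nv B w (M + N) S S'' := by
  induction h with
  | zero S => rwa [zero_add]
  | @succ M _ _ _ h _ ih => rw [add_right_comm]; exact .succ h (ih h')

theorem childrenFrom_succ {c : ℕ} (hc : c < nv) (u : ℕ) : childrenFrom par nv c u =
    if par (c + 1) = u then insert (c + 1) (childrenFrom par nv (c + 1) u)
    else childrenFrom par nv (c + 1) u := by
  ext x
  split_ifs with h <;>
  simp only [childrenFrom, Finset.mem_filter, Finset.mem_Icc, Finset.mem_insert] <;>
  constructor
  · rintro ⟨h1, h2⟩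
    by_cases hx : x = c + 1
    · exact Or.inl hx
    · exact Or.inr ⟨by omega, h2⟩
  · rintro (rfl | ⟨h1, h2⟩)
    · exact ⟨by omega, h⟩
    · exact ⟨by omega, h2⟩
  · rintro ⟨h1, h2⟩
    have : x ≠ c + 1 := by rintro rfl; exact h h2
    exact ⟨by omega, h2⟩
  · rintro ⟨h1, h2⟩
    exact ⟨by omega, h2⟩

variable {H : ℕ} {lvl : ℕ → ℕ}

/-- The traversal of the subtree at `u` multiplies the product of the parent by the tree sum. -/
def Traverses (par : ℕ → ℕ) (nv B : ℕ) (w : ℕ → (ℕ → ℕ) → R) (lvl : ℕ → ℕ) (h u : ℕ) : Prop :=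
  ∀ S : Trav R, S.cur = u → S.sum u = 0 → S.prod u = 1 → S.ch u = 0 →
    (∀ z, lvl u ≤ lvl z → S.code z = 0) →
    ∃ S', Steps par nv B w (travTime par nv B h u) S S' ∧ S'.cur = par u ∧ S'.code = S.code ∧
      S'.prod (par u) = S.prod (par u) * treeSum par nv B w h u S.code ∧
      ∀ z, lvl z < lvl u → S'.ch z = S.ch z ∧ S'.sum z = S.sum z ∧
        (z ≠ par u → S'.prod z = S.prod z)

/-- Induction on the number `k` of vertex numbers still to be scanned. Subtrees of children disturb
nothing at smaller levels except the product at `u`, so the scan resumes where it stopped. -/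
theorem traverse_children (hT : RTree nv H par lvl) (h u : ℕ)
    (ih : ∀ x ∈ children par nv u, Traverses par nv B w lvl h x) (k : ℕ) :
    ∀ S : Trav R, S.cur = u → S.ch u + k = nv → (∀ z, lvl u < lvl z → S.code z = 0) →
    ∃ S', Steps par nv B w (k + ∑ x ∈ childrenFrom par nv (S.ch u) u, travTime par nv B h x) S S' ∧
      S'.cur = u ∧ S'.code = S.code ∧ S'.ch u = nv ∧ S'.sum u = S.sum u ∧
      S'.prod u = S.prod u *
        ∏ x ∈ childrenFrom par nv (S.ch u) u, treeSum par nv B w h x S.code ∧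
      ∀ z, lvl z < lvl u → S'.ch z = S.ch z ∧ S'.sum z = S.sum z ∧ S'.prod z = S.prod z := by
  induction k with
  | zero =>
    intro S hc hk _
    have he : childrenFrom par nv (S.ch u) u = ∅ := by
      rw [childrenFrom, Finset.Icc_eq_empty (by omega), Finset.filter_empty]
    rw [he]
    exact ⟨S, .zero S, hc, rfl, hk, rfl, by simp, fun z _ => ⟨rfl, rfl, rfl⟩⟩
  | succ k ihk =>
    intro S hc hk hz
    obtain ⟨cur, code, sum, prod, ch⟩ := S
    simp only at hc hk hz ⊢
    subst hc
    have hlt : ch cur < nv := by omega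
    rw [childrenFrom_succ hlt]
    by_cases hp : par (ch cur + 1) = cur
    · rw [if_pos hp, Finset.sum_insert (by simp [childrenFrom]),
        Finset.prod_insert (by simp [childrenFrom])]
      set x := ch cur + 1 with hx
      have hxI : x ∈ Finset.Icc 1 nv := Finset.mem_Icc.2 ⟨by omega, by omega⟩
      have hxc : x ∈ children par nv cur := mem_children.2 ⟨Finset.mem_Icc.1 hxI, hp⟩
      have hlvl := hT.lvl_par x hxI
      rw [hp] at hlvl
      have hne : cur ≠ x := by intro h; rw [← h] at hlvl; omega
      have st := Step.enter (B := B) (w := w) (par := par) (nv := nv) ⟨cur, code, sum, prod, ch⟩ hlt hp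
      simp only [← hx] at st
      obtain ⟨S1, h1, c1, g1, p1, k1⟩ := ih x hxc
        ⟨x, code, Function.update sum x 0, Function.update prod x 1,
          Function.update (Function.update ch cur x) x 0⟩ rfl (by simp) (by simp) (by simp)
        (fun z h => hz z (by omega))
      obtain ⟨e1, e2, -⟩ := k1 cur hlvl
      simp only [Function.update_of_ne hne, Function.update_self] at e1 e2
      rw [hp] at c1 p1
      simp only [Function.update_of_ne hne] at p1 g1
      obtain ⟨S2, h2, c2, g2, ch2, s2, p2, k2⟩ := ihk S1 c1 (by rw [e1]; omega)
        (by rw [g1]; exact hz)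
      rw [e1] at h2 p2
      rw [g1] at p2
      refine ⟨S2, ?_, c2, g2.trans g1, ch2, s2.trans e2, ?_, fun z hzl => ?_⟩
      · have := Steps.succ st (h1.trans h2)
        convert this using 1
        ring
      · rw [p2, p1, mul_assoc]
      · obtain ⟨a1, a2, a3⟩ := k1 z (by omega)
        obtain ⟨b1, b2, b3⟩ := k2 z hzl
        have z1 : z ≠ cur := by rintro rfl; omega
        have z2 : z ≠ x := by rintro rfl; omega
        simp only [Function.update_of_ne z1, Function.update_of_ne z2] at a1 a2 a3
        exact ⟨b1.trans a1, b2.trans a2, b3.trans (a3 (by rw [hp]; exact z1))⟩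
    · rw [if_neg hp]
      have st := Step.pass (B := B) (w := w) (par := par) (nv := nv) ⟨cur, code, sum, prod, ch⟩ hlt hp
      obtain ⟨S2, h2, c2, g2, ch2, s2, p2, k2⟩ := ihk
        ⟨cur, code, sum, prod, Function.update ch cur (ch cur + 1)⟩ rfl (by simp; omega) hz
      simp only [Function.update_self] at h2 c2 g2 s2 p2 k2
      refine ⟨S2, ?_, c2, g2, ch2, s2, p2, fun z hzl => ?_⟩
      · have := Steps.succ st h2
        convert this using 1
        ring
      · obtain ⟨b1, b2, b3⟩ := k2 z hzl
        have z1 : z ≠ cur := by rintro rfl; omega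
        simp only [Function.update_of_ne z1] at b1
        exact ⟨b1, b2, b3⟩

/-- There are `k + 1` codes of `u` left, the current one included. Each scan of the children adds
one summand; after the last, `leave` multiplies the total into the parent's product. -/
theorem traverse_codes (hT : RTree nv H par lvl) (h u : ℕ) (hu : u ∈ Finset.Icc 1 nv)
    (ih : ∀ x ∈ children par nv u, Traverses par nv B w lvl h x) (k : ℕ) :
    ∀ S : Trav R, S.cur = u → S.prod u = 1 → S.ch u = 0 → S.code u + (k + 1) = B →
    (∀ z, lvl u ≤ lvl z → z ≠ u → S.code z = 0) →
    ∃ S', Steps par nv B w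
        ((k + 1) * (nv + 1 + ∑ x ∈ children par nv u, travTime par nv B h x)) S S' ∧
      S'.cur = par u ∧ S'.code = Function.update S.code u 0 ∧
      S'.prod (par u) = S.prod (par u) * (S.sum u + ∑ i ∈ Finset.range (k + 1),
        w u (Function.update S.code u (S.code u + i)) * ∏ x ∈ children par nv u,
          treeSum par nv B w h x (Function.update S.code u (S.code u + i))) ∧
      ∀ z, lvl z < lvl u → S'.ch z = S.ch z ∧ S'.sum z = S.sum z ∧
        (z ≠ par u → S'.prod z = S.prod z) := by
  have hu' := Finset.mem_Icc.1 hu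
  have hlp := hT.lvl_par u hu
  have hpu : par u ≠ u := by intro h; rw [h] at hlp; omega
  induction k with
  | zero =>
    intro S hc hp hch hB hz
    obtain ⟨S1, h1, c1, g1, ch1, s1, p1, k1⟩ := traverse_children hT h u ih nv S hc (by omega)
      (fun z hzl => hz z hzl.le (by rintro rfl; omega))
    rw [hch] at h1 p1
    rw [hp, one_mul] at p1
    have hcf : childrenFrom par nv 0 u = children par nv u := rfl
    rw [hcf] at h1 p1
    obtain ⟨-, -, pp⟩ := k1 (par u) hlp
    have st := Step.leave (par := par) (nv := nv) (B := B) (w := w) S1 (by rw [c1]; exact ch1)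
      (by omega) (by rw [c1, g1]; omega)
    rw [c1] at st
    refine ⟨⟨par u, Function.update S1.code u 0,
      Function.update S1.sum u (S1.sum u + w u S1.code * S1.prod u),
      Function.update S1.prod (par u) (S1.prod (par u) * (S1.sum u + w u S1.code * S1.prod u)),
      S1.ch⟩, ?_, rfl, by simp only [g1], ?_, fun z hzl => ?_⟩
    · have := h1.trans (.succ st (.zero _))
      convert this using 1
      ring
    · simp only [Function.update_self, pp, s1, p1, g1, zero_add, Finset.sum_range_one, add_zero,
        Function.update_eq_self]
    · obtain ⟨b1, b2, b3⟩ := k1 z hzl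
      have z1 : z ≠ u := by rintro rfl; omega
      simp only [Function.update_of_ne z1]
      exact ⟨b1, b2, fun z2 => by rw [Function.update_of_ne z2, b3]⟩
  | succ k ihk =>
    intro S hc hp hch hB hz
    obtain ⟨S1, h1, c1, g1, ch1, s1, p1, k1⟩ := traverse_children hT h u ih nv S hc (by omega)
      (fun z hzl => hz z hzl.le (by rintro rfl; omega))
    rw [hch] at h1 p1
    rw [hp, one_mul] at p1
    have hcf : childrenFrom par nv 0 u = children par nv u := rfl
    rw [hcf] at h1 p1
    obtain ⟨-, -, pp⟩ := k1 (par u) hlp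
    have st := Step.next (par := par) (nv := nv) (B := B) (w := w) S1 (by rw [c1]; exact ch1)
      (by omega) (by rw [c1, g1]; omega)
    rw [c1] at st
    obtain ⟨S2, h2, c2, g2, p2, k2⟩ := ihk
      ⟨u, Function.update S1.code u (S1.code u + 1),
        Function.update S1.sum u (S1.sum u + w u S1.code * S1.prod u),
        Function.update S1.prod u 1, Function.update S1.ch u 0⟩ rfl (by simp) (by simp)
      (by simp only [Function.update_self, g1]; omega)
      (fun z hzl hzu => by simp only [Function.update_of_ne hzu, g1]; exact hz z hzl hzu)
    simp only [Function.update_self, Function.update_of_ne hpu, g1, Function.update_idem,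
      s1, p1, pp] at g2 p2
    refine ⟨S2, ?_, c2, g2, ?_, fun z hzl => ?_⟩
    · have := h1.trans (.succ st h2)
      convert this using 1
      ring
    · rw [p2, Finset.sum_range_succ' _ (k + 1), add_zero, Function.update_eq_self]
      congr 1
      rw [add_assoc, add_comm (w u S.code * _)]
      congr 2
      refine Finset.sum_congr rfl fun i _ => ?_
      rw [show S.code u + 1 + i = S.code u + (i + 1) by ring]
    · obtain ⟨b1, b2, b3⟩ := k1 z hzl
      obtain ⟨d1, d2, d3⟩ := k2 z hzl
      have z1 : z ≠ u := by rintro rfl; omega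
      simp only [Function.update_of_ne z1] at d1 d2 d3
      exact ⟨d1.trans b1, d2.trans b2, fun z2 => (d3 z2).trans b3⟩

theorem traverses (hT : RTree nv H par lvl) (hB : 0 < B) (h : ℕ) : ∀ u ∈ Finset.Icc 1 nv,
    H < h + lvl u → Traverses par nv B w lvl h u := by
  induction h with
  | zero => intro u hu hh; have := hT.lvl_le u hu; omega
  | succ h ih =>
    intro u hu hh S hc hs hp hch hz
    have ihc : ∀ x ∈ children par nv u, Traverses par nv B w lvl h x := by
      intro x hx
      have hx' := mem_children.1 hx
      have hxI := Finset.mem_Icc.2 hx'.1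
      have := hT.lvl_par x hxI
      rw [hx'.2] at this
      exact ih x hxI (by omega)
    have hz0 := hz u le_rfl
    obtain ⟨S', h1, c1, g1, p1, k1⟩ := traverse_codes hT h u hu ihc (B - 1) S hc hp hch (by omega)
      (fun z hzl _ => hz z hzl)
    rw [Nat.sub_add_cancel hB] at h1 p1
    refine ⟨S', h1, c1, ?_, ?_, k1⟩
    · rw [g1, ← hz0, Function.update_eq_self]
    · rw [p1, hs, zero_add, hz0]
      simp only [zero_add, treeSum]

/-- The whole traversal. -/
theorem traverse_root (hT : RTree nv H par lvl) (hB : 0 < B) (S : Trav R) (hc : S.cur = 0)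
    (hp : S.prod 0 = 1) (hch : S.ch 0 = 0) (hz : ∀ z, S.code z = 0) :
    ∃ S', Steps par nv B w
        (nv + ∑ x ∈ children par nv 0, travTime par nv B (H + 1) x) S S' ∧
      S'.cur = 0 ∧ S'.ch 0 = nv ∧
      S'.prod 0 = ∏ x ∈ children par nv 0, treeSum par nv B w (H + 1) x fun _ => 0 := by
  have ihc : ∀ x ∈ children par nv 0, Traverses par nv B w lvl (H + 1) x := fun x hx =>
    traverses hT hB _ x (Finset.mem_Icc.2 (mem_children.1 hx).1) (by omega)
  obtain ⟨S1, h1, c1, g1, ch1, s1, p1, k1⟩ := traverse_children hT (H + 1) 0 ihc nv S hc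
    (by omega) fun z _ => hz z
  rw [hch] at h1 p1
  rw [hp, one_mul, show S.code = fun _ => 0 from funext hz] at p1
  exact ⟨S1, h1, c1, ch1, p1⟩

/-- Summing over whole levels avoids a branching factor from the number of children: children of
different vertices are disjoint and lie one level deeper. Each level thus costs only one factor `B`.
-/
theorem sum_travTime_le (hT : RTree nv H par lvl) (hB : 0 < B) (h j : ℕ) :
    ∑ x ∈ (Finset.Icc 1 nv).filter (fun x => j ≤ lvl x), travTime par nv B h x ≤
      h * (B ^ h * ((nv + 1) * (nv + 1))) := by
  induction h generalizing j with
  | zero => simp [travTime]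
  | succ h ih =>
    have h1 : ∑ x ∈ (Finset.Icc 1 nv).filter (fun x => j ≤ lvl x),
        ∑ y ∈ children par nv x, travTime par nv B h y ≤
        ∑ y ∈ (Finset.Icc 1 nv).filter (fun x => j + 1 ≤ lvl x), travTime par nv B h y := by
      rw [← Finset.sum_biUnion]
      · refine Finset.sum_le_sum_of_subset fun y hy => ?_
        rw [Finset.mem_biUnion] at hy
        obtain ⟨x, hx, hy⟩ := hy
        rw [Finset.mem_filter] at hx ⊢
        have hy' := mem_children.1 hy
        have hyI := Finset.mem_Icc.2 hy'.1
        have := hT.lvl_par y hyI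
        rw [hy'.2] at this
        exact ⟨hyI, by omega⟩
      · intro x _ x' _ hne
        refine Finset.disjoint_left.2 fun y hy hy' => hne ?_
        rw [← (mem_children.1 hy).2, (mem_children.1 hy').2]
    have h2 : ((Finset.Icc 1 nv).filter (fun x => j ≤ lvl x)).card ≤ nv + 1 :=
      (Finset.card_filter_le _ _).trans (by simp)
    simp only [travTime]
    rw [← Finset.mul_sum, Finset.sum_add_distrib, Finset.sum_const, smul_eq_mul]
    have h3 := h1.trans (ih (j + 1))
    have h4 : ((Finset.Icc 1 nv).filter (fun x => j ≤ lvl x)).card * (nv + 1) ≤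
        B ^ h * ((nv + 1) * (nv + 1)) := by
      calc _ ≤ (nv + 1) * (nv + 1) := Nat.mul_le_mul_right _ h2
        _ ≤ _ := Nat.le_mul_of_pos_left _ (by positivity)
    calc _ ≤ B * (B ^ h * ((nv + 1) * (nv + 1)) + h * (B ^ h * ((nv + 1) * (nv + 1)))) :=
          Nat.mul_le_mul_left _ (Nat.add_le_add h4 h3)
      _ = _ := by ring

end

end TD

namespace TD

/-! ### The program

Scalars: `0` number of vertices `n` of the graph, `1` depth bound, `2` current depth bound `dd`,
`5` failure flag, `7` number of vertices `nv` of the current subgraph, `8` is `2 * dd`, `9` is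
`dd + 1`, `10` evaluation point, `11` modulus, `12` is `nv + 1`, `13` the number of moduli,
`15` current vertex of the traversal, `16` its loop condition, `20` is `n + 1`.
Arrays: `0` input and output, `1` current elimination forest, `2` parents in the elimination tree,
`3` labels, `4` digits (digit `q` of vertex `u` at `q * (n + 1) + u`), `5`, `6`, `7` sums, products
and last children of the traversal, `8` values of the generating function. -/

abbrev v (x : ℕ) : Expr := .var x

def digE (q u : Expr) : Expr := .get 4 (q * v 20 + u)

def adjE (a b : Expr) : Expr := .get 0 (a * v 0 + b + 1)

/-- `22 := base (21)` -/
def baseC : Cmd := .seq (.set 22 (.get 2 (v 21)))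
  (.for_ 23 2 (.ite (digE (v 2 + v 23) (v 21)) (.set 22 (.get 2 (v 22))) .skip))

/-- `21 := cr (25) (26)` -/
def crC : Cmd := .seq (.set 21 (v 25))
  (.for_ 27 9 (.ite (.eq (digE (v 26) (v 21)) 1) (.seq baseC (.set 21 (v 22))) .skip))

/-- `29 := ell (28)` -/
def ellC : Cmd := .seq (.set 29 0)
  (.for_ 30 2 (.ite (digE (v 30) (v 28)) (.set 29 (v 30)) .skip))

/-- Clears the flag `18` if the old nodes of `15` are not an initial segment. -/
def patternC : Cmd := .for_ 31 2 (.ite (v 31) (.ite (.eq (digE (v 31) (v 15)) 1)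
  (.ite (.eq (digE (v 31 - 1) (v 15)) 1) .skip (.set 18 0)) .skip) .skip)

/-- Clears the flag `18` if the positions of `15` and `33` do not fit (`32` is `ell (15)`). -/
def fitsC : Cmd := .seq (.set 28 (v 33)) <| .seq ellC <|
  .ite (.eq (v 29) (v 32)) (.set 18 0) <|
  .seq (.ite (.lt (v 29) (v 32)) (.set 26 (v 29)) (.set 26 (v 32))) <|
  .seq (.set 25 (v 33)) <| .seq crC <| .seq (.set 35 (v 21)) <|
  .seq (.set 25 (v 15)) <| .seq crC <| .ite (.eq (v 21) (v 35)) .skip (.set 18 0)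

/-- Clears the flag `18` if `15` does not fit to an adjacent ancestor. -/
def ancestorsC : Cmd := .seq (.set 33 (.get 2 (v 15))) <|
  .for_ 34 9 (.ite (v 33) (.seq (.ite (adjE (v 15) (v 33)) fitsC .skip)
    (.set 33 (.get 2 (v 33)))) .skip)

/-- `18 := Valid (15)`, `32 := ell (15)` -/
def validC : Cmd := .seq (.set 18 1) <| .seq patternC <| .seq (.set 28 (v 15)) <| .seq ellC <|
  .seq (.set 32 (v 29)) <|
  .seq (.ite (.get 3 (v 15)) (.ite (.eq (.get 3 (v 15)) (v 32 + 1)) .skip (.set 18 0)) .skip) <|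
  .seq (.set 25 (v 15)) <| .seq (.set 26 (v 32)) <| .seq crC <|
  .seq (.ite (.eq (digE (v 26) (v 21)) 2) .skip (.set 18 0)) ancestorsC

/-- `17 := ` the product of the factors of the digits of `15` -/
def facC : Cmd := .seq (.set 17 1) <| .for_ 31 2 <| .ite (.eq (digE (v 31) (v 15)) 2)
  (.set 17 (v 17 * v 10 % v 11)) <| .ite (.eq (digE (v 31) (v 15)) 3)
  (.set 17 (v 11 - v 17 * v 10 % v 11)) .skip

/-- `17 := weight (15)` -/
def weightC : Cmd := .seq validC (.seq facC (.ite (v 18) .skip (.set 17 0)))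

/-- The bound on the values that the program handles. -/
def bnd (n : ℕ) : ℕ := 64 * (n + 2) ^ 2

/-- The state holds the instance `I` with the configuration `δ`. -/
structure Env (n : ℕ) (I : Inst) (δ : ℕ → ℕ → ℕ) (s : St) : Prop where
  v0 : s.var 0 = n
  v2 : s.var 2 = I.dd
  v7 : s.var 7 = I.nv
  v8 : s.var 8 = 2 * I.dd
  v9 : s.var 9 = I.dd + 1
  v20 : s.var 20 = n + 1
  dd_le : I.dd ≤ n
  nv_le : I.nv ≤ n
  par : ∀ u ≤ I.nv, s.arr 2 u = I.par u
  par_le : ∀ u ≤ I.nv, I.par u ≤ I.nv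
  lab : ∀ u ∈ Finset.Icc 1 I.nv, s.arr 3 u = I.lab u
  adj : ∀ u ∈ Finset.Icc 1 I.nv, ∀ x ∈ Finset.Icc 1 I.nv, s.arr 0 (u * n + x + 1) ≠ 0 ↔ I.adj u x
  dig : ∀ u ≤ I.nv, ∀ q < 2 * I.dd, s.arr 4 (q * (n + 1) + u) = δ u q

theorem Env.congr {n : ℕ} {I : Inst} {δ : ℕ → ℕ → ℕ} {s s' : St} (h : Env n I δ s)
    (hv : ∀ x ∈ [0, 2, 7, 8, 9, 20], s'.var x = s.var x)
    (ha : ∀ a ∈ [0, 2, 3, 4], s'.arr a = s.arr a) : Env n I δ s' := by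
  simp only [List.mem_cons, List.not_mem_nil, or_false, forall_eq_or_imp, forall_eq] at hv ha
  obtain ⟨h1, h2, h3, h4, h5, h6⟩ := hv
  obtain ⟨a1, a2, a3, a4⟩ := ha
  exact ⟨h1.trans h.v0, h2.trans h.v2, h3.trans h.v7, h4.trans h.v8, h5.trans h.v9,
    h6.trans h.v20, h.dd_le, h.nv_le, by rw [a2]; exact h.par, h.par_le, by rw [a3]; exact h.lab,
    by rw [a1]; exact h.adj, by rw [a4]; exact h.dig⟩

theorem Env.same {n : ℕ} {I : Inst} {δ : ℕ → ℕ → ℕ} {c : Cmd} {s s' : St} (h : Env n I δ s)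
    (hs : Same c s s') (hv : ∀ x ∈ [0, 2, 7, 8, 9, 20], x ∉ c.mods)
    (ha : ∀ a ∈ [0, 2, 3, 4], a ∉ c.marrs) : Env n I δ s' :=
  h.congr (fun x hx => hs.1 x (hv x hx)) fun a hx => hs.2 a (ha a hx)

/-! ### Correctness of the routines that compute one weight -/

section

variable {n F : ℕ} {I : Inst} {δ : ℕ → ℕ → ℕ} {s : St}

theorem le_bnd {n : ℕ} : 256 ≤ bnd n := by
  have : 2 ^ 2 ≤ (n + 2) ^ 2 := Nat.pow_le_pow_left (by omega) 2
  unfold bnd; omega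

theorem idx_lt {n q u : ℕ} (hq : q ≤ 2 * n) (hu : u ≤ n) : q * (n + 1) + u < bnd n := by
  unfold bnd; nlinarith

theorem adj_idx_lt {n a b : ℕ} (ha : a ≤ n) (hb : b ≤ n) : a * n + b + 1 < bnd n := by
  unfold bnd; nlinarith

theorem lt_bnd {n a : ℕ} (ha : a ≤ 2 * n + 4) : a < bnd n := by
  unfold bnd; nlinarith

theorem Env.iterate_le (he : Env n I δ s) {u : ℕ} (hu : u ≤ I.nv) (k : ℕ) :
    I.par^[k] u ≤ I.nv := by
  induction k with
  | zero => exact hu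
  | succ k ih => rw [Function.iterate_succ_apply']; exact he.par_le _ ih

theorem Env.walk_le (he : Env n I δ s) {u : ℕ} (hu : u ≤ I.nv) (q : ℕ) :
    I.walk δ u q ≤ I.nv := by
  obtain ⟨k, hk⟩ := Inst.walk_anc (I := I) (δ := δ) u q
  rw [hk]; exact he.iterate_le hu _

theorem Env.follow_le (he : Env n I δ s) {u : ℕ} (hu : u ≤ I.nv) (p k : ℕ) :
    I.follow δ p k u ≤ I.nv := by
  obtain ⟨j, hj⟩ := Inst.follow_anc (I := I) (δ := δ) p k u
  rw [hj]; exact he.iterate_le hu _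

theorem Env.digE_ok (he : Env n I δ s) {q u : Expr} (hq : q.ok (bnd n) s) (hu : u.ok (bnd n) s)
    (hq' : q.val s < 2 * I.dd) (hu' : u.val s ≤ I.nv) : (digE q u).ok (bnd n) s := by
  have hnv := he.nv_le
  have hdd := he.dd_le
  refine ⟨⟨⟨hq, trivial⟩, hu⟩, ?_⟩
  rw [Expr.val_add, Expr.val_mul, Expr.val_var, he.v20]
  exact idx_lt (by omega) (by omega)

theorem Env.digE_val (he : Env n I δ s) {q u : Expr} (hq : q.val s < 2 * I.dd)
    (hu : u.val s ≤ I.nv) : (digE q u).val s = δ (u.val s) (q.val s) := by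
  rw [digE, Expr.val_get, Expr.val_add, Expr.val_mul, Expr.val_var, he.v20, he.dig _ hu _ hq]

theorem Env.lt_bnd (he : Env n I δ s) {a : ℕ} (ha : a ≤ I.nv) : a < bnd n :=
  TD.lt_bnd (by have := he.nv_le; omega)

theorem base_spec (he : Env n I δ s) (hb : s.Bdd (bnd n)) (hu : s.var 21 ≤ I.nv) :
    WP (bnd n) F baseC s fun s' => s'.var 22 = I.base δ (s.var 21) := by
  rw [baseC, WP_seq, WP_set]
  refine ⟨⟨trivial, he.lt_bnd hu⟩, hb.2 _ _, ?_⟩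
  set s1 := s.set 22 (Expr.val s (.get 2 (v 21))) with hs1
  have hb1 : s1.Bdd (bnd n) := hb.set (hb.2 _ _)
  have he1 : Env n I δ s1 := he.congr (by simp [hs1]) (by simp [hs1])
  refine WP.for_ (fun i s' => s'.var 22 = I.walk δ (s.var 21) i) (by decide)
    (by decide) (by decide) hb1 ?_ ?_ ?_
  · simp [hs1, Inst.walk, he.par _ hu]
  · intro i hi s' hs' hb' hx hI
    have he' := he1.same hs' (by decide) (by decide)
    have h21 : s'.var 21 = s.var 21 := by rw [hs'.1 21 (by decide)]; simp [hs1]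
    have hw := he.walk_le hu i
    rw [he1.v2] at hi
    have h1 : Expr.val s' (v 2 + v 23) = I.dd + i := by simp [he'.v2, hx]
    have h2 : Expr.val s' (v 21) = s.var 21 := h21
    rw [WP_ite, he'.digE_val (by omega) (by omega), WP_set, WP_skip, h1, h2]
    refine ⟨he'.digE_ok ⟨trivial, trivial⟩ trivial (by omega) (by omega),
      fun h => ⟨⟨trivial, ?_⟩, hb'.2 _ _, ?_⟩, fun h => ?_⟩
    · rw [Expr.val_var, hI]; exact he.lt_bnd hw
    · simp [Inst.walk, h, hI, he'.par _ hw]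
    · simp [Inst.walk, h, hI]
  · intro s' hs' hb' hI
    rw [he1.v2] at hI
    exact hI

theorem cr_spec (he : Env n I δ s) (hb : s.Bdd (bnd n)) (hu : s.var 25 ≤ I.nv)
    (hp : s.var 26 < 2 * I.dd) :
    WP (bnd n) F crC s fun s' => s'.var 21 = I.cr δ (s.var 25) (s.var 26) := by
  rw [crC, WP_seq, WP_set]
  refine ⟨trivial, hb.1 _, ?_⟩
  set s1 := s.set 21 (Expr.val s (v 25)) with hs1
  have hb1 : s1.Bdd (bnd n) := hb.set (hb.1 _)
  have he1 : Env n I δ s1 := he.congr (by simp [hs1]) (by simp [hs1])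
  refine WP.for_ (fun i s' => s'.var 21 = I.follow δ (s.var 26) i (s.var 25)) (by decide)
    (by decide) (by decide) hb1 ?_ ?_ ?_
  · simp [hs1, Inst.follow]
  · intro i hi s' hs' hb' hx hI
    have he' := he1.same hs' (by decide) (by decide)
    have h26 : s'.var 26 = s.var 26 := by rw [hs'.1 26 (by decide)]; simp [hs1]
    have hw := he.follow_le hu (s.var 26) i
    have h1 : Expr.val s' (v 26) = s.var 26 := h26
    have h2 : Expr.val s' (v 21) = I.follow δ (s.var 26) i (s.var 25) := hI
    rw [WP_ite, Expr.val_eq, he'.digE_val (by omega) (by omega), WP_seq, WP_skip, h1, h2,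
      Expr.val_ofNat]
    refine ⟨⟨he'.digE_ok trivial trivial (by omega) (by omega), trivial⟩, fun h => ?_, fun h => ?_⟩
    · refine (base_spec he' hb' (by omega)).mono hb' fun s2 hs2 hb2 h22 => ?_
      rw [WP_set]
      refine ⟨trivial, hb2.1 _, ?_⟩
      have h3 : δ (I.follow δ (s.var 26) i (s.var 25)) (s.var 26) = 1 := by
        by_contra h3; simp [h3] at h
      simp [Inst.follow, h3, h22, hI]
    · have h3 : δ (I.follow δ (s.var 26) i (s.var 25)) (s.var 26) ≠ 1 := by
        intro h3; simp [h3] at h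
      simp [Inst.follow, h3, hI]
  · intro s' hs' hb' hI
    rw [he1.v9] at hI
    exact hI

theorem ell_spec (he : Env n I δ s) (hb : s.Bdd (bnd n)) (hu : s.var 28 ≤ I.nv) :
    WP (bnd n) F ellC s fun s' => s'.var 29 = I.ell δ (s.var 28) := by
  rw [ellC, WP_seq, WP_set]
  refine ⟨trivial, TD.lt_bnd (by simp), ?_⟩
  set s1 := s.set 29 (Expr.val s 0) with hs1
  have hb1 : s1.Bdd (bnd n) := hb.set (TD.lt_bnd (by simp))
  have he1 : Env n I δ s1 := he.congr (by simp [hs1]) (by simp [hs1])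
  refine WP.for_ (fun i s' => s'.var 29 = Inst.lastNZ δ (s.var 28) i) (by decide)
    (by decide) (by decide) hb1 ?_ ?_ ?_
  · simp [hs1, Inst.lastNZ]
  · intro i hi s' hs' hb' hx hI
    have he' := he1.same hs' (by decide) (by decide)
    have h1 : Expr.val s' (v 28) = s.var 28 := by
      rw [Expr.val_var, hs'.1 28 (by decide)]; simp [hs1]
    have h2 : Expr.val s' (v 30) = i := hx
    rw [he1.v2] at hi
    rw [WP_ite, he'.digE_val (by omega) (by omega), WP_set, WP_skip, h1, h2]
    refine ⟨he'.digE_ok trivial trivial (by omega) (by omega),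
      fun h => ⟨trivial, by rw [← h2]; exact hb'.1 _, ?_⟩, fun h => ?_⟩
    · simp [Inst.lastNZ, h]
    · simp [Inst.lastNZ, h, hI]
  · intro s' hs' hb' hI
    rw [he1.v2] at hI
    exact hI

theorem pattern_spec (he : Env n I δ s) (hb : s.Bdd (bnd n)) (hu : s.var 15 ≤ I.nv) :
    WP (bnd n) F patternC s fun s' => s'.var 18 ≠ 0 ↔ s.var 18 ≠ 0 ∧
      ∀ q, q + 1 < I.dd → δ (s.var 15) (q + 1) = 1 → δ (s.var 15) q = 1 := by
  refine WP.for_ (fun i s' => s'.var 18 ≠ 0 ↔ s.var 18 ≠ 0 ∧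
      ∀ q, q + 1 < i → δ (s.var 15) (q + 1) = 1 → δ (s.var 15) q = 1) (by decide)
    (by decide) (by decide) hb ?_ ?_ ?_
  · simp
  · intro i hi s' hs' hb' hx hI
    have he' := he.same hs' (by decide) (by decide)
    have h1 : Expr.val s' (v 15) = s.var 15 := hs'.1 15 (by decide)
    have h2 : Expr.val s' (v 31) = i := hx
    have h3 : Expr.val s' (v 31 - 1) = i - 1 := by simp [hx]
    rw [he.v2] at hi
    simp only [WP_ite, WP_skip, WP_set, Expr.val_eq, Expr.val_ofNat]
    rw [he'.digE_val (by omega) (by omega), he'.digE_val (by omega) (by omega), h1, h2, h3]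
    have hok1 := he'.digE_ok (q := v 31) (u := v 15) trivial trivial (by omega) (by omega)
    have hok2 := he'.digE_ok (q := v 31 - 1) (u := v 15) ⟨trivial, trivial⟩ trivial
      (by omega) (by omega)
    have hstep : (∀ q, q + 1 < i + 1 → δ (s.var 15) (q + 1) = 1 → δ (s.var 15) q = 1) ↔
        (∀ q, q + 1 < i → δ (s.var 15) (q + 1) = 1 → δ (s.var 15) q = 1) ∧
        (0 < i → δ (s.var 15) i = 1 → δ (s.var 15) (i - 1) = 1) := by
      constructor
      · intro h
        refine ⟨fun q hq => h q (by omega), fun hi h1 => ?_⟩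
        exact h (i - 1) (by omega) (by rwa [Nat.sub_add_cancel hi])
      · rintro ⟨h, h'⟩ q hq h1
        rcases Nat.lt_or_ge (q + 1) i with h2 | h2
        · exact h q h2 h1
        · have : i = q + 1 := by omega
          subst this
          exact h' (by omega) h1
    have h18 : (18 : ℕ) ≠ 31 := by decide
    simp only [hstep, St.set_var, if_neg h18, if_true]
    refine ⟨trivial, fun hi0 => ⟨⟨hok1, trivial⟩, fun hd => ⟨⟨hok2, trivial⟩, fun hd2 => ?_,
      fun hd2 => ⟨trivial, TD.lt_bnd (by omega), ?_⟩⟩, fun hd => ?_⟩, fun hi0 => ?_⟩ <;>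
      clear hstep hok1 hok2
    · have : δ (s.var 15) (i - 1) = 1 := by by_contra h; simp [h] at hd2
      tauto
    · have h5 : δ (s.var 15) (i - 1) ≠ 1 := by intro h; simp [h] at hd2
      have h6 : δ (s.var 15) i = 1 := by by_contra h; simp [h] at hd
      have h7 : 0 < i := by omega
      tauto
    · have h6 : δ (s.var 15) i ≠ 1 := by intro h; simp [h] at hd
      tauto
    · have h7 : ¬ 0 < i := by omega
      tauto
  · intro s' hs' hb' hI
    rw [he.v2] at hI
    exact hI

end

end TD

namespace TD

theorem Inst.lastNZ_lt_of_pos (δ : ℕ → ℕ → ℕ) (u : ℕ) {q : ℕ} (hq : 0 < q) :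
    Inst.lastNZ δ u q < q := by
  induction q with
  | zero => omega
  | succ q ih =>
    simp only [Inst.lastNZ]
    split_ifs
    · omega
    · rcases Nat.eq_zero_or_pos q with rfl | h
      · simp [Inst.lastNZ]
      · exact (ih h).trans (by omega)

section

variable {n F : ℕ} {I : Inst} {δ : ℕ → ℕ → ℕ} {s : St}

theorem fits_spec (hd : 0 < I.dd) (he : Env n I δ s) (hb : s.Bdd (bnd n)) (hu : s.var 15 ≤ I.nv)
    (hx : s.var 33 ≤ I.nv) (hl : s.var 32 = I.ell δ (s.var 15)) :
    WP (bnd n) F fitsC s fun s' => s'.var 18 ≠ 0 ↔ s.var 18 ≠ 0 ∧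
      I.Fits δ (s.var 33) (s.var 15) := by
  have hlt1 : I.ell δ (s.var 33) < I.dd := Inst.lastNZ_lt_of_pos _ _ hd
  have hlt2 : I.ell δ (s.var 15) < I.dd := Inst.lastNZ_lt_of_pos _ _ hd
  rw [fitsC, WP_seq, WP_set]
  refine ⟨trivial, hb.1 _, ?_⟩
  set s1 := s.set 28 (Expr.val s (v 33)) with hs1
  have hb1 : s1.Bdd (bnd n) := hb.set (hb.1 _)
  have he1 : Env n I δ s1 := he.congr (by simp [hs1]) (by simp [hs1])
  rw [WP_seq]
  refine (ell_spec he1 hb1 (by simpa [hs1] using hx)).mono hb1 fun s2 hs2 hb2 h29 => ?_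
  have he2 := he1.same hs2 (by decide) (by decide)
  have h29' : s2.var 29 = I.ell δ (s.var 33) := by rw [h29]; simp [hs1]
  have e2 : ∀ x ∈ [15, 18, 32, 33], s2.var x = s.var x := by
    intro x hx
    have : x ∉ ellC.mods ∧ x ≠ 28 := by revert x; decide
    rw [hs2.1 x this.1]; simp [hs1, this.2]
  have e2a := e2 15 (by decide)
  have e2b := e2 18 (by decide)
  have e2c := e2 32 (by decide)
  have e2d := e2 33 (by decide)
  simp only [WP_ite, Expr.val_eq, Expr.val_var, WP_set, h29', e2c, hl]
  refine ⟨⟨trivial, trivial⟩, fun h => ⟨trivial, TD.lt_bnd (by simp), ?_⟩, fun h => ?_⟩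
  · have h' : I.ell δ (s.var 33) = I.ell δ (s.var 15) := by by_contra hc; simp [hc] at h
    simp [Inst.Fits, h']
  have hne : I.ell δ (s.var 33) ≠ I.ell δ (s.var 15) := by intro hc; simp [hc] at h
  rw [WP_seq]
  have h26 : WP (bnd n) F (.ite (.lt (v 29) (v 32)) (.set 26 (v 29)) (.set 26 (v 32))) s2
      fun s' => s'.var 26 = min (I.ell δ (s.var 33)) (I.ell δ (s.var 15)) := by
    simp only [WP_ite, Expr.val_lt, Expr.val_var, WP_set, h29', e2c, hl]
    refine ⟨⟨trivial, trivial⟩, fun h => ⟨trivial, TD.lt_bnd (by have := he.dd_le; omega), ?_⟩,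
      fun h => ⟨trivial, TD.lt_bnd (by have := he.dd_le; omega), ?_⟩⟩
    · have : I.ell δ (s.var 33) < I.ell δ (s.var 15) := by by_contra hc; simp [hc] at h
      simp [min_eq_left this.le]
    · have : ¬ I.ell δ (s.var 33) < I.ell δ (s.var 15) := by intro hc; simp [hc] at h
      simp [min_eq_right (not_lt.1 this)]
  refine h26.mono hb2 fun s3 hs3 hb3 h26 => ?_
  have he3 := he2.same hs3 (by decide) (by decide)
  set p := min (I.ell δ (s.var 33)) (I.ell δ (s.var 15)) with hp
  have hp2 : p < 2 * I.dd := by omega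
  rw [WP_seq, WP_set]
  refine ⟨trivial, hb3.1 _, ?_⟩
  set s4 := s3.set 25 (Expr.val s3 (v 33)) with hs4
  have hb4 : s4.Bdd (bnd n) := hb3.set (hb3.1 _)
  have he4 : Env n I δ s4 := he3.congr (by simp [hs4]) (by simp [hs4])
  have a25 : s4.var 25 = s.var 33 := by simp [hs4, hs3.1 33 (by decide), e2d]
  have a26 : s4.var 26 = p := by simp [hs4, h26]
  rw [WP_seq]
  refine (cr_spec he4 hb4 (by omega) (by omega)).mono hb4 fun s5 hs5 hb5 h21 => ?_
  have he5 := he4.same hs5 (by decide) (by decide)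
  rw [a25, a26] at h21
  rw [WP_seq, WP_set]
  refine ⟨trivial, hb5.1 _, ?_⟩
  set s6 := s5.set 35 (Expr.val s5 (v 21)) with hs6
  have hb6 : s6.Bdd (bnd n) := hb5.set (hb5.1 _)
  have he6 : Env n I δ s6 := he5.congr (by simp [hs6]) (by simp [hs6])
  rw [WP_seq, WP_set]
  refine ⟨trivial, hb6.1 _, ?_⟩
  set s7 := s6.set 25 (Expr.val s6 (v 15)) with hs7
  have hb7 : s7.Bdd (bnd n) := hb6.set (hb6.1 _)
  have he7 : Env n I δ s7 := he6.congr (by simp [hs7]) (by simp [hs7])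
  have b25 : s7.var 25 = s.var 15 := by
    simp [hs7, hs6, hs5.1 15 (by decide), hs4, hs3.1 15 (by decide), e2a]
  have b26 : s7.var 26 = p := by simp [hs7, hs6, hs5.1 26 (by decide), hs4, h26]
  rw [WP_seq]
  refine (cr_spec he7 hb7 (by omega) (by omega)).mono hb7 fun s8 hs8 hb8 h21' => ?_
  rw [b25, b26] at h21'
  have h35 : s8.var 35 = I.cr δ (s.var 33) p := by
    simp [hs8.1 35 (by decide), hs7, hs6, h21]
  have h18 : s8.var 18 = s.var 18 := by
    simp [hs8.1 18 (by decide), hs7, hs6, hs5.1 18 (by decide), hs4, hs3.1 18 (by decide), e2b]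
  have hf : I.Fits δ (s.var 33) (s.var 15) ↔ s8.var 35 = s8.var 21 := by
    rw [h35, h21']
    exact ⟨fun h => h.2, fun h => ⟨hne, h⟩⟩
  simp only [WP_ite, Expr.val_eq, Expr.val_var, WP_set, WP_skip, hf, h18]
  refine ⟨⟨trivial, trivial⟩, fun h => ?_, fun h => ⟨trivial, TD.lt_bnd (by simp), ?_⟩⟩
  · have h' : s8.var 21 = s8.var 35 := by by_contra hc; simp [hc] at h
    simp [h']
  · have h' : ¬ s8.var 35 = s8.var 21 := by intro hc; simp [hc] at h
    simp [h']

/-- Scalar 33 runs through the proper ancestors and stays 0 after the virtual root is reached; the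
`dd + 1` iterations match the range `k ≤ dd` in `Valid`. -/
theorem ancestors_spec (hd : 0 < I.dd) (h0 : I.par 0 = 0) (he : Env n I δ s)
    (hb : s.Bdd (bnd n)) (hu : s.var 15 ∈ Finset.Icc 1 I.nv)
    (hl : s.var 32 = I.ell δ (s.var 15)) :
    WP (bnd n) F ancestorsC s fun s' => s'.var 18 ≠ 0 ↔ s.var 18 ≠ 0 ∧
      ∀ k ≤ I.dd, I.par^[k + 1] (s.var 15) ≠ 0 →
        I.adj (s.var 15) (I.par^[k + 1] (s.var 15)) →
          I.Fits δ (I.par^[k + 1] (s.var 15)) (s.var 15) := by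
  set u := s.var 15 with hu15
  have hu1 := Finset.mem_Icc.1 hu
  rw [ancestorsC, WP_seq, WP_set]
  refine ⟨⟨trivial, he.lt_bnd (by simpa using hu1.2)⟩, hb.2 _ _, ?_⟩
  set s1 := s.set 33 (Expr.val s (.get 2 (v 15))) with hs1
  have hb1 : s1.Bdd (bnd n) := hb.set (hb.2 _ _)
  have he1 : Env n I δ s1 := he.congr (by simp [hs1]) (by simp [hs1])
  refine WP.for_ (fun i s' => s'.var 33 = I.par^[i + 1] u ∧ (s'.var 18 ≠ 0 ↔ s.var 18 ≠ 0 ∧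
      ∀ k < i, I.par^[k + 1] u ≠ 0 → I.adj u (I.par^[k + 1] u) → I.Fits δ (I.par^[k + 1] u) u))
      (by decide) (by decide) (by decide) hb1 ?_ ?_ ?_
  · simp [hs1, ← hu15, he.par _ hu1.2]
  · rintro i hi s' hs' hb' hx ⟨hI1, hI2⟩
    have he' := he1.same hs' (by decide) (by decide)
    have hx33 : I.par^[i + 1] u ≤ I.nv := he.iterate_le hu1.2 _
    have e15 : s'.var 15 = u := by simp [hs'.1 15 (by decide), hs1, ← hu15]
    have e32 : s'.var 32 = I.ell δ u := by simp [hs'.1 32 (by decide), hs1, hl]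
    have hstep : ∀ P : ℕ → Prop, (∀ k < i + 1, P k) ↔ (∀ k < i, P k) ∧ P i := fun P => by
      simp only [Nat.lt_succ_iff_lt_or_eq, or_imp, forall_and, forall_eq]
    simp only [hstep]
    rw [WP_ite, Expr.val_var, hI1, WP_skip]
    refine ⟨trivial, fun hne => ?_, fun h => ?_⟩
    · have hx1 : I.par^[i + 1] u ∈ Finset.Icc 1 I.nv :=
        Finset.mem_Icc.2 ⟨Nat.one_le_iff_ne_zero.2 hne, hx33⟩
      have hadj : Expr.val s' (adjE (v 15) (v 33)) ≠ 0 ↔ I.adj u (I.par^[i + 1] u) := by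
        rw [← he'.adj u hu _ hx1]
        simp [adjE, e15, hI1, he'.v0]
      have hok : (adjE (v 15) (v 33)).ok (bnd n) s' := by
        refine ⟨⟨⟨⟨trivial, trivial⟩, trivial⟩, trivial⟩, ?_⟩
        simp only [Expr.val_add, Expr.val_mul, Expr.val_var, Expr.val_ofNat, e15, hI1, he'.v0]
        exact adj_idx_lt (hu1.2.trans he.nv_le) (hx33.trans he.nv_le)
      rw [WP_seq]
      have key : WP (bnd n) F (.ite (adjE (v 15) (v 33)) fitsC .skip) s' fun t =>
          t.var 18 ≠ 0 ↔ s'.var 18 ≠ 0 ∧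
            (I.adj u (I.par^[i + 1] u) → I.Fits δ (I.par^[i + 1] u) u) := by
        rw [WP_ite, hadj, WP_skip]
        refine ⟨hok, fun ha => ?_, fun ha => ?_⟩
        · refine (fits_spec hd he' hb' (by omega) (by omega) (by rw [e32, e15])).mono hb'
            fun t _ _ ht => ?_
          rw [ht, e15, hI1]
          simp [ha, -Function.iterate_succ]
        · have ha : ¬ I.adj u (I.par^[i + 1] u) := by rw [← hadj]; simpa using ha
          simp [ha, -Function.iterate_succ]
      refine key.mono hb' fun t ht htb ht18 => ?_
      have het := he'.same ht (by decide) (by decide)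
      have t33 : t.var 33 = I.par^[i + 1] u := by rw [ht.1 33 (by decide), hI1]
      rw [WP_set]
      refine ⟨⟨trivial, by rw [Expr.val_var, t33]; exact he.lt_bnd hx33⟩, htb.2 _ _, ?_, ?_⟩
      · simp [t33, het.par _ hx33, Function.iterate_succ_apply' I.par (i + 1), -Function.iterate_succ]
      · simp only [St.set_var]
        norm_num
        have := ht18.trans (and_congr_left fun _ => hI2)
        simp only [ne_eq] at this hne
        rw [this]
        exact ⟨fun h => ⟨h.1.1, h.1.2, fun _ => h.2⟩, fun h => ⟨⟨h.1, h.2.1⟩, h.2.2 hne⟩⟩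
    · rw [Function.iterate_succ_apply' I.par (i + 1), h, h0]
      simp only [St.set_var]
      norm_num
      refine ⟨by rw [hI1, h], ?_⟩
      simpa using hI2
  · rintro s' hs' hb' ⟨-, hI⟩
    rw [hI, he1.v9]
    simp only [Nat.lt_succ_iff]

theorem valid_spec (hd : 0 < I.dd) (h0 : I.par 0 = 0) (he : Env n I δ s)
    (hb : s.Bdd (bnd n)) (hu : s.var 15 ∈ Finset.Icc 1 I.nv) :
    WP (bnd n) F validC s fun s' => s'.var 18 ≠ 0 ↔ I.Valid δ (s.var 15) := by
  set u := s.var 15 with hu15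
  have hu1 := Finset.mem_Icc.1 hu
  have hlt : I.ell δ u < I.dd := Inst.lastNZ_lt_of_pos _ _ hd
  have hddn := he.dd_le
  rw [validC, WP_seq, WP_set]
  refine ⟨trivial, TD.lt_bnd (by simp), ?_⟩
  set s1 := s.set 18 (Expr.val s 1) with hs1
  have hb1 : s1.Bdd (bnd n) := hb.set (TD.lt_bnd (by simp))
  have he1 : Env n I δ s1 := he.congr (by simp [hs1]) (by simp [hs1])
  have a15 : s1.var 15 = u := by simp [hs1, hu15]
  have a18 : s1.var 18 = 1 := by simp [hs1]
  rw [WP_seq]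
  refine (pattern_spec he1 hb1 (by omega)).mono hb1 fun s2 hs2 hb2 h18 => ?_
  have he2 := he1.same hs2 (by decide) (by decide)
  have b15 : s2.var 15 = u := by rw [hs2.1 15 (by decide), a15]
  rw [a15, a18] at h18
  rw [WP_seq, WP_set]
  refine ⟨trivial, hb2.1 _, ?_⟩
  set s3 := s2.set 28 (Expr.val s2 (v 15)) with hs3
  have hb3 : s3.Bdd (bnd n) := hb2.set (hb2.1 _)
  have he3 : Env n I δ s3 := he2.congr (by simp [hs3]) (by simp [hs3])
  rw [WP_seq]
  refine (ell_spec he3 hb3 (by simp [hs3, b15]; omega)).mono hb3 fun s4 hs4 hb4 h29 => ?_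
  have he4 := he3.same hs4 (by decide) (by decide)
  replace h29 : s4.var 29 = I.ell δ u := by rw [h29]; simp [hs3, b15]
  have d15 : s4.var 15 = u := by simp [hs4.1 15 (by decide), hs3, b15]
  have d18 : s4.var 18 = s2.var 18 := by simp [hs4.1 18 (by decide), hs3]
  rw [WP_seq, WP_set]
  refine ⟨trivial, hb4.1 _, ?_⟩
  set s5 := s4.set 32 (Expr.val s4 (v 29)) with hs5
  have hb5 : s5.Bdd (bnd n) := hb4.set (hb4.1 _)
  have he5 : Env n I δ s5 := he4.congr (by simp [hs5]) (by simp [hs5])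
  have e15 : s5.var 15 = u := by simp [hs5, d15]
  have e32 : s5.var 32 = I.ell δ u := by simp [hs5, h29]
  have e18 : s5.var 18 = s2.var 18 := by simp [hs5, d18]
  have hlab : s5.arr 3 u = I.lab u := he5.lab u hu
  rw [WP_seq]
  have key : WP (bnd n) F (.ite (.get 3 (v 15)) (.ite (.eq (.get 3 (v 15)) (v 32 + 1)) .skip
      (.set 18 0)) .skip) s5 fun t => t.var 18 ≠ 0 ↔ s2.var 18 ≠ 0 ∧
        (I.lab u = 0 ∨ I.lab u = I.ell δ u + 1) := by
    simp only [WP_ite, WP_set, WP_skip, Expr.val_eq, Expr.val_add, Expr.val_get, Expr.val_var,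
      Expr.val_ofNat, e15, e32, hlab, e18, Expr.ok_get, Expr.ok_var, Expr.ok_eq, Expr.ok_add,
      Expr.ok_ofNat, he.lt_bnd hu1.2]
    refine ⟨by simp, fun h => ⟨by simp, fun h' => ?_, fun h' => ⟨trivial, TD.lt_bnd (by omega), ?_⟩⟩,
      fun h => by simp [h]⟩
    · have : I.lab u = I.ell δ u + 1 := by by_contra hc; simp [hc] at h'
      simp [this]
    · have : ¬ I.lab u = I.ell δ u + 1 := by intro hc; simp [hc] at h'
      simp [this, h]
  refine key.mono hb5 fun s6 hs6 hb6 f18 => ?_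
  have he6 := he5.same hs6 (by decide) (by decide)
  have f15 : s6.var 15 = u := by rw [hs6.1 15 (by decide), e15]
  have f32 : s6.var 32 = I.ell δ u := by rw [hs6.1 32 (by decide), e32]
  rw [WP_seq, WP_set]
  refine ⟨trivial, hb6.1 _, ?_⟩
  set s7 := s6.set 25 (Expr.val s6 (v 15)) with hs7
  have hb7 : s7.Bdd (bnd n) := hb6.set (hb6.1 _)
  have he7 : Env n I δ s7 := he6.congr (by simp [hs7]) (by simp [hs7])
  rw [WP_seq, WP_set]
  refine ⟨trivial, hb7.1 _, ?_⟩
  set s8 := s7.set 26 (Expr.val s7 (v 32)) with hs8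
  have hb8 : s8.Bdd (bnd n) := hb7.set (hb7.1 _)
  have he8 : Env n I δ s8 := he7.congr (by simp [hs8]) (by simp [hs8])
  have g25 : s8.var 25 = u := by simp [hs8, hs7, f15]
  have g26 : s8.var 26 = I.ell δ u := by simp [hs8, hs7, f32]
  rw [WP_seq]
  refine (cr_spec he8 hb8 (by omega) (by omega)).mono hb8 fun s9 hs9 hb9 h21 => ?_
  have he9 := he8.same hs9 (by decide) (by decide)
  rw [g25, g26] at h21
  have i26 : s9.var 26 = I.ell δ u := by rw [hs9.1 26 (by decide), g26]
  have i15 : s9.var 15 = u := by simp [hs9.1 15 (by decide), hs8, hs7, f15]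
  have i18 : s9.var 18 = s6.var 18 := by simp [hs9.1 18 (by decide), hs8, hs7]
  have i32 : s9.var 32 = I.ell δ u := by simp [hs9.1 32 (by decide), hs8, hs7, f32]
  have hcr : I.cr δ u (I.ell δ u) ≤ I.nv := he.follow_le hu1.2 _ _
  rw [WP_seq]
  have key2 : WP (bnd n) F (.ite (.eq (digE (v 26) (v 21)) 2) .skip (.set 18 0)) s9 fun t =>
      t.var 18 ≠ 0 ↔ s6.var 18 ≠ 0 ∧ δ (I.cr δ u (I.ell δ u)) (I.ell δ u) = 2 := by
    have hv : Expr.val s9 (digE (v 26) (v 21)) = δ (I.cr δ u (I.ell δ u)) (I.ell δ u) := by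
      rw [he9.digE_val (by simp [i26]; omega) (by simp [h21, hcr])]; simp [i26, h21]
    simp only [WP_ite, WP_set, WP_skip, Expr.val_eq, hv, Expr.val_ofNat, i18]
    refine ⟨⟨he9.digE_ok trivial trivial (by simp [i26]; omega) (by simp [h21, hcr]), trivial⟩,
      fun h => ?_, fun h => ⟨trivial, TD.lt_bnd (by omega), ?_⟩⟩
    · have : δ (I.cr δ u (I.ell δ u)) (I.ell δ u) = 2 := by by_contra hc; simp [hc] at h
      simp [this]
    · have : ¬ δ (I.cr δ u (I.ell δ u)) (I.ell δ u) = 2 := by intro hc; simp [hc] at h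
      simp [this]
  refine key2.mono hb9 fun s10 hs10 hb10 j18 => ?_
  have he10 := he9.same hs10 (by decide) (by decide)
  have j15 : s10.var 15 = u := by rw [hs10.1 15 (by decide), i15]
  have j32 : s10.var 32 = I.ell δ u := by rw [hs10.1 32 (by decide), i32]
  refine (ancestors_spec hd h0 he10 hb10 (by rwa [j15]) (by rw [j15, j32])).mono hb10
    fun t _ _ ht => ?_
  rw [ht, j18, f18, h18, j15, Inst.Valid]
  simp [and_assoc]

/-- Negation is computed as the modulus minus a residue, which may yield the modulus itself. Hence
the result is described in `ZMod` and not as a reduced number. -/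
theorem fac_spec (he : Env n I δ s) (hb : s.Bdd (bnd n)) (hu : s.var 15 ≤ I.nv)
    (hm : 0 < s.var 11) :
    WP (bnd n) F facC s fun s' => ((s'.var 17 : ℕ) : ZMod (s.var 11)) =
      ∏ q ∈ Finset.range I.dd, fac ((s.var 10 : ℕ) : ZMod (s.var 11)) (δ (s.var 15) q) := by
  rw [facC, WP_seq, WP_set]
  refine ⟨trivial, TD.lt_bnd (by simp), ?_⟩
  set s1 := s.set 17 (Expr.val s 1) with hs1
  have hb1 : s1.Bdd (bnd n) := hb.set (TD.lt_bnd (by simp))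
  have he1 : Env n I δ s1 := he.congr (by simp [hs1]) (by simp [hs1])
  refine WP.for_ (fun i s' => ((s'.var 17 : ℕ) : ZMod (s.var 11)) =
      ∏ q ∈ Finset.range i, fac ((s.var 10 : ℕ) : ZMod (s.var 11)) (δ (s.var 15) q)) (by decide)
    (by decide) (by decide) hb1 ?_ ?_ ?_
  · simp [hs1]
  · intro i hi s' hs' hb' hx hI
    have he' := he1.same hs' (by decide) (by decide)
    rw [he1.v2] at hi
    have e15 : Expr.val s' (v 15) = s.var 15 := by simp [hs'.1 15 (by decide), hs1]
    have e10 : s'.var 10 = s.var 10 := by simp [hs'.1 10 (by decide), hs1]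
    have e11 : s'.var 11 = s.var 11 := by simp [hs'.1 11 (by decide), hs1]
    have h31 : Expr.val s' (v 31) = i := hx
    have hok := he'.digE_ok (q := v 31) (u := v 15) trivial trivial (by omega) (by omega)
    have hml := Nat.mod_lt (s'.var 17 * s'.var 10) (e11 ▸ hm)
    have hm' := hb'.1 11
    simp only [WP_ite, WP_set, WP_skip, Expr.val_eq, Expr.val_ofNat,
      he'.digE_val (q := v 31) (u := v 15) (by omega) (by omega), h31, e15,
      Finset.prod_range_succ, ← hI]
    refine ⟨⟨hok, trivial⟩, fun h => ⟨⟨⟨trivial, trivial⟩, trivial⟩, ?_, ?_⟩, fun h =>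
      ⟨⟨hok, trivial⟩, fun h' => ⟨⟨trivial, ⟨trivial, trivial⟩, trivial⟩, ?_, ?_⟩, fun h' => ?_⟩⟩
    · simp only [Expr.val_mod, Expr.val_mul, Expr.val_var]; omega
    · have : δ (s.var 15) i = 2 := by by_contra hc; simp [hc] at h
      simp [this, fac, e10, e11]
    · simp only [Expr.val_mod, Expr.val_mul, Expr.val_var, Expr.val_sub]; omega
    · have h3 : δ (s.var 15) i = 3 := by by_contra hc; simp [hc] at h'
      simp [h3, fac, e10, e11]
      rw [Nat.cast_sub (by rw [e10, e11] at hml; exact hml.le)]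
      simp
    · have h2 : δ (s.var 15) i ≠ 2 := by intro hc; simp [hc] at h
      have h3 : δ (s.var 15) i ≠ 3 := by intro hc; simp [hc] at h'
      simp [h2, h3, fac]
  · intro s' hs' hb' hI
    rw [he1.v2] at hI
    exact hI

theorem weight_spec (hd : 0 < I.dd) (h0 : I.par 0 = 0) (he : Env n I δ s)
    (hb : s.Bdd (bnd n)) (hu : s.var 15 ∈ Finset.Icc 1 I.nv) (hm : 0 < s.var 11) :
    WP (bnd n) F weightC s fun s' => ((s'.var 17 : ℕ) : ZMod (s.var 11)) =
      I.weight ((s.var 10 : ℕ) : ZMod (s.var 11)) δ (s.var 15) := by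
  have hu1 := Finset.mem_Icc.1 hu
  rw [weightC, WP_seq]
  refine (valid_spec hd h0 he hb hu).mono hb fun s1 hs1 hb1 h18 => ?_
  have he1 := he.same hs1 (by decide) (by decide)
  have e11 := hs1.1 11 (by decide)
  have e10 := hs1.1 10 (by decide)
  have e15 := hs1.1 15 (by decide)
  rw [WP_seq]
  refine (fac_spec he1 hb1 (by omega) (by omega)).mono hb1 fun s2 hs2 hb2 h17 => ?_
  rw [e11, e10, e15] at h17
  rw [WP_ite, WP_skip, WP_set, Expr.val_var, hs2.1 18 (by decide), h18]
  refine ⟨trivial, fun h => ?_, fun h => ⟨trivial, TD.lt_bnd (by simp), ?_⟩⟩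
  · rw [Inst.weight, if_pos h, h17]
  · have h : ¬ I.Valid δ (s.var 15) := by rw [← h18]; simpa using h
    rw [Inst.weight, if_neg h]; simp

end

end TD

namespace TD

/-! ### The steps of the traversal as a program -/

/-- Increments the code of `15`; `37` is the carry. -/
def incC : Cmd := .seq (.set 37 1) <| .for_ 38 8 <| .ite (v 37)
  (.ite (.eq (digE (v 38) (v 15)) 3) (.put 4 (v 38 * v 20 + v 15) 0)
    (.seq (.put 4 (v 38 * v 20 + v 15) (digE (v 38) (v 15) + 1)) (.set 37 0))) .skip

def enterC : Cmd := .seq (.set 36 (.get 7 (v 15) + 1)) <| .seq (.put 7 (v 15) (v 36)) <|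
  .ite (.eq (.get 2 (v 36)) (v 15))
    (.seq (.put 5 (v 36) 0) <| .seq (.put 6 (v 36) 1) <| .seq (.put 7 (v 36) 0) (.set 15 (v 36)))
    .skip

def nextC : Cmd := .seq weightC <|
  .seq (.put 5 (v 15) ((.get 5 (v 15) + v 17 * .get 6 (v 15)) % v 11)) <| .seq incC <|
  .ite (v 37) (.seq (.set 36 (.get 2 (v 15))) <|
      .seq (.put 6 (v 36) (.get 6 (v 36) * .get 5 (v 15) % v 11)) (.set 15 (v 36)))
    (.seq (.put 6 (v 15) 1) (.put 7 (v 15) 0))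

/-- One step of the traversal. -/
def stepC : Cmd := .ite (.lt (.get 7 (v 15)) (v 7)) enterC (.ite (v 15) nextC (.set 16 0))

theorem idx_eq {n q q' u u' : ℕ} (hu : u ≤ n) (hu' : u' ≤ n) :
    q * (n + 1) + u = q' * (n + 1) + u' ↔ q = q' ∧ u = u' := by
  constructor
  · intro h
    have h1 : q = q' := by
      have := congrArg (· / (n + 1)) h
      simpa [Nat.add_div_of_dvd_right, Nat.div_eq_of_lt (Nat.lt_succ_of_le hu),
        Nat.div_eq_of_lt (Nat.lt_succ_of_le hu')] using this
    subst h1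
    exact ⟨rfl, by omega⟩
  · rintro ⟨rfl, rfl⟩; rfl

theorem succ_div_of_carry {c b : ℕ} (h : c % b + 1 = b) : (c + 1) / b = c / b + 1 := by
  have hb : 0 < b := by omega
  have := Nat.div_add_mod c b
  rw [show c + 1 = b * (c / b + 1) by rw [mul_add]; omega, Nat.mul_div_cancel_left _ hb]

theorem succ_div_of_not_carry {c b : ℕ} (hb : 0 < b) (h : c % b + 1 ≠ b) :
    (c + 1) / b = c / b := by
  have := Nat.div_add_mod c b
  have := Nat.mod_lt c hb
  rw [show c + 1 = c % b + 1 + b * (c / b) by omega, Nat.add_mul_div_left _ _ hb,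
    Nat.div_eq_of_lt (by omega), zero_add]

/-- The carry passes digit `i` just if it arrives there and the digit is 3. -/
theorem carry_succ (c i : ℕ) : c % 4 ^ (i + 1) + 1 = 4 ^ (i + 1) ↔
    c % 4 ^ i + 1 = 4 ^ i ∧ c / 4 ^ i % 4 = 3 := by
  have h := Nat.mod_mul (x := c) (a := 4 ^ i) (b := 4)
  have h1 := Nat.mod_lt c (show 0 < 4 ^ i by positivity)
  have h2 := Nat.mod_lt (c / 4 ^ i) (show 0 < 4 by norm_num)
  rw [pow_succ, h]
  generalize c / 4 ^ i % 4 = d at *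
  generalize c % 4 ^ i = e at *
  generalize 4 ^ i = b at *
  constructor
  · intro h
    interval_cases d <;> omega
  · rintro ⟨h3, rfl⟩
    omega

section

variable {n F : ℕ} {I : Inst} {s : St}

/-- A code need not fit below `bnd n`, so it exists only as digits. The final carry detects the last
code, and then the digits have wrapped to 0. The two options for `c` serve the steps `next` and
`leave`. -/
theorem inc_spec {γ : ℕ → ℕ} (he : Env n I (dgt γ) s) (hb : s.Bdd (bnd n))
    (hu : s.var 15 ≤ I.nv) (hγ : γ (s.var 15) < 4 ^ (2 * I.dd)) :
    WP (bnd n) F incC s fun s' => (s'.var 37 ≠ 0 ↔ γ (s.var 15) + 1 = 4 ^ (2 * I.dd)) ∧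
      ∀ c, (c = γ (s.var 15) + 1 ∨ c = 0 ∧ γ (s.var 15) + 1 = 4 ^ (2 * I.dd)) →
        Env n I (dgt (Function.update γ (s.var 15) c)) s' := by
  set u := s.var 15 with hu15
  have hnv := he.nv_le
  have hddn := he.dd_le
  rw [incC, WP_seq, WP_set]
  refine ⟨trivial, TD.lt_bnd (by simp), ?_⟩
  set s1 := s.set 37 (Expr.val s 1) with hs1
  have hb1 : s1.Bdd (bnd n) := hb.set (TD.lt_bnd (by simp))
  have he1 : Env n I (dgt γ) s1 := he.congr (by simp [hs1]) (by simp [hs1])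
  refine WP.for_ (fun i s' => (s'.var 37 ≠ 0 ↔ γ u % 4 ^ i + 1 = 4 ^ i) ∧
      ∀ x ≤ I.nv, ∀ q < 2 * I.dd, s'.arr 4 (q * (n + 1) + x) =
        if x = u ∧ q < i then (γ u + 1) / 4 ^ q % 4 else dgt γ x q) (by decide)
    (by decide) (by decide) hb1 ?_ ?_ ?_
  · refine ⟨by simp [hs1, Nat.mod_one], fun x hx q hq => ?_⟩
    simp only [Nat.not_lt_zero, and_false, if_false, St.set_arr]
    exact he1.dig x hx q hq
  · rintro i hi s' hs' hb' hx ⟨hI1, hI2⟩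
    rw [he1.v8] at hi
    have e15 : s'.var 15 = u := by simp [hs'.1 15 (by decide), hs1, hu15]
    have e20 : s'.var 20 = n + 1 := by rw [hs'.1 20 (by decide), he1.v20]
    have hcell : s'.arr 4 (i * (n + 1) + u) = γ u / 4 ^ i % 4 := by
      rw [hI2 u hu i hi, if_neg (by omega), dgt]
    have hdiv := succ_div_of_not_carry (c := γ u) (b := 4 ^ i) (by positivity)
    have hdiv' := succ_div_of_carry (c := γ u) (b := 4 ^ i)
    have hd4 := Nat.mod_lt (γ u / 4 ^ i) (show 0 < 4 by norm_num)
    have hidx : i * (n + 1) + u < bnd n := idx_lt (by omega) (by omega)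
    have harr : ∀ y, y = (γ u + 1) / 4 ^ i % 4 → ∀ x ≤ I.nv, ∀ q < 2 * I.dd,
        Function.update (s'.arr 4) (i * (n + 1) + u) y (q * (n + 1) + x) =
          if x = u ∧ q < i + 1 then (γ u + 1) / 4 ^ q % 4 else dgt γ x q := by
      rintro y rfl x hx q hq
      simp only [Function.update_apply, idx_eq (hx.trans hnv) (hu.trans hnv), hI2 x hx q hq]
      by_cases h1 : x = u
      · rcases lt_trichotomy q i with h2 | h2 | h2
        · simp [h1, h2, h2.ne, h2.trans (Nat.lt_succ_self i)]
        · simp [h1, h2]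
        · simp [h1, h2.ne', show ¬ q < i by omega, show ¬ q < i + 1 by omega]
      · simp [h1]
    simp only [WP_ite, WP_seq, WP_put, WP_set, WP_skip, digE, Expr.val_eq, Expr.val_add,
      Expr.val_mul, Expr.val_get, Expr.val_var, Expr.val_ofNat, Expr.ok_get, Expr.ok_add,
      Expr.ok_mul, Expr.ok_var, Expr.ok_eq, Expr.ok_ofNat, hx, e15, e20, hcell, carry_succ,
      true_and, and_true]
    refine ⟨fun hc => ⟨hidx, fun h3 => ⟨hidx, TD.lt_bnd (by omega), ?_, ?_⟩, fun h3 => ?_⟩,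
      fun hc => ⟨?_, fun x hx q hq => ?_⟩⟩
    · have : γ u / 4 ^ i % 4 = 3 := by by_contra hn; simp [hn] at h3
      simp only [St.put_var, St.set_var, if_neg (show (37 : ℕ) ≠ 38 by decide), this,
        and_true]
      exact hI1
    · have h3 : γ u / 4 ^ i % 4 = 3 := by by_contra hn; simp [hn] at h3
      have h4 := hdiv' (hI1.1 hc)
      simpa using harr 0 (by omega)
    · have h3 : γ u / 4 ^ i % 4 ≠ 3 := by intro hn; simp [hn] at h3
      have h4 := hdiv' (hI1.1 hc)
      refine ⟨hidx, hidx, TD.lt_bnd (by omega), TD.lt_bnd (by omega), ?_, ?_⟩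
      · simp [h3]
      · simpa using harr (γ u / 4 ^ i % 4 + 1) (by omega)
    · have : ¬ γ u % 4 ^ i + 1 = 4 ^ i := by rw [← hI1]; simpa using hc
      simp [this, hc]
    · have h5 := hdiv (by rw [ne_eq, ← hI1]; simpa using hc)
      have := harr (s'.arr 4 (i * (n + 1) + u)) (by rw [hcell, h5]) x hx q hq
      rw [Function.update_eq_self] at this
      simpa using this
  · rintro s' hs' hb' ⟨hI1, hI2⟩
    rw [he1.v8] at hI1 hI2
    rw [Nat.mod_eq_of_lt hγ] at hI1
    refine ⟨hI1, fun c hc => ?_⟩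
    refine ⟨by rw [hs'.1 0 (by decide), he1.v0], by rw [hs'.1 2 (by decide), he1.v2],
      by rw [hs'.1 7 (by decide), he1.v7], by rw [hs'.1 8 (by decide), he1.v8],
      by rw [hs'.1 9 (by decide), he1.v9], by rw [hs'.1 20 (by decide), he1.v20], he.dd_le,
      he.nv_le, by rw [hs'.2 2 (by decide)]; exact he1.par, he.par_le,
      by rw [hs'.2 3 (by decide)]; exact he1.lab, by rw [hs'.2 0 (by decide)]; exact he1.adj,
      fun x hx q hq => ?_⟩
    rw [hI2 x hx q hq]
    by_cases h : x = u
    · subst h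
      simp only [true_and, hq, if_true, dgt, Function.update_self]
      rcases hc with rfl | ⟨rfl, hc⟩
      · rfl
      · rw [hc, Nat.pow_div hq.le (by norm_num), Nat.zero_div, Nat.zero_mod]
        obtain ⟨k, hk⟩ := Nat.exists_eq_add_of_lt hq
        rw [hk, show q + k + 1 - q = k + 1 by omega, pow_succ, Nat.mul_mod_left]
    · simp [h, dgt]

/-- The state holds the traversal state `S`. -/
structure TRep (n : ℕ) (I : Inst) (m X : ℕ) (S : Trav (ZMod m)) (s : St) : Prop where
  env : Env n I (dgt S.code) s
  v10 : s.var 10 = X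
  v11 : s.var 11 = m
  v15 : s.var 15 = S.cur
  v16 : s.var 16 ≠ 0
  cur_le : S.cur ≤ I.nv
  ch : ∀ u ≤ I.nv, s.arr 7 u = S.ch u
  sum : ∀ u ≤ I.nv, ((s.arr 5 u : ℕ) : ZMod m) = S.sum u
  prod : ∀ u ≤ I.nv, ((s.arr 6 u : ℕ) : ZMod m) = S.prod u
  code_lt : ∀ u, S.code u < 4 ^ (2 * I.dd)

theorem cast_update {m : ℕ} {f : ℕ → ℕ} {g : ℕ → ZMod m} {a x : ℕ} {y : ZMod m} {N : ℕ}
    (h : ∀ u ≤ N, ((f u : ℕ) : ZMod m) = g u) (hx : ((x : ℕ) : ZMod m) = y) :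
    ∀ u ≤ N, ((Function.update f a x u : ℕ) : ZMod m) = Function.update g a y u := by
  intro u hu
  by_cases h1 : u = a
  · subst h1; simpa using hx
  · simp [h1, h u hu]

theorem update_congr {f g : ℕ → ℕ} {a x : ℕ} {N : ℕ} (h : ∀ u ≤ N, f u = g u) :
    ∀ u ≤ N, Function.update f a x u = Function.update g a x u := by
  intro u hu
  by_cases h1 : u = a
  · subst h1; simp
  · simp [h1, h u hu]

/-- The tests of the program, scan unfinished, child found, carry, exclude all constructors of
`Step` but the one whose effect the branch produces. -/
theorem step_spec {m X : ℕ} {S S' : Trav (ZMod m)} (hd : 0 < I.dd) (h0 : I.par 0 = 0) (hm : 0 < m)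
    (hS : Step I.par I.nv (4 ^ (2 * I.dd)) (fun u γ => I.weight (X : ZMod m) (dgt γ) u) S S')
    (hr : TRep n I m X S s) (hb : s.Bdd (bnd n)) :
    WP (bnd n) F stepC s (TRep n I m X S') := by
  have he := hr.env
  have hcur := hr.cur_le
  have hch := hr.ch _ hcur
  have h15 := hr.v15
  have hnv := he.nv_le
  have hlt := he.lt_bnd hcur
  rw [stepC, WP_ite]
  simp only [Expr.val_lt, Expr.val_get, Expr.val_var, Expr.ok_lt, Expr.ok_get, Expr.ok_var,
    h15, hch, he.v7, hlt, true_and, and_true]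
  have henter : S.ch S.cur < I.nv → WP (bnd n) F enterC s (TRep n I m X S') := by
    intro hlt'
    rw [enterC, WP_seq, WP_set]
    refine ⟨⟨⟨trivial, by rw [Expr.val_var, h15]; exact hlt⟩, trivial⟩, ?_, ?_⟩
    · simp only [Expr.val_add, Expr.val_get, Expr.val_var, Expr.val_ofNat, h15, hch]
      exact TD.lt_bnd (by omega)
    rw [show Expr.val s (.get 7 (v 15) + 1) = S.ch S.cur + 1 by simp [h15, hch]]
    set x := S.ch S.cur + 1 with hx
    have hxn : x ≤ I.nv := hlt'
    have hxl := he.lt_bnd hxn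
    rw [WP_seq, WP_put]
    refine ⟨trivial, trivial, by simp [h15, hlt], by simp [hxl], ?_⟩
    rw [WP_ite]
    simp only [Expr.val_eq, Expr.val_get, Expr.val_var, Expr.ok_eq, Expr.ok_get, Expr.ok_var,
      St.put_var, St.put_arr, St.set_var, St.set_arr, if_true, hxl, h15,
      if_neg (show (15 : ℕ) ≠ 36 by decide), if_neg (show (2 : ℕ) ≠ 7 by decide),
      he.par _ hxn, WP_skip, WP_seq, WP_put, WP_set, Expr.val_ofNat, Expr.ok_ofNat,
      TD.lt_bnd (n := n) (a := 0) (by omega), TD.lt_bnd (n := n) (a := 1) (by omega), true_and]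
    have hbase : ∀ u ≤ I.nv, Function.update (s.arr 7) S.cur x u = Function.update S.ch S.cur x u :=
      update_congr hr.ch
    refine ⟨fun hp => ?_, fun hp => ?_⟩
    · have hp : I.par x = S.cur := by by_contra hc; simp [hc] at hp
      cases hS with
      | pass h hp' => exact absurd hp hp'
      | next h => omega
      | leave h => omega
      | enter h hp' =>
        refine ⟨he.congr (by simp) (by simp), by simp [hr.v10], by simp [hr.v11], by simp [hx],
          by simp [hr.v16], hxn, ?_, ?_, ?_, hr.code_lt⟩
        · simpa [h15] using update_congr (a := x) (x := 0) hbase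
        · simpa using cast_update (a := x) (x := 0) hr.sum (by simp)
        · simpa using cast_update (a := x) (x := 1) hr.prod (by simp)
    · have hp : I.par x ≠ S.cur := by intro hc; simp [hc] at hp
      cases hS with
      | enter h hp' => exact absurd hp' hp
      | next h => omega
      | leave h => omega
      | pass h hp' =>
        refine ⟨he.congr (by simp) (by simp), by simp [hr.v10], by simp [hr.v11], by simp [h15],
          by simp [hr.v16], hcur, ?_, ?_, ?_, hr.code_lt⟩
        · simpa [h15] using hbase
        · simpa using hr.sum
        · simpa using hr.prod
  have hnext : S.ch S.cur = I.nv → S.cur ≠ 0 → WP (bnd n) F nextC s (TRep n I m X S') := by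
    intro hend hne
    have hcI : S.cur ∈ Finset.Icc 1 I.nv := Finset.mem_Icc.2 ⟨by omega, hcur⟩
    rw [nextC, WP_seq]
    refine (weight_spec hd h0 he hb (by rwa [h15]) (by rw [hr.v11]; exact hm)).mono hb
      fun s1 hs1 hb1 h17 => ?_
    have he1 := he.same hs1 (by decide) (by decide)
    rw [hr.v10, hr.v11, h15] at h17
    have a15 : s1.var 15 = S.cur := by rw [hs1.1 15 (by decide), h15]
    have a10 : s1.var 10 = X := by rw [hs1.1 10 (by decide), hr.v10]
    have a11 : s1.var 11 = m := by rw [hs1.1 11 (by decide), hr.v11]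
    have a16 : s1.var 16 = s.var 16 := by rw [hs1.1 16 (by decide)]
    have A5 : s1.arr 5 = s.arr 5 := hs1.2 5 (by decide)
    have A6 : s1.arr 6 = s.arr 6 := hs1.2 6 (by decide)
    have A7 : s1.arr 7 = s.arr 7 := hs1.2 7 (by decide)
    have hmb : m < bnd n := by rw [← a11]; exact hb1.1 _
    rw [WP_seq, WP_put]
    set y := (s.arr 5 S.cur + s1.var 17 * s.arr 6 S.cur) % m with hy
    have hyv : Expr.val s1 ((.get 5 (v 15) + v 17 * .get 6 (v 15)) % v 11) = y := by
      simp [a15, A5, A6, a11, hy]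
    have hyb : y < bnd n := (Nat.mod_lt _ hm).trans hmb
    rw [hyv]
    refine ⟨trivial, ⟨⟨⟨trivial, by simp [a15, hlt]⟩, trivial, trivial, by simp [a15, hlt]⟩,
      trivial⟩, by simp [a15, hlt], hyb, ?_⟩
    have hyc : ((y : ℕ) : ZMod m) = S.sum S.cur +
        I.weight (X : ZMod m) (dgt S.code) S.cur * S.prod S.cur := by
      rw [hy, ZMod.natCast_mod, Nat.cast_add, Nat.cast_mul, hr.sum _ hcur, hr.prod _ hcur, h17]
    rw [Expr.val_var, a15]
    set s2 := s1.put 5 S.cur y with hs2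
    have hb2 : s2.Bdd (bnd n) := hb1.put hyb
    have he2 : Env n I (dgt S.code) s2 := he1.congr (by simp [hs2]) (by simp [hs2])
    have b15 : s2.var 15 = S.cur := by simp [hs2, a15]
    rw [WP_seq]
    refine (inc_spec he2 hb2 (by rwa [b15]) (by rw [b15]; exact hr.code_lt _)).mono hb2
      fun s3 hs3 hb3 => ?_
    rw [b15]
    rintro ⟨h37, henv⟩
    have c15 : s3.var 15 = S.cur := by rw [hs3.1 15 (by decide), b15]
    have c10 : s3.var 10 = X := by simp [hs3.1 10 (by decide), hs2, a10]
    have c11 : s3.var 11 = m := by simp [hs3.1 11 (by decide), hs2, a11]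
    have c16 : s3.var 16 ≠ 0 := by simp [hs3.1 16 (by decide), hs2, a16, hr.v16]
    have C5 : s3.arr 5 = Function.update (s.arr 5) S.cur y := by
      simp [hs3.2 5 (by decide), hs2, A5]
    have C6 : s3.arr 6 = s.arr 6 := by simp [hs3.2 6 (by decide), hs2, A6]
    have C7 : s3.arr 7 = s.arr 7 := by simp [hs3.2 7 (by decide), hs2, A7]
    have hsum := cast_update (a := S.cur) hr.sum hyc
    rw [WP_ite, Expr.val_var, h37]
    refine ⟨trivial, fun hB => ?_, fun hB => ?_⟩
    · have hpl := he.par_le _ hcur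
      have hplt := he.lt_bnd hpl
      have he3 := henv 0 (Or.inr ⟨rfl, hB⟩)
      rw [WP_seq, WP_set]
      refine ⟨⟨trivial, by simp [c15, hlt]⟩, hb3.2 _ _, ?_⟩
      rw [show Expr.val s3 (.get 2 (v 15)) = I.par S.cur by simp [c15, he3.par _ hcur]]
      simp only [WP_seq, WP_put, WP_set, Expr.ok_mod, Expr.ok_mul, Expr.ok_get, Expr.ok_var,
        Expr.val_mod, Expr.val_mul, Expr.val_get, Expr.val_var, St.set_var, St.set_arr, St.put_var,
        if_true, if_neg (show (15 : ℕ) ≠ 36 by decide), if_neg (show (11 : ℕ) ≠ 36 by decide),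
        c15, c11, C5, C6, Function.update_self, hplt, hlt, true_and, and_true]
      refine ⟨(Nat.mod_lt _ hm).trans hmb, ?_⟩
      cases hS with
      | pass h => omega
      | enter h => omega
      | next h h0 hB' => omega
      | leave h h0 hB' =>
        refine ⟨he3.congr (by simp) (by simp), by simp [c10], by simp [c11], by simp,
          by simp [c16], hpl, ?_, ?_, ?_, ?_⟩
        · simpa [C7] using hr.ch
        · simpa [C5] using hsum
        · simpa [C6] using cast_update (a := I.par S.cur) (x := s.arr 6 (I.par S.cur) * y % m) hr.prod
            (by rw [ZMod.natCast_mod, Nat.cast_mul, hr.prod _ hpl, hyc])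
        · intro u
          simp only [Function.update_apply]
          split_ifs
          · positivity
          · exact hr.code_lt u
    · have hB : S.code S.cur + 1 ≠ 4 ^ (2 * I.dd) := by rw [ne_eq, ← h37]; simpa using hB
      have he3 := henv _ (Or.inl rfl)
      simp only [WP_seq, WP_put, Expr.ok_var, Expr.ok_ofNat,
        Expr.val_ofNat, Expr.val_var, St.put_var,
        c15, hlt, TD.lt_bnd (n := n) (a := 0) (by omega), TD.lt_bnd (n := n) (a := 1) (by omega),
        true_and]
      cases hS with
      | pass h => omega
      | enter h => omega
      | leave h h0 hB' => omega
      | next h h0 hB' =>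
        refine ⟨he3.congr (by simp) (by simp), by simp [c10], by simp [c11], by simp [c15],
          by simp [c16], hcur, ?_, ?_, ?_, ?_⟩
        · simpa [C7] using update_congr (a := S.cur) (x := 0) hr.ch
        · simpa [C5] using hsum
        · simpa [C6] using cast_update (a := S.cur) (x := 1) hr.prod (by simp)
        · intro u
          simp only [Function.update_apply]
          split_ifs
          · exact hB'
          · exact hr.code_lt u
  refine ⟨fun h => henter ?_, fun h => ?_⟩
  · by_contra hc; simp [hc] at h
  · have h1 : ¬ S.ch S.cur < I.nv := by intro hc; simp [hc] at h
    rw [WP_ite, Expr.val_var, h15]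
    have h2 : S.ch S.cur = I.nv ∧ S.cur ≠ 0 := by
      cases hS with
      | pass h => omega
      | enter h => omega
      | leave h h0 hB' => exact ⟨h, h0⟩
      | next h h0 hB' => exact ⟨h, h0⟩
    exact ⟨trivial, fun _ => hnext h2.1 h2.2, fun h => absurd h h2.2⟩

theorem steps_spec {m X N M : ℕ} {S S' : Trav (ZMod m)} {Q : St → Prop} (hd : 0 < I.dd)
    (h0 : I.par 0 = 0) (hm : 0 < m)
    (hS : Steps I.par I.nv (4 ^ (2 * I.dd)) (fun u γ => I.weight (X : ZMod m) (dgt γ) u) N S S')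
    (hr : TRep n I m X S s) (hb : s.Bdd (bnd n))
    (hQ : ∀ s', s'.Bdd (bnd n) → TRep n I m X S' s' → WPN (bnd n) F M 16 stepC s' Q) :
    WPN (bnd n) F (N + M) 16 stepC s Q := by
  induction hS generalizing s with
  | zero S => rw [zero_add]; exact hQ s hb hr
  | succ h h' ih =>
    rw [add_right_comm]
    exact WPN.succ hr.v16 ((step_spec hd h0 hm h hr hb).mono hb fun s' _ hb' hr' => ih hr' hb' hQ)

end

end TD

namespace TD

/-! ### Evaluation and differences modulo small numbers -/

/-- Evaluates the generating function at `10` modulo `11`; the value is cell 0 of array `6`. -/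
def evalC : Cmd := .seq (.set 40 ((2 * v 0 + 1) * v 20)) <| .seq (.for_ 41 40 (.put 4 (v 41) 0)) <|
  .seq (.put 6 0 1) <| .seq (.put 7 0 0) <| .seq (.set 15 0) <| .seq (.set 16 1) (.whl 16 stepC)

/-- Takes the `7`-th difference of the values in array `8`. -/
def diffC : Cmd := .for_ 42 7 <| .seq (.set 43 (v 7 - v 42)) <| .for_ 44 43 <|
  .put 8 (v 44) ((.get 8 (v 44 + 1) + v 11 - .get 8 (v 44) % v 11) % v 11)

/-- Sets the flag `39` if the labels can be extended to a solution. -/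
def countC : Cmd := .seq (.set 39 0) <| .for_ 14 13 <| .seq (.set 11 (v 14 + 1)) <|
  .seq (.for_ 10 12 (.seq evalC (.put 8 (v 10) (.get 6 0)))) <| .seq diffC <|
  .ite (.get 8 0 % v 11) (.set 39 1) .skip

/-- Any contents of the digit array form some configuration, so between evaluations only the rest of
the environment has to be tracked. -/
theorem Env.any {n : ℕ} {I : Inst} {δ : ℕ → ℕ → ℕ} {s s' : St} (h : Env n I δ s)
    (hv : ∀ x ∈ [0, 2, 7, 8, 9, 20], s'.var x = s.var x)
    (ha : ∀ a ∈ [0, 2, 3], s'.arr a = s.arr a) :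
    Env n I (fun u q => s'.arr 4 (q * (n + 1) + u)) s' := by
  have h' : Env n I (fun u q => s'.arr 4 (q * (n + 1) + u)) { s with arr := s'.arr } := by
    simp only [List.mem_cons, List.not_mem_nil, or_false, forall_eq_or_imp, forall_eq] at ha
    exact ⟨h.v0, h.v2, h.v7, h.v8, h.v9, h.v20, h.dd_le, h.nv_le,
      fun u hu => by simpa [ha.2.1] using h.par u hu, h.par_le,
      fun u hu => by simpa [ha.2.2] using h.lab u hu,
      fun u hu x hx => by simpa [ha.1] using h.adj u hu x hx, fun u hu q hq => rfl⟩
  exact h'.congr hv fun _ _ => rfl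

theorem Env.same_any {n : ℕ} {I : Inst} {δ : ℕ → ℕ → ℕ} {c : Cmd} {s s' : St} (h : Env n I δ s)
    (hs : Same c s s') (hv : ∀ x ∈ [0, 2, 7, 8, 9, 20], x ∉ c.mods)
    (ha : ∀ a ∈ [0, 2, 3], a ∉ c.marrs) : Env n I (fun u q => s'.arr 4 (q * (n + 1) + u)) s' :=
  h.any (fun x hx => hs.1 x (hv x hx)) fun a hx => hs.2 a (ha a hx)

/-- A bound on the number of steps of the traversal. -/
def iters (n dd : ℕ) : ℕ := n + (dd + 2) * ((4 ^ (2 * dd)) ^ (dd + 2) * ((n + 1) * (n + 1))) + 1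

section

variable {n F : ℕ} {I : Inst} {δ : ℕ → ℕ → ℕ} {s : St} {lvl : ℕ → ℕ}

theorem zero_spec (he : Env n I δ s) (hb : s.Bdd (bnd n)) :
    WP (bnd n) F (.seq (.set 40 ((2 * v 0 + 1) * v 20)) (.for_ 41 40 (.put 4 (v 41) 0))) s
      (Env n I (dgt fun _ => 0)) := by
  have hN : (2 * n + 1) * (n + 1) < bnd n := by unfold bnd; nlinarith
  have hv : Expr.val s ((2 * v 0 + 1) * v 20) = (2 * n + 1) * (n + 1) := by simp [he.v0, he.v20]
  rw [WP_seq, WP_set, hv]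
  refine ⟨⟨⟨⟨trivial, trivial⟩, trivial⟩, trivial⟩, hN, ?_⟩
  set s1 := s.set 40 ((2 * n + 1) * (n + 1)) with hs1
  have hb1 : s1.Bdd (bnd n) := hb.set hN
  have he1 : Env n I δ s1 := he.congr (by simp [hs1]) (by simp [hs1])
  refine WP.for_ (fun i s' => ∀ x < i, s'.arr 4 x = 0) (by decide) (by decide) (by decide) hb1
    (by simp) ?_ ?_
  · intro i hi s' hs' hb' hx hI
    rw [WP_put, Expr.val_var, hx]
    refine ⟨trivial, trivial, hx ▸ hb'.1 _, TD.lt_bnd (by simp), fun x hxi => ?_⟩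
    simp only [St.set_arr, St.put_arr, if_true, Function.update_apply]
    split_ifs with h
    · rfl
    · exact hI x (by omega)
  · intro s' hs' hb' hI
    have he' := he1.same_any hs' (by decide) (by decide)
    refine { he' with dig := fun u hu q hq => ?_ }
    have := he.nv_le
    have := he.dd_le
    rw [hI _ (by simp [hs1]; nlinarith)]
    simp [dgt]

theorem eval_spec (hd : 0 < I.dd) (hT : RTree I.nv (I.dd + 1) I.par lvl) (he : Env n I δ s)
    (hb : s.Bdd (bnd n)) (hm : 0 < s.var 11) (hF : iters n I.dd ≤ F) :
    WP (bnd n) F evalC s fun s' =>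
      ((s'.arr 6 0 : ℕ) : ZMod (s.var 11)) = ((I.genFun (s.var 10 : ℕ) : ℤ) : ZMod (s.var 11)) := by
  set m := s.var 11 with hm11
  set X := s.var 10 with hX10
  have hassoc : ∀ (Q : St → Prop), WP (bnd n) F evalC s Q ↔
      WP (bnd n) F (.seq (.set 40 ((2 * v 0 + 1) * v 20)) (.for_ 41 40 (.put 4 (v 41) 0))) s
        fun s' => WP (bnd n) F (.seq (.put 6 0 1) <| .seq (.put 7 0 0) <| .seq (.set 15 0) <|
          .seq (.set 16 1) (.whl 16 stepC)) s' Q := fun Q => by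
    rw [evalC, WP_seq, WP_seq]; simp only [WP_seq]
  rw [hassoc]
  refine (zero_spec he hb).mono hb fun s1 hs1 hb1 he1 => ?_
  have a11 : s1.var 11 = m := hs1.1 11 (by decide)
  have a10 : s1.var 10 = X := hs1.1 10 (by decide)
  simp only [WP_seq, WP_put, WP_set, Expr.ok_ofNat, Expr.val_ofNat,
    TD.lt_bnd (n := n) (a := 0) (by omega), TD.lt_bnd (n := n) (a := 1) (by omega), true_and]
  set s2 := (((s1.put 6 0 1).put 7 0 0).set 15 0).set 16 1 with hs2
  have hb2 : s2.Bdd (bnd n) := (((hb1.put (TD.lt_bnd (by omega))).put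
    (TD.lt_bnd (by omega))).set (TD.lt_bnd (by omega))).set (TD.lt_bnd (by omega))
  let S : Trav (ZMod m) := ⟨0, fun _ => 0, fun u => (s2.arr 5 u : ℕ), fun u => (s2.arr 6 u : ℕ),
    s2.arr 7⟩
  have hr : TRep n I m X S s2 := ⟨he1.congr (by simp [hs2]) (by simp [hs2]),
    by simp [hs2, a10], by simp [hs2, a11], by simp [hs2, S], by simp [hs2], Nat.zero_le _,
    fun _ _ => rfl, fun _ _ => rfl, fun _ _ => rfl, fun _ => by positivity⟩
  obtain ⟨S', hst, hc', hch', hp'⟩ := traverse_root (par := I.par) (nv := I.nv)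
    (B := 4 ^ (2 * I.dd)) (w := fun u γ => I.weight (X : ZMod m) (dgt γ) u) hT (by positivity) S rfl
    (by simp [S, hs2]) (by simp [S, hs2]) fun _ => rfl
  rw [Inst.prod_treeSum_weight hT X] at hp'
  -- The additional iteration finds the scan at the virtual root complete and clears the loop
  -- condition.
  have hN : I.nv + ∑ x ∈ children I.par I.nv 0,
      travTime I.par I.nv (4 ^ (2 * I.dd)) (I.dd + 1 + 1) x + 1 ≤ F := by
    refine le_trans (Nat.succ_le_succ (Nat.add_le_add he.nv_le ?_)) hF
    refine le_trans (Finset.sum_le_sum_of_subset ?_) (le_trans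
      (sum_travTime_le hT (B := 4 ^ (2 * I.dd)) (by positivity) (I.dd + 1 + 1) 0) ?_)
    · intro x hx
      have := mem_children.1 hx
      simp [this.1]
    · have := he.nv_le
      gcongr
  refine WPN.whl hN (steps_spec (M := 1) hd hT.par_zero hm hst hr hb2 fun s3 hb3 hr3 => ?_)
  refine WPN.succ hr3.v16 ?_
  have e15 : s3.var 15 = 0 := by rw [hr3.v15, hc']
  have e7 : s3.arr 7 0 = I.nv := by rw [hr3.ch 0 (by omega), hch']
  have hlt0 : 0 < bnd n := TD.lt_bnd (by omega)
  simp only [stepC, WP_ite, Expr.val_lt, Expr.val_get, Expr.val_var, e15, e7, hr3.env.v7,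
    lt_irrefl, if_false, ne_eq, not_true, false_imp_iff, true_imp_iff, WP_set, Expr.ok_lt,
    Expr.ok_get, Expr.ok_var, true_and, Expr.ok_ofNat, Expr.val_ofNat, and_true, hlt0]
  refine WPN.zero (by simp) ?_
  rw [St.set_arr, hr3.prod 0 (by omega), hp']

theorem fwdDiff_iterate_succ (g : ℤ → ℤ) (r : ℕ) (y : ℤ) :
    (fwdDiff (1 : ℤ))^[r + 1] g y = (fwdDiff (1 : ℤ))^[r] g (y + 1) - (fwdDiff (1 : ℤ))^[r] g y := by
  rw [Function.iterate_succ_apply']; rfl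

/-- The differences are formed in place from left to right, so cell `y + 1` still holds the previous
order when cell `y` is overwritten. Adding the modulus first prevents truncation in the subtraction.
-/
theorem diff_spec (g : ℤ → ℤ) (hb : s.Bdd (bnd n)) (hnv : s.var 7 ≤ n) (hm : 0 < s.var 11)
    (hg : ∀ y ≤ s.var 7, ((s.arr 8 y : ℕ) : ZMod (s.var 11)) = ((g y : ℤ) : ZMod (s.var 11))) :
    WP (bnd n) F diffC s fun s' => ((s'.arr 8 0 : ℕ) : ZMod (s.var 11)) =
      (((fwdDiff (1 : ℤ))^[s.var 7] g 0 : ℤ) : ZMod (s.var 11)) := by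
  set m := s.var 11 with hm11
  set N := s.var 7 with hN7
  refine WP.for_ (fun r s' => ∀ y, y + r ≤ N →
    ((s'.arr 8 y : ℕ) : ZMod m) = (((fwdDiff (1 : ℤ))^[r] g y : ℤ) : ZMod m))
    (by decide) (by decide) (by decide) hb (by simpa using hg) ?_ ?_
  · intro r hr s1 hs1 hb1 hx hI
    have a7 : s1.var 7 = N := hs1.1 7 (by decide)
    have a11 : s1.var 11 = m := hs1.1 11 (by decide)
    rw [WP_seq, WP_set]
    have hv : Expr.val s1 (v 7 - v 42) = N - r := by simp [a7, hx]
    rw [hv]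
    refine ⟨⟨trivial, trivial⟩, TD.lt_bnd (by omega), ?_⟩
    set s2 := s1.set 43 (N - r) with hs2
    have hb2 : s2.Bdd (bnd n) := hb1.set (TD.lt_bnd (by omega))
    refine WP.for_ (fun j s' => (∀ y < j,
      ((s'.arr 8 y : ℕ) : ZMod m) = (((fwdDiff (1 : ℤ))^[r + 1] g y : ℤ) : ZMod m)) ∧
      ∀ y, j ≤ y → y + r ≤ N →
        ((s'.arr 8 y : ℕ) : ZMod m) = (((fwdDiff (1 : ℤ))^[r] g y : ℤ) : ZMod m))
      (by decide) (by decide) (by decide) hb2 ?_ ?_ ?_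
    · exact ⟨fun y hy => absurd hy (by omega), fun y _ hy => by simpa [hs2] using hI y hy⟩
    · rintro j hj s3 hs3 hb3 hx3 ⟨hI1, hI2⟩
      have hj' : j < N - r := by simpa [hs2] using hj
      have b11 : s3.var 11 = m := by rw [hs3.1 11 (by decide)]; simp [hs2, a11]
      have hmb : m < bnd n := b11 ▸ hb3.1 _
      have hlt1 : j < bnd n := TD.lt_bnd (by omega)
      have hlt2 : j + 1 < bnd n := TD.lt_bnd (by omega)
      simp only [WP_put, Expr.val_add, Expr.val_sub, Expr.val_mod, Expr.val_get, Expr.val_var,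
        Expr.val_ofNat, Expr.ok_var, Expr.ok_mod, Expr.ok_sub, Expr.ok_add, Expr.ok_get,
        Expr.ok_ofNat, hx3, b11, hlt1, hlt2, true_and]
      refine ⟨(Nat.mod_lt _ hm).trans hmb, fun y hy => ?_, fun y hy hyN => ?_⟩
      · simp only [St.set_arr, St.put_arr, if_true, Function.update_apply]
        split_ifs with h
        · subst h
          have hml := Nat.mod_lt (s3.arr 8 y) hm
          rw [ZMod.natCast_mod, Nat.cast_sub (by omega), Nat.cast_add, ZMod.natCast_self,
            ZMod.natCast_mod, hI2 y le_rfl (by omega), hI2 (y + 1) (by omega) (by omega),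
            fwdDiff_iterate_succ]
          push_cast
          ring
        · exact hI1 y (by omega)
      · simp only [St.set_arr, St.put_arr, if_true, Function.update_apply]
        rw [if_neg (by omega)]
        exact hI2 y (by omega) hyN
    · rintro s3 hs3 hb3 ⟨hI1, -⟩ y hy
      exact hI1 y (by simp [hs2]; omega)
  · intro s' hs' hb' hI
    exact_mod_cast hI 0 (by omega)

theorem count_spec (hd : 0 < I.dd) (hT : RTree I.nv (I.dd + 1) I.par lvl) (he : Env n I δ s)
    (hb : s.Bdd (bnd n)) (h12 : s.var 12 = I.nv + 1) (h13 : s.var 13 = 16 * (n + 1) ^ 2)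
    (hF : iters n I.dd ≤ F) :
    WP (bnd n) F countC s fun s' => s'.var 39 ≠ 0 ↔
      ∃ m < 16 * (n + 1) ^ 2, ((I.leading : ℤ) : ZMod (m + 1)) ≠ 0 := by
  have hnv := he.nv_le
  rw [countC, WP_seq, WP_set]
  refine ⟨trivial, TD.lt_bnd (by simp), ?_⟩
  set s1 := s.set 39 (Expr.val s 0) with hs1
  have hb1 : s1.Bdd (bnd n) := hb.set (TD.lt_bnd (by simp))
  have he1 : Env n I δ s1 := he.congr (by simp [hs1]) (by simp [hs1])
  have a13 : s1.var 13 = 16 * (n + 1) ^ 2 := by simp [hs1, h13]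
  refine WP.for_ (fun i s' => s'.var 39 ≠ 0 ↔ ∃ m < i, ((I.leading : ℤ) : ZMod (m + 1)) ≠ 0)
    (by decide) (by decide) (by decide) hb1 (by simp [hs1]) ?_ ?_
  · intro i hi s2 hs2 hb2 hx hI
    rw [a13] at hi
    have he2 := he1.same_any hs2 (by decide) (by decide)
    have a12 : s2.var 12 = I.nv + 1 := by simp [hs2.1 12 (by decide), hs1, h12]
    have hib : i + 1 < bnd n := by unfold bnd; nlinarith
    have hv : Expr.val s2 (v 14 + 1) = i + 1 := by simp [hx]
    rw [WP_seq, WP_set, hv]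
    refine ⟨⟨trivial, trivial⟩, hib, ?_⟩
    set s3 := s2.set 11 (i + 1) with hs3
    have hb3 : s3.Bdd (bnd n) := hb2.set hib
    have he3 : Env n I _ s3 := he2.congr (by simp [hs3]) (by simp [hs3])
    have hX : WP (bnd n) F (.for_ 10 12 (.seq evalC (.put 8 (v 10) (.get 6 0)))) s3 fun s' =>
        ∀ y ≤ I.nv, ((s'.arr 8 y : ℕ) : ZMod (i + 1)) = ((I.genFun y : ℤ) : ZMod (i + 1)) := by
      refine WP.for_ (fun j s' => ∀ y < j,
        ((s'.arr 8 y : ℕ) : ZMod (i + 1)) = ((I.genFun y : ℤ) : ZMod (i + 1)))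
        (by decide) (by decide) (by decide) hb3 (by simp) ?_ ?_
      · intro j hj s4 hs4 hb4 hx4 hI4
        have he4 := he3.same_any hs4 (by decide) (by decide)
        have b11 : s4.var 11 = i + 1 := by rw [hs4.1 11 (by decide)]; simp [hs3]
        have hj' : j ≤ I.nv := by
          have : s3.var 12 = I.nv + 1 := by simp [hs3, a12]
          omega
        rw [WP_seq]
        refine (eval_spec hd hT he4 hb4 (by omega) hF).mono hb4 fun s5 hs5 hb5 h5 => ?_
        rw [b11, hx4] at h5
        have c10 : s5.var 10 = j := by rw [hs5.1 10 (by decide), hx4]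
        have c8 : s5.arr 8 = s4.arr 8 := hs5.2 8 (by decide)
        rw [WP_put]
        refine ⟨trivial, ⟨trivial, TD.lt_bnd (by simp)⟩, hb5.1 _, hb5.2 _ _, fun y hy => ?_⟩
        simp only [St.set_arr, St.put_arr, if_true, Function.update_apply, Expr.val_var, c10,
          Expr.val_get, Expr.val_ofNat, c8]
        split_ifs with h
        · rw [h, h5]
        · exact hI4 y (by omega)
      · intro s' hs' hb' hI' y hy
        exact hI' y (by simp [hs3, a12]; omega)
    rw [WP_seq]
    refine hX.mono hb3 fun s4 hs4 hb4 h4 => ?_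
    have b7 : s4.var 7 = I.nv := by rw [hs4.1 7 (by decide), he3.v7]
    have b11 : s4.var 11 = i + 1 := by rw [hs4.1 11 (by decide)]; simp [hs3]
    rw [WP_seq]
    refine (diff_spec I.genFun hb4 (by omega) (by omega) (by rw [b7, b11]; exact h4)).mono hb4
      fun s5 hs5 hb5 h5 => ?_
    rw [b11, b7] at h5
    have c11 : s5.var 11 = i + 1 := by rw [hs5.1 11 (by decide), b11]
    have c39 : s5.var 39 = s2.var 39 := by
      rw [hs5.1 39 (by decide), hs4.1 39 (by decide)]; simp [hs3]
    have hz : s5.arr 8 0 % (i + 1) = 0 ↔ ((I.leading : ℤ) : ZMod (i + 1)) = 0 := by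
      rw [Inst.leading, ← h5, ← Nat.dvd_iff_mod_eq_zero, ← ZMod.natCast_eq_zero_iff]
    have hstep : (∃ m < i + 1, ((I.leading : ℤ) : ZMod (m + 1)) ≠ 0) ↔
        (∃ m < i, ((I.leading : ℤ) : ZMod (m + 1)) ≠ 0) ∨ ((I.leading : ℤ) : ZMod (i + 1)) ≠ 0 := by
      constructor
      · rintro ⟨m, h1, h2⟩
        rcases Nat.lt_succ_iff_lt_or_eq.1 h1 with h | rfl
        · exact Or.inl ⟨m, h, h2⟩
        · exact Or.inr h2
      · rintro (⟨m, h1, h2⟩ | h)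
        · exact ⟨m, by omega, h2⟩
        · exact ⟨i, by omega, h⟩
    simp only [WP_ite, WP_set, WP_skip, Expr.val_mod, Expr.val_get, Expr.val_var, Expr.val_ofNat,
      c11, ne_eq, hz, Expr.ok_mod, Expr.ok_get, Expr.ok_ofNat, Expr.ok_var, true_and]
    simp only [ne_eq] at hstep hI
    rw [hstep]
    refine ⟨⟨TD.lt_bnd (by omega), trivial⟩, fun h => ⟨TD.lt_bnd (by omega), ?_⟩, fun h => ?_⟩
    · simp [h]
    · simp only [h, not_true, or_false, St.set_var, if_neg (show (39 : ℕ) ≠ 14 by decide), c39]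
      exact hI
  · intro s' hs' hb' hI
    rwa [a13] at hI

end

end TD

namespace TD

/-! ### Self-reduction: fixing the height indices one by one -/

/-- Finds labels that extend to a solution; sets the flag `5` if there is none. -/
def greedyC : Cmd := .seq (.for_ 45 12 (.put 3 (v 45) 0)) <| .for_ 46 7 <| .seq (.set 47 0) <|
  .seq (.for_ 48 2 (.ite (v 47) .skip (.seq (.put 3 (v 46 + 1) (v 48 + 1)) <| .seq countC <|
    .ite (v 39) (.set 47 1) .skip))) <| .ite (v 47) .skip (.set 5 1)

/-- The state holds everything but the labels and the digits. -/
def Ready (n nv dd : ℕ) (par : ℕ → ℕ) (A : ℕ → ℕ → Prop) (s : St) : Prop :=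
  Env n ⟨nv, dd, par, s.arr 3, A⟩ (fun u q => s.arr 4 (q * (n + 1) + u)) s

theorem Ready.congr {n nv dd : ℕ} {par : ℕ → ℕ} {A : ℕ → ℕ → Prop} {s s' : St}
    (h : Ready n nv dd par A s) (hv : ∀ x ∈ [0, 2, 7, 8, 9, 20], s'.var x = s.var x)
    (ha : ∀ a ∈ [0, 2], s'.arr a = s.arr a) : Ready n nv dd par A s' := by
  simp only [List.mem_cons, List.not_mem_nil, or_false, forall_eq_or_imp, forall_eq] at hv ha
  obtain ⟨h1, h2, h3, h4, h5, h6⟩ := hv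
  obtain ⟨a1, a2⟩ := ha
  exact ⟨h1.trans h.v0, h2.trans h.v2, h3.trans h.v7, h4.trans h.v8, h5.trans h.v9,
    h6.trans h.v20, h.dd_le, h.nv_le, by rw [a2]; exact h.par, h.par_le, fun _ _ => rfl,
    by rw [a1]; exact h.adj, fun _ _ _ _ => rfl⟩

theorem Ready.same {n nv dd : ℕ} {par : ℕ → ℕ} {A : ℕ → ℕ → Prop} {c : Cmd} {s s' : St}
    (h : Ready n nv dd par A s) (hs : Same c s s') (hv : ∀ x ∈ [0, 2, 7, 8, 9, 20], x ∉ c.mods)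
    (ha : ∀ a ∈ [0, 2], a ∉ c.marrs) : Ready n nv dd par A s' :=
  h.congr (fun x hx => hs.1 x (hv x hx)) fun a hx => hs.2 a (ha a hx)

/-- The labels extend to an elimination order. -/
def Extends (nv dd : ℕ) (A : ℕ → ℕ → Prop) (L : ℕ → ℕ) : Prop :=
  ∃ ell anc, ElimOrder nv dd A ell anc ∧ Respects nv L ell

section

variable {n F nv dd : ℕ} {par lvl : ℕ → ℕ} {A : ℕ → ℕ → Prop} {s : St}

theorem count_ready (hd : 0 < dd) (hT : RTree nv (dd + 1) par lvl)
    (hE : (Inst.mk nv dd par (fun _ => 0) A).Elim) (hs : ∀ u v, A u v → A v u)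
    (hr : Ready n nv dd par A s) (hb : s.Bdd (bnd n)) (h12 : s.var 12 = nv + 1)
    (h13 : s.var 13 = 16 * (n + 1) ^ 2) (hF : iters n dd ≤ F) :
    WP (bnd n) F countC s fun s' => s'.var 39 ≠ 0 ↔ Extends nv dd A (s.arr 3) := by
  refine (count_spec (I := ⟨nv, dd, par, s.arr 3, A⟩) hd hT hr hb h12 h13 hF).mono hb
    fun s' _ _ h => h.trans ?_
  exact Inst.exists_elimOrder_iff (I := ⟨nv, dd, par, s.arr 3, A⟩) hT hd hE hs hr.nv_le hr.dd_le

/-- The labels chosen so far always extend to an elimination order if one exists at all. Failure at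
a vertex therefore refutes existence, and complete labels are the height indices of an actual order.
-/
theorem greedy_spec (hT : RTree nv (dd + 1) par lvl)
    (hE : (Inst.mk nv dd par (fun _ => 0) A).Elim) (hs : ∀ u v, A u v → A v u)
    (hr : Ready n nv dd par A s) (hb : s.Bdd (bnd n)) (h12 : s.var 12 = nv + 1)
    (h13 : s.var 13 = 16 * (n + 1) ^ 2) (hF : iters n dd ≤ F) (h5 : s.var 5 = 0) (hnv : 0 < nv) :
    WP (bnd n) F greedyC s fun s' =>
      (s'.var 5 = 0 → ∃ ell anc, ElimOrder nv dd A ell anc ∧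
        ∀ u ∈ Finset.Icc 1 nv, s'.arr 3 u = ell u + 1) ∧
      (s'.var 5 ≠ 0 → ¬ ∃ ell anc, ElimOrder nv dd A ell anc) := by
  have hnvn : nv ≤ n := hr.nv_le
  have hddn : dd ≤ n := hr.dd_le
  have hzero : WP (bnd n) F (.for_ 45 12 (.put 3 (v 45) 0)) s fun s' =>
      ∀ u ≤ nv, s'.arr 3 u = 0 := by
    refine WP.for_ (fun i s' => ∀ u < i, s'.arr 3 u = 0) (by decide) (by decide) (by decide) hb
      (by simp) ?_ ?_
    · intro i hi s' hs' hb' hx hI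
      rw [WP_put, Expr.val_var, hx]
      refine ⟨trivial, trivial, hx ▸ hb'.1 _, TD.lt_bnd (by simp), fun u hu => ?_⟩
      simp only [St.set_arr, St.put_arr, if_true, Function.update_apply]
      split_ifs with h
      · rfl
      · exact hI u (by omega)
    · intro s' hs' hb' hI u hu
      exact hI u (by omega)
  rw [greedyC, WP_seq]
  refine hzero.mono hb fun s1 hs1 hb1 h1 => ?_
  have hr1 := hr.same hs1 (by decide) (by decide)
  have a12 : s1.var 12 = nv + 1 := by rw [hs1.1 12 (by decide), h12]
  have a13 : s1.var 13 = 16 * (n + 1) ^ 2 := by rw [hs1.1 13 (by decide), h13]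
  have a5 : s1.var 5 = 0 := by rw [hs1.1 5 (by decide), h5]
  have a7 : s1.var 7 = nv := hr1.v7
  refine WP.for_ (fun x s' => (∀ u, x < u → u ≤ nv → s'.arr 3 u = 0) ∧
      (s'.var 5 = 0 → (∃ ell anc, ElimOrder nv dd A ell anc) → Extends nv dd A (s'.arr 3)) ∧
      (s'.var 5 = 0 → ∀ u ∈ Finset.Icc 1 x, s'.arr 3 u ≠ 0) ∧
      (s'.var 5 = 0 → 0 < x → ∃ ell anc, ElimOrder nv dd A ell anc) ∧
      (s'.var 5 ≠ 0 → ¬ ∃ ell anc, ElimOrder nv dd A ell anc))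
    (by decide) (by decide) (by decide) hb1 ?_ ?_ ?_
  · refine ⟨fun u _ hu => h1 u hu, fun _ ⟨ell, anc, h⟩ => ⟨ell, anc, h, fun u hu => Or.inl ?_⟩,
      by simp, by simp, by simp [a5]⟩
    exact h1 u (Finset.mem_Icc.1 hu).2
  · rintro x hx s2 hs2 hb2 hx2 ⟨hI1, hI2, hI3, hI4, hI5⟩
    rw [a7] at hx
    have hxI : x + 1 ∈ Finset.Icc 1 nv := Finset.mem_Icc.2 ⟨by omega, by omega⟩
    have hr2 := hr1.same hs2 (by decide) (by decide)
    have b12 : s2.var 12 = nv + 1 := by rw [hs2.1 12 (by decide), a12]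
    have b13 : s2.var 13 = 16 * (n + 1) ^ 2 := by rw [hs2.1 13 (by decide), a13]
    rw [WP_seq, WP_set]
    refine ⟨trivial, TD.lt_bnd (by simp), ?_⟩
    set s3 := s2.set 47 (Expr.val s2 0) with hs3
    have hb3 : s3.Bdd (bnd n) := hb2.set (TD.lt_bnd (by simp))
    have hr3 : Ready n nv dd par A s3 := hr2.congr (by simp [hs3]) (by simp [hs3])
    have c5 : s3.var 5 = s2.var 5 := by simp [hs3]
    set L := s2.arr 3 with hL
    have hfind : WP (bnd n) F (.for_ 48 2 (.ite (v 47) .skip (.seq (.put 3 (v 46 + 1) (v 48 + 1)) <|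
        .seq countC <| .ite (v 39) (.set 47 1) .skip))) s3 fun s' =>
        (∀ u, u ≠ x + 1 → s'.arr 3 u = L u) ∧
        (s'.var 47 ≠ 0 → s'.arr 3 (x + 1) ≠ 0 ∧ Extends nv dd A (s'.arr 3)) ∧
        (s'.var 47 = 0 → ∀ j < dd, ¬ Extends nv dd A (Function.update L (x + 1) (j + 1))) := by
      refine WP.for_ (fun i s' => (∀ u, u ≠ x + 1 → s'.arr 3 u = L u) ∧
        (s'.var 47 ≠ 0 → s'.arr 3 (x + 1) ≠ 0 ∧ Extends nv dd A (s'.arr 3)) ∧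
        (s'.var 47 = 0 → ∀ j < i, ¬ Extends nv dd A (Function.update L (x + 1) (j + 1))))
        (by decide) (by decide) (by decide) hb3 ⟨fun u _ => by simp [hs3, hL], by simp [hs3],
          by simp⟩ ?_ ?_
      · rintro i hi s4 hs4 hb4 hx4 ⟨hJ1, hJ2, hJ3⟩
        have hi' : i < dd := lt_of_lt_of_eq hi hr3.v2
        have hr4 := hr3.same hs4 (by decide) (by decide)
        have d46 : s4.var 46 = x := by rw [hs4.1 46 (by decide)]; simp [hs3, hx2]
        rw [WP_ite, Expr.val_var, WP_skip]
        refine ⟨trivial, fun h => ⟨hJ1, by simpa using hJ2, by simp [h]⟩, fun h => ?_⟩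
        have e1 : Expr.val s4 (v 46 + 1) = x + 1 := by simp [d46]
        have e2 : Expr.val s4 (v 48 + 1) = i + 1 := by simp [hx4]
        rw [WP_seq, WP_put, e1, e2]
        refine ⟨⟨trivial, trivial⟩, ⟨trivial, trivial⟩, TD.lt_bnd (by omega),
          TD.lt_bnd (by omega), ?_⟩
        set s5 := s4.put 3 (x + 1) (i + 1) with hs5
        have hb5 : s5.Bdd (bnd n) := hb4.put (TD.lt_bnd (by omega))
        have hr5 : Ready n nv dd par A s5 := hr4.congr (by simp [hs5]) (by simp [hs5])
        have hL5 : s5.arr 3 = Function.update L (x + 1) (i + 1) := by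
          funext u
          by_cases hu : u = x + 1
          · subst hu; simp [hs5]
          · simp [hs5, hu, hJ1 u hu]
        rw [WP_seq]
        refine (count_ready (by omega) hT hE hs hr5 hb5
          (by simp [hs5, hs4.1 12 (by decide), hs3, b12])
          (by simp [hs5, hs4.1 13 (by decide), hs3, b13]) hF).mono hb5 fun s6 hs6 hb6 h39 => ?_
        have hL6 : s6.arr 3 = Function.update L (x + 1) (i + 1) := by
          rw [hs6.2 3 (by decide), hL5]
        have f47 : s6.var 47 = 0 := by simp [hs6.1 47 (by decide), hs5, h]
        rw [hL5] at h39
        rw [WP_ite, Expr.val_var, h39, WP_set, WP_skip]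
        refine ⟨trivial, fun h => ⟨trivial, TD.lt_bnd (by simp), fun u hu => ?_, fun _ => ?_, ?_⟩,
          fun h => ⟨fun u hu => ?_, ?_, fun _ j hj => ?_⟩⟩
        · simp [hL6, hu]
        · simp [hL6, h]
        · simp
        · simp [hL6, hu]
        · simp [f47]
        · rcases Nat.lt_succ_iff_lt_or_eq.1 hj with hj | rfl
          · exact hJ3 ‹_› j hj
          · rw [← h39]; simpa using h
      · rintro s' hs' hb' ⟨hJ1, hJ2, hJ3⟩
        rw [hr3.v2] at hJ3
        exact ⟨hJ1, hJ2, hJ3⟩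
    rw [WP_seq]
    refine hfind.mono hb3 fun s4 hs4 hb4 h4 => ?_
    obtain ⟨hJ1, hJ2, hJ3⟩ := h4
    have d5 : s4.var 5 = s2.var 5 := by rw [hs4.1 5 (by decide), c5]
    have hlater : ∀ u, x + 1 < u → u ≤ nv → s4.arr 3 u = 0 := fun u hu hu' => by
      rw [hJ1 u (by omega)]; exact hI1 u (by omega) hu'
    rw [WP_ite, Expr.val_var, WP_skip, WP_set]
    refine ⟨trivial, fun h => ?_, fun h => ⟨trivial, TD.lt_bnd (by simp), ?_⟩⟩
    · obtain ⟨hne, hex⟩ := hJ2 h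
      have hex' : ∃ ell anc, ElimOrder nv dd A ell anc := by
        obtain ⟨ell, anc, h, -⟩ := hex; exact ⟨ell, anc, h⟩
      have h5 : s2.var 5 = 0 := by by_contra hc; exact hI5 hc hex'
      refine ⟨by simpa using hlater, fun _ _ => hex, fun _ u hu => ?_, fun _ _ => hex',
        by simp [d5, h5]⟩
      have hu' := Finset.mem_Icc.1 hu
      simp only [St.set_arr]
      by_cases hux : u = x + 1
      · rwa [hux]
      · rw [hJ1 u hux]
        exact hI3 h5 u (Finset.mem_Icc.2 ⟨hu'.1, by omega⟩)
    · have hno : ¬ ∃ ell anc, ElimOrder nv dd A ell anc := by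
        intro hex
        have h5 : s2.var 5 = 0 := by by_contra hc; exact hI5 hc hex
        obtain ⟨ell, anc, h1, h2⟩ := hI2 h5 hex
        -- In an order that extends the earlier labels, the height index of the next vertex is one
        -- of the values that were tried.
        refine hJ3 h (ell (x + 1)) (h1.lt _ hxI) ⟨ell, anc, h1, fun u hu => ?_⟩
        by_cases hux : u = x + 1
        · subst hux; simp
        · rw [Function.update_of_ne hux]; exact h2 u hu
      exact ⟨by simpa using hlater, by simp, by simp, by simp, fun _ => hno⟩
  · rintro s' hs' hb' ⟨-, hI2, hI3, hI4, hI5⟩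
    rw [a7] at hI3 hI4
    refine ⟨fun h => ?_, hI5⟩
    obtain ⟨ell, anc, h1, h2⟩ := hI2 h (hI4 h hnv)
    exact ⟨ell, anc, h1, fun u hu => (h2 u hu).resolve_left (hI3 h u hu)⟩

end

end TD

namespace TD

/-! ### From labels to an elimination forest -/

/-- `56 := ` the root of `55` -/
def rootC : Cmd := .seq (.set 56 (v 55)) <|
  .for_ 57 2 (.ite (.get 1 (v 56)) (.set 56 (.get 1 (v 56))) .skip)

/-- Makes `53` the parent of the root of `55`. -/
def linkC : Cmd := .seq rootC (.ite (.eq (v 56) (v 53)) .skip (.put 1 (v 56) (v 53)))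

/-- Links `53` to all its neighbours with larger labels. -/
def linksC : Cmd := .for_ 54 7 <| .seq (.set 55 (v 54 + 1)) <|
  .ite (adjE (v 53) (v 55)) (.ite (.lt (v 51) (.get 3 (v 55))) linkC .skip) .skip

/-- Builds an elimination forest in array `1` from the labels. -/
def rebuildC : Cmd := .seq (.for_ 49 12 (.put 1 (v 49) 0)) <| .for_ 50 2 <|
  .seq (.set 51 (v 2 - v 50)) <| .for_ 52 7 <| .seq (.set 53 (v 52 + 1)) <|
  .ite (.eq (.get 3 (v 53)) (v 51)) linksC .skip

/-- `H` is the parent function of an elimination forest of depth at most `dd`. -/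
structure HForest (nv dd : ℕ) (A : ℕ → ℕ → Prop) (H : ℕ → ℕ) : Prop where
  zero : H 0 = 0
  le : ∀ u ∈ Finset.Icc 1 nv, H u ≤ nv
  ell : ∃ ell : ℕ → ℕ, (∀ u ∈ Finset.Icc 1 nv, ell u < dd) ∧
    ∀ u ∈ Finset.Icc 1 nv, H u ≠ 0 → ell (H u) < ell u
  comp : ∀ u ∈ Finset.Icc 1 nv, ∀ x ∈ Finset.Icc 1 nv, A u x → ∃ k, H^[k] u = x ∨ H^[k] x = u

/-- The forest `H` is compatible with the order `anc`, its parents have labels at least `c`, and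
for the pairs in `P` it satisfies the condition of elimination forests. -/
structure Partial (nv : ℕ) (A : ℕ → ℕ → Prop) (ell : ℕ → ℕ) (anc : ℕ → ℕ → Prop) (c : ℕ)
    (P : ℕ → ℕ → Prop) (H : ℕ → ℕ) : Prop where
  zero : H 0 = 0
  anc : ∀ u ∈ Finset.Icc 1 nv, H u ≠ 0 →
    H u ∈ Finset.Icc 1 nv ∧ anc (H u) u ∧ ell (H u) < ell u ∧ c ≤ ell (H u) + 1
  comp : ∀ x ∈ Finset.Icc 1 nv, ∀ w ∈ Finset.Icc 1 nv, A x w → ell x < ell w → P x w →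
    ∃ k, H^[k] w = x

/-- Giving the root `y` a parent preserves paths to a vertex `z`: a path that left `y` would have
been stuck at 0. -/
theorem iterate_update {H : ℕ → ℕ} (h0 : H 0 = 0) {y z : ℕ} (hy : H y = 0) (x k : ℕ) :
    ∀ w, H^[k] w = z → z ≠ 0 → (Function.update H y x)^[k] w = z := by
  induction k with
  | zero => exact fun w h _ => h
  | succ k ih =>
    intro w h hz
    rw [Function.iterate_succ_apply] at h ⊢
    by_cases hw : w = y
    · rw [hw, hy, Function.iterate_fixed h0] at h
      exact absurd h.symm hz
    · rw [Function.update_of_ne hw]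
      exact ih _ h hz

section

variable {n F nv dd c : ℕ} {par ell H : ℕ → ℕ} {A anc P P' : ℕ → ℕ → Prop} {s : St}

theorem Partial.mono {c' : ℕ} (h : Partial nv A ell anc c P H) (hc : c' ≤ c)
    (hP : ∀ x ∈ Finset.Icc 1 nv, ∀ w ∈ Finset.Icc 1 nv, ell x < ell w → A x w → P' x w → P x w) :
    Partial nv A ell anc c' P' H :=
  ⟨h.zero, fun u hu hne => by
    obtain ⟨h1, h2, h3, h4⟩ := h.anc u hu hne
    exact ⟨h1, h2, h3, hc.trans h4⟩, fun x hx w hw ha hl hp =>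
    h.comp x hx w hw ha hl (hP x hx w hw hl ha hp)⟩

/-- Both `x` and the root `y` are above `w` in the order, and `x` is not deeper, so `x` is above
`y`. The new link thus respects the order, although the program never sees it. -/
theorem Partial.link (hO : ElimOrder nv dd A ell anc) (h : Partial nv A ell anc c P H) {x w y : ℕ}
    (hx : x ∈ Finset.Icc 1 nv) (hw : w ∈ Finset.Icc 1 nv) (ha : A x w) (hl : ell x < ell w)
    (hc : ell x + 1 = c) (hyI : y ∈ Finset.Icc 1 nv) (hy : ∃ k, H^[k] w = y) (hy0 : H y = 0)
    (hyw : anc y w) (hyc : c ≤ ell y + 1) (hyx : y ≠ x) :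
    Partial nv A ell anc c (fun a b => P a b ∨ a = x ∧ b = w) (Function.update H y x) := by
  have hx1 := Finset.mem_Icc.1 hx
  have hxw : anc x w := by
    rcases hO.comp x hx w hw ha with h | h
    · exact h
    · have := hO.le w hw x hx h; omega
  have hxy : anc x y := hO.down x hx y hyI w hw hxw hyw (by omega)
  have hlt : ell x < ell y := by
    rcases Nat.lt_or_eq_of_le (hO.le x hx y hyI hxy) with h | h
    · exact h
    · exact absurd (hO.eq x hx y hyI hxy h).symm hyx
  have hy1 := Finset.mem_Icc.1 hyI
  refine ⟨?_, fun u hu hne => ?_, fun a ha' b hb' hab hlab hp => ?_⟩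
  · rw [Function.update_of_ne (by omega), h.zero]
  · by_cases huy : u = y
    · subst huy; simp only [Function.update_self]
      exact ⟨hx, hxy, hlt, by omega⟩
    · rw [Function.update_of_ne huy] at hne ⊢
      exact h.anc u hu hne
  · rcases hp with hp | ⟨rfl, rfl⟩
    · obtain ⟨k, hk⟩ := h.comp a ha' b hb' hab hlab hp
      have := Finset.mem_Icc.1 ha'
      exact ⟨k, iterate_update h.zero hy0 x k b hk (by omega)⟩
    · obtain ⟨k, hk⟩ := hy
      refine ⟨k + 1, ?_⟩
      rw [Function.iterate_succ_apply', iterate_update h.zero hy0 a k b hk (by omega),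
        Function.update_self]

/-- Parents have strictly smaller height indices and all indices are below `dd`, so `dd` moves
always end at a root. -/
theorem root_spec (hO : ElimOrder nv dd A ell anc) (h : Partial nv A ell anc c P (s.arr 1))
    (hb : s.Bdd (bnd n)) (h2 : s.var 2 = dd) (hw : s.var 55 ∈ Finset.Icc 1 nv)
    (hc : c ≤ ell (s.var 55) + 1) :
    WP (bnd n) F rootC s fun s' => s'.var 56 ∈ Finset.Icc 1 nv ∧
      (∃ k, (s.arr 1)^[k] (s.var 55) = s'.var 56) ∧ s.arr 1 (s'.var 56) = 0 ∧
      anc (s'.var 56) (s.var 55) ∧ c ≤ ell (s'.var 56) + 1 := by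
  set w := s.var 55 with hw55
  set H := s.arr 1 with hH
  rw [rootC, WP_seq, WP_set]
  refine ⟨trivial, hb.1 _, ?_⟩
  set s1 := s.set 56 (Expr.val s (v 55)) with hs1
  have hb1 : s1.Bdd (bnd n) := hb.set (hb.1 _)
  refine WP.for_ (fun i s' => s'.var 56 ∈ Finset.Icc 1 nv ∧ (∃ k, H^[k] w = s'.var 56) ∧
      anc (s'.var 56) w ∧ c ≤ ell (s'.var 56) + 1 ∧
      (H (s'.var 56) = 0 ∨ ell (s'.var 56) + i ≤ ell w)) (by decide) (by decide) (by decide) hb1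
      ?_ ?_ ?_
  · have : (s1.set 57 0).var 56 = w := by simp [hs1, hw55]
    rw [this]
    exact ⟨hw, ⟨0, rfl⟩, hO.refl w hw, hc, Or.inr (by omega)⟩
  · rintro i hi s2 hs2 hb2 hx ⟨hI1, ⟨k, hk⟩, hI3, hI4, hI5⟩
    have hI1' := Finset.mem_Icc.1 hI1
    have hH2 : s2.arr 1 = H := hs2.2 1 (by decide)
    set y := s2.var 56 with hy
    have hv : Expr.val s2 (.get 1 (v 56)) = H y := by simp [hH2, hy]
    have hok : (Expr.get 1 (v 56)).ok (bnd n) s2 := ⟨trivial, hb2.1 _⟩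
    rw [WP_ite, hv, WP_set, WP_skip, hv]
    refine ⟨hok, fun hne => ⟨hok, by rw [← hv]; exact hb2.2 _ _, ?_⟩, fun h0 => ?_⟩
    · obtain ⟨h1, h2, h3, h4⟩ := h.anc y hI1 hne
      have e : (((s2.set 56 (H y)).set 57 (i + 1)).var 56) = H y := by simp
      rw [e]
      refine ⟨h1, ⟨k + 1, by rw [Function.iterate_succ_apply', hk]⟩,
        hO.trans _ h1 _ hI1 _ hw h2 hI3, h4, Or.inr ?_⟩
      have : ell y + i ≤ ell w := hI5.resolve_left hne
      omega
    · have e : ((s2.set 57 (i + 1)).var 56) = y := by simp [hy]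
      rw [e]
      exact ⟨hI1, ⟨k, hk⟩, hI3, hI4, Or.inl h0⟩
  · rintro s' hs' hb' ⟨hI1, hI2, hI3, hI4, hI5⟩
    refine ⟨hI1, hI2, hI5.resolve_right ?_, hI3, hI4⟩
    have := hO.lt w hw
    have : s1.var 2 = dd := by simp [hs1, h2]
    omega

theorem link_spec (hO : ElimOrder nv dd A ell anc) (h : Partial nv A ell anc c P (s.arr 1))
    (hb : s.Bdd (bnd n)) (h2 : s.var 2 = dd) (hw : s.var 55 ∈ Finset.Icc 1 nv)
    (hx : s.var 53 ∈ Finset.Icc 1 nv) (ha : A (s.var 53) (s.var 55))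
    (hl : ell (s.var 53) < ell (s.var 55)) (hc : ell (s.var 53) + 1 = c) :
    WP (bnd n) F linkC s fun s' => Partial nv A ell anc c
      (fun a b => P a b ∨ a = s.var 53 ∧ b = s.var 55) (s'.arr 1) := by
  rw [linkC, WP_seq]
  refine (root_spec hO h hb h2 hw (by omega)).mono hb fun s1 hs1 hb1 h1 => ?_
  obtain ⟨h1, h3, h4, h5, h6⟩ := h1
  have a53 : s1.var 53 = s.var 53 := hs1.1 53 (by decide)
  have A1 : s1.arr 1 = s.arr 1 := hs1.2 1 (by decide)
  simp only [WP_ite, Expr.val_eq, Expr.val_var, WP_skip, WP_put, a53, Expr.ok_eq, Expr.ok_var,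
    and_self, true_and]
  refine ⟨fun he => ?_, fun he => ⟨hb1.1 _, a53 ▸ hb1.1 _, ?_⟩⟩
  · have he : s1.var 56 = s.var 53 := by by_contra hc; simp [hc] at he
    rw [A1]
    refine ⟨h.zero, h.anc, fun a ha' b hb' hab hlab hp => ?_⟩
    rcases hp with hp | ⟨rfl, rfl⟩
    · exact h.comp a ha' b hb' hab hlab hp
    · rw [← he]; exact h3
  · have he : s1.var 56 ≠ s.var 53 := by intro hc; simp [hc] at he
    simp only [St.put_arr, if_true, A1]
    exact h.link hO hx hw ha hl hc h1 h3 h4 h5 h6 he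

theorem links_spec (hO : ElimOrder nv dd A ell anc) (h : Partial nv A ell anc c P (s.arr 1))
    (hr : Ready n nv dd par A s) (hb : s.Bdd (bnd n))
    (hlab : ∀ u ∈ Finset.Icc 1 nv, s.arr 3 u = ell u + 1)
    (hx : s.var 53 ∈ Finset.Icc 1 nv) (hc : ell (s.var 53) + 1 = c) (h51 : s.var 51 = c) :
    WP (bnd n) F linksC s fun s' => Partial nv A ell anc c
      (fun a b => P a b ∨ a = s.var 53) (s'.arr 1) := by
  have hnv : nv ≤ n := hr.nv_le
  set x := s.var 53 with hx53
  have hx1 := Finset.mem_Icc.1 hx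
  refine WP.for_ (fun t s' => Partial nv A ell anc c (fun a b => P a b ∨ a = x ∧ b ≤ t) (s'.arr 1))
    (by decide) (by decide) (by decide) hb ?_ ?_ ?_
  · refine h.mono le_rfl fun a _ b hb' _ _ hp => ?_
    have := Finset.mem_Icc.1 hb'
    rcases hp with hp | ⟨-, hp⟩
    · exact hp
    · omega
  · intro t ht s1 hs1 hb1 hx1' hI
    have ht' : t < nv := lt_of_lt_of_eq ht hr.v7
    have hr1 := hr.same hs1 (by decide) (by decide)
    have hv : Expr.val s1 (v 54 + 1) = t + 1 := by simp [hx1']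
    have hlt : t + 1 < bnd n := TD.lt_bnd (by omega)
    have hwI : t + 1 ∈ Finset.Icc 1 nv := Finset.mem_Icc.2 ⟨by omega, by omega⟩
    rw [WP_seq, WP_set, hv]
    refine ⟨⟨trivial, trivial⟩, hlt, ?_⟩
    set s2 := s1.set 55 (t + 1) with hs2
    have hb2 : s2.Bdd (bnd n) := hb1.set hlt
    have hr2 : Ready n nv dd par A s2 := hr1.congr (by simp [hs2]) (by simp [hs2])
    have a53 : s2.var 53 = x := by simp [hs2, hs1.1 53 (by decide), hx53]
    have a55 : s2.var 55 = t + 1 := by simp [hs2]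
    have a51 : s2.var 51 = c := by simp [hs2, hs1.1 51 (by decide), h51]
    have a3 : s2.arr 3 (t + 1) = ell (t + 1) + 1 := by
      simp [hs2, hs1.2 3 (by decide), hlab _ hwI]
    have hadj : Expr.val s2 (adjE (v 53) (v 55)) ≠ 0 ↔ A x (t + 1) := by
      refine Iff.trans ?_ (hr2.adj x hx _ hwI)
      simp [adjE, a53, a55, hr2.v0]
    have hok : (adjE (v 53) (v 55)).ok (bnd n) s2 := by
      refine ⟨⟨⟨⟨trivial, trivial⟩, trivial⟩, trivial⟩, ?_⟩
      simp only [Expr.val_add, Expr.val_mul, Expr.val_var, Expr.val_ofNat, a53, a55, hr2.v0]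
      exact adj_idx_lt (by omega) (by omega)
    have hI2 : Partial nv A ell anc c (fun a b => P a b ∨ a = x ∧ b ≤ t) (s2.arr 1) := hI
    have hlt51 : Expr.val s2 (.lt (v 51) (.get 3 (v 55))) ≠ 0 ↔ ell x < ell (t + 1) := by
      simp only [Expr.val_lt, Expr.val_var, Expr.val_get, a51, a55, a3, ← hc]
      split_ifs <;> simp <;> omega
    have hskip : ¬ (A x (t + 1) ∧ ell x < ell (t + 1)) →
        Partial nv A ell anc c (fun a b => P a b ∨ a = x ∧ b ≤ t + 1) (s2.arr 1) := by
      intro hno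
      refine hI2.mono le_rfl fun a _ b _ hl ha hp => ?_
      rcases hp with hp | ⟨rfl, hp⟩
      · exact Or.inl hp
      · rcases Nat.lt_or_eq_of_le hp with h | rfl
        · exact Or.inr ⟨rfl, by omega⟩
        · exact absurd ⟨ha, hl⟩ hno
    rw [WP_ite, hadj, WP_ite, hlt51, WP_skip]
    refine ⟨hok, fun ha => ⟨⟨trivial, trivial, by simpa [a55] using hlt⟩, fun hl => ?_,
      fun hl => ?_⟩, fun ha => ?_⟩
    · refine (link_spec hO hI2 hb2 hr2.v2 (by rwa [a55]) (by rwa [a53])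
        (by rwa [a53, a55]) (by rwa [a53, a55]) (by rwa [a53])).mono hb2 fun s3 _ _ h3 => ?_
      rw [a53, a55] at h3
      refine h3.mono le_rfl fun a _ b _ _ _ hp => ?_
      rcases hp with hp | ⟨rfl, hp⟩
      · exact Or.inl (Or.inl hp)
      · rcases Nat.lt_or_eq_of_le hp with h | rfl
        · exact Or.inl (Or.inr ⟨rfl, by omega⟩)
        · exact Or.inr ⟨rfl, rfl⟩
    · exact hskip fun hh => hlt51.2 hh.2 hl
    · exact hskip fun hh => hadj.2 hh.1 ha
  · intro s' hs' hb' hI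
    refine hI.mono le_rfl fun a _ b hb'' _ _ hp => ?_
    have := Finset.mem_Icc.1 hb''
    exact hp.imp id fun h => ⟨h, this.2.trans_eq hr.v7.symm⟩

/-- Indices are processed from `dd - 1` down to 0. At each stage the edges whose shallower endpoint
has been processed join comparable vertices. Only the labels are read; the order `anc` is needed
just to prove that every link is harmless. -/
theorem rebuild_spec (hO : ElimOrder nv dd A ell anc) (hs : ∀ u v, A u v → A v u)
    (hr : Ready n nv dd par A s) (hb : s.Bdd (bnd n)) (h12 : s.var 12 = nv + 1)
    (hlab : ∀ u ∈ Finset.Icc 1 nv, s.arr 3 u = ell u + 1) :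
    WP (bnd n) F rebuildC s fun s' => HForest nv dd A (s'.arr 1) := by
  have hnv : nv ≤ n := hr.nv_le
  have hdd : dd ≤ n := hr.dd_le
  have hzero : WP (bnd n) F (.for_ 49 12 (.put 1 (v 49) 0)) s fun s' =>
      ∀ u ≤ nv, s'.arr 1 u = 0 := by
    refine WP.for_ (fun i s' => ∀ u < i, s'.arr 1 u = 0) (by decide) (by decide) (by decide) hb
      (by simp) ?_ ?_
    · intro i hi s' hs' hb' hx hI
      rw [WP_put, Expr.val_var, hx]
      refine ⟨trivial, trivial, hx ▸ hb'.1 _, TD.lt_bnd (by simp), fun u hu => ?_⟩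
      simp only [St.set_arr, St.put_arr, if_true, Function.update_apply]
      split_ifs with h
      · rfl
      · exact hI u (by omega)
    · intro s' hs' hb' hI u hu
      exact hI u (by omega)
  rw [rebuildC, WP_seq]
  refine hzero.mono hb fun s1 hs1 hb1 h1 => ?_
  have hr1 := hr.same hs1 (by decide) (by decide)
  have A3 : s1.arr 3 = s.arr 3 := hs1.2 3 (by decide)
  refine WP.for_ (fun i s' => Partial nv A ell anc (dd - i) (fun a _ => dd - i ≤ ell a) (s'.arr 1))
    (by decide) (by decide) (by decide) hb1 ?_ ?_ ?_
  · refine ⟨h1 0 (Nat.zero_le _), fun u hu hne => ?_, fun x hx w hw _ _ hp => ?_⟩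
    · exact absurd (h1 u (Finset.mem_Icc.1 hu).2) hne
    · have := hO.lt x hx; omega
  · intro i hi s2 hs2 hb2 hx2 hI2
    have hi' : i < dd := lt_of_lt_of_eq hi hr1.v2
    have hr2 := hr1.same hs2 (by decide) (by decide)
    have hv : Expr.val s2 (v 2 - v 50) = dd - i := by simp [hr2.v2, hx2]
    have hlt : dd - i < bnd n := TD.lt_bnd (by omega)
    rw [WP_seq, WP_set, hv]
    refine ⟨⟨trivial, trivial⟩, hlt, ?_⟩
    set s3 := s2.set 51 (dd - i) with hs3
    have hb3 : s3.Bdd (bnd n) := hb2.set hlt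
    have hr3 : Ready n nv dd par A s3 := hr2.congr (by simp [hs3]) (by simp [hs3])
    refine WP.for_ (fun j s' => Partial nv A ell anc (dd - i)
      (fun a _ => dd - i ≤ ell a ∨ ell a + 1 = dd - i ∧ a ≤ j) (s'.arr 1))
      (by decide) (by decide) (by decide) hb3 ?_ ?_ ?_
    · refine Partial.mono (P := fun a _ => dd - i ≤ ell a) hI2 le_rfl fun a ha b _ _ _ hp => ?_
      have := Finset.mem_Icc.1 ha
      omega
    · intro j hj s4 hs4 hb4 hx4 hI4
      have hj' : j < nv := lt_of_lt_of_eq hj hr3.v7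
      have hr4 := hr3.same hs4 (by decide) (by decide)
      have hv4 : Expr.val s4 (v 52 + 1) = j + 1 := by simp [hx4]
      have hltj : j + 1 < bnd n := TD.lt_bnd (by omega)
      have hjI : j + 1 ∈ Finset.Icc 1 nv := Finset.mem_Icc.2 ⟨by omega, by omega⟩
      rw [WP_seq, WP_set, hv4]
      refine ⟨⟨trivial, trivial⟩, hltj, ?_⟩
      set s5 := s4.set 53 (j + 1) with hs5
      have hb5 : s5.Bdd (bnd n) := hb4.set hltj
      have hr5 : Ready n nv dd par A s5 := hr4.congr (by simp [hs5]) (by simp [hs5])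
      have a51 : s5.var 51 = dd - i := by simp [hs5, hs4.1 51 (by decide), hs3]
      have a53 : s5.var 53 = j + 1 := by simp [hs5]
      have hlab5 : ∀ u ∈ Finset.Icc 1 nv, s5.arr 3 u = ell u + 1 := fun u hu => by
        simp [hs5, hs4.2 3 (by decide), hs3, hs2.2 3 (by decide), A3, hlab u hu]
      have hve : Expr.val s5 (.eq (.get 3 (v 53)) (v 51)) ≠ 0 ↔ ell (j + 1) + 1 = dd - i := by
        simp [a51, a53, hlab5 _ hjI]
      rw [WP_ite, hve, WP_skip]
      refine ⟨⟨⟨trivial, by simpa [a53] using hltj⟩, trivial⟩, fun he => ?_, fun he => ?_⟩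
      · have hI5 : Partial nv A ell anc (dd - i)
          (fun a _ => dd - i ≤ ell a ∨ ell a + 1 = dd - i ∧ a ≤ j) (s5.arr 1) := hI4
        refine (links_spec hO hI5 hr5 hb5 hlab5 (by rwa [a53]) (by rwa [a53]) a51).mono hb5
          fun s6 _ _ h6 => ?_
        rw [a53] at h6
        refine h6.mono le_rfl fun a _ b _ _ _ hp => ?_
        omega
      · have he : ¬ ell (j + 1) + 1 = dd - i := fun h => hve.2 h he
        refine hI4.mono le_rfl fun a _ b _ _ _ hp => ?_
        rcases hp with hp | ⟨hp, hp'⟩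
        · exact Or.inl hp
        · rcases Nat.lt_or_eq_of_le hp' with h | rfl
          · exact Or.inr ⟨hp, by omega⟩
          · exact absurd hp he
    · intro s' hs' hb' hI
      refine hI.mono (by omega) fun a ha b _ _ _ hp => ?_
      have h1 := Finset.mem_Icc.1 ha
      have h2 : s3.var 7 = nv := hr3.v7
      omega
  · intro s' hs' hb' hI
    have h2 : s1.var 2 = dd := hr1.v2
    rw [h2] at hI
    refine ⟨hI.zero, fun u hu => ?_, ⟨ell, hO.lt, fun u hu hne =>
      (hI.anc u hu hne).2.2.1⟩, fun u hu x hx ha => ?_⟩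
    · by_cases hne : s'.arr 1 u = 0
      · omega
      · exact (Finset.mem_Icc.1 (hI.anc u hu hne).1).2
    · rcases Nat.lt_or_gt_of_ne (hO.ne u hu x hx ha) with h | h
      · obtain ⟨k, hk⟩ := hI.comp u hu x hx ha h (by omega)
        exact ⟨k, Or.inr hk⟩
      · obtain ⟨k, hk⟩ := hI.comp x hx u hu (hs _ _ ha) h (by omega)
        exact ⟨k, Or.inl hk⟩

end

end TD

namespace TD

/-! ### Iterative compression -/

/-- Puts the new vertex `7` on top of the forest in array `1`. -/
def treeC : Cmd := .seq (.put 2 0 0) <| .seq (.for_ 58 6 <| .ite (.get 1 (v 58 + 1))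
  (.put 2 (v 58 + 1) (.get 1 (v 58 + 1))) (.put 2 (v 58 + 1) (v 7))) (.put 2 (v 7) 0)

/-- Adds the vertex `6 + 1` to the forest in array `1`, or sets the flag `5`. -/
def addC : Cmd := .ite (v 5) .skip <| .seq (.set 7 (v 6 + 1)) <| .seq (.set 12 (v 6 + 2)) <|
  .seq treeC <| .seq greedyC <| .ite (v 5) .skip rebuildC

/-- Looks for an elimination forest of depth at most `2`. -/
def tryC : Cmd := .seq (.set 8 (2 * v 2)) <| .seq (.set 9 (v 2 + 1)) <| .seq (.set 5 0) <|
  .seq (.put 1 0 0) (.for_ 6 0 addC)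

/-- Looks for an elimination forest of depth at most `1`; sets the flag `4` if there is one. -/
def searchC : Cmd := .seq (.set 3 (v 1 + 1)) <| .seq (.set 20 (v 0 + 1)) <|
  .seq (.set 13 (16 * v 20 * v 20)) <| .seq (.set 4 0) <|
  .for_ 2 3 <| .ite (v 4) .skip (.seq tryC (.ite (v 5) .skip (.set 4 1)))

def mainC : Cmd := .seq searchC <| .seq (.put 0 0 (v 4)) <| .ite (v 4)
  (.for_ 59 0 (.put 0 (v 59 + 1) (.get 1 (v 59 + 1)))) .skip

/-- The tree with the new vertex `m + 1` on top of the forest `H`. -/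
def treePar (H : ℕ → ℕ) (m u : ℕ) : ℕ :=
  if u = 0 ∨ u = m + 1 then 0 else if H u = 0 then m + 1 else H u

theorem ElimOrder.restrict {nv nv' dd : ℕ} {A anc : ℕ → ℕ → Prop} {ell : ℕ → ℕ}
    (h : ElimOrder nv dd A ell anc) (hle : nv' ≤ nv) : ElimOrder nv' dd A ell anc := by
  have hs : ∀ u, u ∈ Finset.Icc 1 nv' → u ∈ Finset.Icc 1 nv :=
    fun u hu => Finset.Icc_subset_Icc_right hle hu
  exact ⟨fun u hu => h.lt u (hs u hu), fun u hu => h.refl u (hs u hu),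
    fun u hu x hx => h.comp u (hs u hu) x (hs x hx), fun u hu x hx => h.ne u (hs u hu) x (hs x hx),
    fun u hu x hx => h.le u (hs u hu) x (hs x hx), fun u hu x hx => h.eq u (hs u hu) x (hs x hx),
    fun u hu x hx w hw => h.trans u (hs u hu) x (hs x hx) w (hs w hw),
    fun u hu x hx w hw => h.down u (hs u hu) x (hs x hx) w (hs w hw)⟩

section

variable {m dd : ℕ} {A : ℕ → ℕ → Prop} {H : ℕ → ℕ}

theorem treePar_iterate (h : HForest m dd A H) {z : ℕ} (hz : z ≠ 0) (k : ℕ) :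
    ∀ w ∈ Finset.Icc 1 m, H^[k] w = z → (treePar H m)^[k] w = z := by
  induction k with
  | zero => exact fun w _ h => h
  | succ k ih =>
    intro w hw hk
    have hw' := Finset.mem_Icc.1 hw
    rw [Function.iterate_succ_apply] at hk ⊢
    by_cases h0 : H w = 0
    · rw [h0, Function.iterate_fixed h.zero] at hk
      exact absurd hk.symm hz
    · rw [show treePar H m w = H w by simp [treePar, h0]; omega]
      exact ih _ (Finset.mem_Icc.2 ⟨by omega, h.le w hw⟩) hk

theorem treePar_top (h : HForest m dd A H) (u : ℕ) (hu : u ∈ Finset.Icc 1 m) :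
    ∃ k, (treePar H m)^[k + 1] u = m + 1 := by
  obtain ⟨ell, hl, hlt⟩ := h.ell
  induction hn : ell u using Nat.strong_induction_on generalizing u with
  | _ n ih =>
    subst hn
    have hu' := Finset.mem_Icc.1 hu
    by_cases h0 : H u = 0
    · exact ⟨0, by simp [treePar, h0]; omega⟩
    · have hI : H u ∈ Finset.Icc 1 m := Finset.mem_Icc.2 ⟨by omega, h.le u hu⟩
      obtain ⟨k, hk⟩ := ih _ (hlt u hu h0) _ hI rfl
      refine ⟨k + 1, ?_⟩
      rw [Function.iterate_succ_apply, show treePar H m u = H u by simp [treePar, h0]; omega]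
      exact hk

/-- The virtual root gets level 0, the new vertex level 1, and an old vertex its index plus 2, which
is at most `dd + 1`. -/
theorem HForest.rtree (h : HForest m dd A H) :
    ∃ lvl, RTree (m + 1) (dd + 1) (treePar H m) lvl := by
  obtain ⟨ell, hl, hlt⟩ := h.ell
  refine ⟨fun u => if u = 0 then 0 else if u = m + 1 then 1 else ell u + 2, by simp [treePar],
    by simp, fun u hu => ?_, fun u hu => ?_, fun u hu => ?_⟩
  all_goals have hu' := Finset.mem_Icc.1 hu
  · simp only [treePar]
    split_ifs with h1 h2
    · omega
    · omega
    · have := h.le u (Finset.mem_Icc.2 ⟨by omega, by omega⟩)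
      omega
  · by_cases h1 : u = m + 1
    · simp [treePar, h1]
    · have huI : u ∈ Finset.Icc 1 m := Finset.mem_Icc.2 ⟨by omega, by omega⟩
      by_cases h2 : H u = 0
      · simp [treePar, h1, h2, show u ≠ 0 by omega]
      · have h3 := h.le u huI
        have h4 := hlt u huI h2
        simp [treePar, h1, h2, show u ≠ 0 by omega, show H u ≠ m + 1 by omega, h4]
  · split_ifs with h1 h2
    · omega
    · omega
    · have := hl u (Finset.mem_Icc.2 ⟨by omega, by omega⟩)
      omega

theorem HForest.elim (h : HForest m dd A H) (hirr : ∀ u, ¬ A u u) :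
    (Inst.mk (m + 1) dd (treePar H m) (fun _ => 0) A).Elim := by
  intro u hu x hx ha
  simp only at hu hx ha ⊢
  have hu' := Finset.mem_Icc.1 hu
  have hx' := Finset.mem_Icc.1 hx
  have hne : u ≠ x := by rintro rfl; exact hirr u ha
  by_cases h1 : u = m + 1
  · obtain ⟨k, hk⟩ := treePar_top h x (Finset.mem_Icc.2 ⟨by omega, by omega⟩)
    exact ⟨k, Or.inr (by rw [hk, h1])⟩
  by_cases h2 : x = m + 1
  · obtain ⟨k, hk⟩ := treePar_top h u (Finset.mem_Icc.2 ⟨by omega, by omega⟩)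
    exact ⟨k, Or.inl (by rw [hk, h2])⟩
  have huI : u ∈ Finset.Icc 1 m := Finset.mem_Icc.2 ⟨by omega, by omega⟩
  have hxI : x ∈ Finset.Icc 1 m := Finset.mem_Icc.2 ⟨by omega, by omega⟩
  obtain ⟨k, hk⟩ := h.comp u huI x hxI ha
  cases k with
  | zero => simp only [Function.iterate_zero, id] at hk; omega
  | succ k =>
    rcases hk with hk | hk
    · exact ⟨k, Or.inl (treePar_iterate h (by omega) _ u huI hk).symm⟩
    · exact ⟨k, Or.inr (treePar_iterate h (by omega) _ x hxI hk).symm⟩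

end

section

variable {n F dd m : ℕ} {A : ℕ → ℕ → Prop} {s : St}

theorem tree_spec (hb : s.Bdd (bnd n)) (hmn : m + 1 ≤ n) (h6 : s.var 6 = m) (h7 : s.var 7 = m + 1) :
    WP (bnd n) F treeC s fun s' => ∀ u ≤ m + 1, s'.arr 2 u = treePar (s.arr 1) m u := by
  set H := s.arr 1 with hH
  have hz : 0 < bnd n := TD.lt_bnd (by omega)
  rw [treeC, WP_seq, WP_put]
  refine ⟨trivial, trivial, hz, hz, ?_⟩
  set s1 := s.put 2 0 0 with hs1
  have hb1 : s1.Bdd (bnd n) := hb.put hz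
  rw [Expr.val_ofNat, ← hs1, WP_seq]
  refine WP.for_ (fun i s' => ∀ u ≤ i, s'.arr 2 u = treePar H m u)
    (by decide) (by decide) (by decide) hb1 ?_ ?_ ?_
  · intro u hu
    rw [Nat.le_zero.1 hu]
    simp [hs1, treePar]
  · intro i hi s2 hs2 hb2 hx hI
    have hi' : i < m := by simpa [hs1, h6] using hi
    have a7 : s2.var 7 = m + 1 := by simp [hs2.1 7 (by decide), hs1, h7]
    have A1 : s2.arr 1 = H := by simp [hs2.2 1 (by decide), hs1, hH]
    have hlt : i + 1 < bnd n := TD.lt_bnd (by omega)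
    have hlt7 : m + 1 < bnd n := TD.lt_bnd (by omega)
    have hHl : H (i + 1) < bnd n := hb.2 _ _
    simp only [WP_ite, WP_put, Expr.val_get, Expr.val_add, Expr.val_var, Expr.val_ofNat, hx, A1, a7,
      Expr.ok_get, Expr.ok_add, Expr.ok_var, Expr.ok_ofNat, hlt, hlt7, hHl, true_and, St.set_arr,
      St.put_arr, if_true, Function.update_apply]
    refine ⟨fun hne u hu => ?_, fun h0 u hu => ?_⟩
    · split_ifs with h
      · subst h; simp [treePar, hne]; omega
      · exact hI u (by omega)
    · split_ifs with h
      · subst h; simp [treePar, h0]; omega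
      · exact hI u (by omega)
  · intro s2 hs2 hb2 hI
    have a6 : s1.var 6 = m := by simp [hs1, h6]
    have a7 : s2.var 7 = m + 1 := by simp [hs2.1 7 (by decide), hs1, h7]
    rw [a6] at hI
    simp only [WP_put, Expr.val_var, Expr.val_ofNat, a7, Expr.ok_var, Expr.ok_ofNat, hz,
      TD.lt_bnd (n := n) (a := m + 1) (by omega), true_and, St.put_arr, if_true,
      Function.update_apply]
    intro u hu
    split_ifs with h
    · simp [treePar, h]
    · exact hI u (by omega)

/-- The input part of the state. -/
structure Graph (n : ℕ) (A : ℕ → ℕ → Prop) (s : St) : Prop where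
  v0 : s.var 0 = n
  adj : ∀ u ∈ Finset.Icc 1 n, ∀ x ∈ Finset.Icc 1 n, s.arr 0 (u * n + x + 1) ≠ 0 ↔ A u x
  symm : ∀ u x, A u x → A x u
  irr : ∀ u, ¬ A u u

theorem Graph.congr {s' : St} (h : Graph n A s) (hv : s'.var 0 = s.var 0)
    (ha : s'.arr 0 = s.arr 0) : Graph n A s' :=
  ⟨hv.trans h.v0, by rw [ha]; exact h.adj, h.symm, h.irr⟩

/-- An elimination order restricts to an initial set of vertices (`ElimOrder.restrict`), so a
failure on the first `m + 1` vertices already refutes the whole graph. -/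
theorem add_spec (hG : Graph n A s) (hb : s.Bdd (bnd n)) (hm : m < n) (hdd : dd ≤ n)
    (h2 : s.var 2 = dd) (h6 : s.var 6 = m) (h8 : s.var 8 = 2 * dd) (h9 : s.var 9 = dd + 1)
    (h13 : s.var 13 = 16 * (n + 1) ^ 2) (h20 : s.var 20 = n + 1) (hF : iters n dd ≤ F)
    (h1 : s.var 5 = 0 → HForest m dd A (s.arr 1))
    (hno : s.var 5 ≠ 0 → ¬ ∃ ell anc, ElimOrder n dd A ell anc) :
    WP (bnd n) F addC s fun s' => (s'.var 5 = 0 → HForest (m + 1) dd A (s'.arr 1)) ∧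
      (s'.var 5 ≠ 0 → ¬ ∃ ell anc, ElimOrder n dd A ell anc) := by
  rw [addC, WP_ite, WP_skip]
  refine ⟨trivial, fun h => ⟨fun h' => absurd h' h, fun _ => hno h⟩, fun h5 => ?_⟩
  have h5 : s.var 5 = 0 := h5
  have hH := h1 h5
  obtain ⟨lvl, hT⟩ := hH.rtree
  have hlt1 : m + 1 < bnd n := TD.lt_bnd (by omega)
  have hlt2 : m + 2 < bnd n := TD.lt_bnd (by omega)
  simp only [WP_seq, WP_set, Expr.ok_add, Expr.ok_var, Expr.ok_ofNat, Expr.val_add, Expr.val_var,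
    Expr.val_ofNat, h6, St.set_var, if_neg (show (6 : ℕ) ≠ 7 by decide), hlt1, hlt2, true_and]
  set s1 := (s.set 7 (m + 1)).set 12 (m + 2) with hs1
  have hb1 : s1.Bdd (bnd n) := (hb.set hlt1).set hlt2
  refine (tree_spec hb1 hm (by simp [hs1, h6]) (by simp [hs1])).mono hb1 fun s2 hs2 hb2 hp => ?_
  have hp : ∀ u ≤ m + 1, s2.arr 2 u = treePar (s.arr 1) m u := hp
  have hR : Ready n (m + 1) dd (treePar (s.arr 1) m) A s2 := by
    refine ⟨?_, ?_, ?_, ?_, ?_, ?_, hdd, hm, hp, fun u hu => ?_, fun _ _ => rfl, fun u hu x hx => ?_,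
      fun _ _ _ _ => rfl⟩
    · simp [hs2.1 0 (by decide), hs1, hG.v0]
    · simp [hs2.1 2 (by decide), hs1, h2]
    · simp [hs2.1 7 (by decide), hs1]
    · simp [hs2.1 8 (by decide), hs1, h8]
    · simp [hs2.1 9 (by decide), hs1, h9]
    · simp [hs2.1 20 (by decide), hs1, h20]
    · rcases Nat.eq_zero_or_pos u with rfl | h
      · exact hT.par_zero.le.trans (Nat.zero_le _)
      · exact hT.par_le u (Finset.mem_Icc.2 ⟨h, hu⟩)
    · rw [hs2.2 0 (by decide)]
      exact hG.adj u (Finset.Icc_subset_Icc_right hm hu) x (Finset.Icc_subset_Icc_right hm hx)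
  have b12 : s2.var 12 = m + 1 + 1 := by simp [hs2.1 12 (by decide), hs1]
  refine (greedy_spec hT (hH.elim hG.irr) hG.symm hR hb2 b12
    (by simp [hs2.1 13 (by decide), hs1, h13]) hF (by simp [hs2.1 5 (by decide), hs1, h5])
    (by omega)).mono hb2 fun s3 hs3 hb3 h3 => ?_
  have hR3 := hR.same hs3 (by decide) (by decide)
  have c12 : s3.var 12 = m + 1 + 1 := by rw [hs3.1 12 (by decide), b12]
  rw [WP_ite, WP_skip]
  refine ⟨trivial, fun h => ⟨fun h' => absurd h' h, fun _ ⟨ell, anc, hO⟩ =>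
    h3.2 h ⟨ell, anc, hO.restrict hm⟩⟩, fun h => ?_⟩
  obtain ⟨ell, anc, hO, hlab⟩ := h3.1 h
  refine (rebuild_spec hO hG.symm hR3 hb3 c12 hlab).mono hb3 fun s4 hs4 _ h4 => ?_
  refine ⟨fun _ => h4, fun h' => absurd ?_ h'⟩
  rw [hs4.1 5 (by decide)]; exact h

theorem try_spec (hG : Graph n A s) (hb : s.Bdd (bnd n)) (hdd : dd ≤ n)
    (h2 : s.var 2 = dd) (h13 : s.var 13 = 16 * (n + 1) ^ 2) (h20 : s.var 20 = n + 1)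
    (hF : iters n dd ≤ F) :
    WP (bnd n) F tryC s fun s' => (s'.var 5 = 0 → HForest n dd A (s'.arr 1)) ∧
      (s'.var 5 ≠ 0 → ¬ ∃ ell anc, ElimOrder n dd A ell anc) := by
  have hlt1 : 2 * dd < bnd n := TD.lt_bnd (by omega)
  have hlt2 : dd + 1 < bnd n := TD.lt_bnd (by omega)
  have hz : 0 < bnd n := TD.lt_bnd (by omega)
  rw [tryC]
  simp only [WP_seq, WP_set, WP_put, Expr.ok_add, Expr.ok_mul, Expr.ok_var, Expr.ok_ofNat,
    Expr.val_add, Expr.val_mul, Expr.val_var, Expr.val_ofNat, h2, St.set_var,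
    if_neg (show (2 : ℕ) ≠ 8 by decide), hlt1, hlt2, hz, true_and]
  set s1 := (((s.set 8 (2 * dd)).set 9 (dd + 1)).set 5 0).put 1 0 0 with hs1
  have hb1 : s1.Bdd (bnd n) := (((hb.set hlt1).set hlt2).set hz).put hz
  refine WP.for_ (fun i s' => (s'.var 5 = 0 → HForest i dd A (s'.arr 1)) ∧
    (s'.var 5 ≠ 0 → ¬ ∃ ell anc, ElimOrder n dd A ell anc))
    (by decide) (by decide) (by decide) hb1 ?_ ?_ ?_
  · refine ⟨fun _ => ⟨by simp [hs1], by simp, ⟨fun _ => 0, by simp, by simp⟩, by simp⟩, ?_⟩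
    simp [hs1]
  · rintro i hi s2 hs2 hb2 hx ⟨hI1, hI2⟩
    have hi' : i < n := by simpa [hs1, hG.v0] using hi
    have hG2 : Graph n A s2 := hG.congr (by simp [hs2.1 0 (by decide), hs1])
      (by simp [hs2.2 0 (by decide), hs1])
    refine (add_spec hG2 hb2 hi' hdd (by simp [hs2.1 2 (by decide), hs1, h2]) hx
      (by simp [hs2.1 8 (by decide), hs1]) (by simp [hs2.1 9 (by decide), hs1])
      (by simp [hs2.1 13 (by decide), hs1, h13]) (by simp [hs2.1 20 (by decide), hs1, h20]) hF
      hI1 hI2).mono hb2 fun s3 _ _ h3 => ?_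
    simpa using h3
  · intro s' hs' hb' hI
    have : s1.var 0 = n := by simp [hs1, hG.v0]
    rwa [this] at hI

/-- The iteration bound is demanded only for those `dd` below which every depth has failed. This is
what later allows it to depend on `k` as well as on `d`. -/
theorem search_spec {d : ℕ} (hG : Graph n A s) (hb : s.Bdd (bnd n)) (h1 : s.var 1 = d) (hd : d ≤ n)
    (hF : ∀ dd ≤ d, (∀ dd' < dd, ¬ ∃ ell anc, ElimOrder n dd' A ell anc) → iters n dd ≤ F) :
    WP (bnd n) F searchC s fun s' =>
      (s'.var 4 = 0 ∧ ¬ ∃ ell anc, ElimOrder n d A ell anc) ∨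
      (s'.var 4 = 1 ∧ ∃ dd ≤ d, HForest n dd A (s'.arr 1)) := by
  have hlt1 : d + 1 < bnd n := TD.lt_bnd (by omega)
  have hlt2 : n + 1 < bnd n := TD.lt_bnd (by omega)
  have hlt3 : 16 * (n + 1) * (n + 1) < bnd n := by unfold bnd; nlinarith
  have hz : 0 < bnd n := TD.lt_bnd (by omega)
  rw [searchC]
  simp only [WP_seq, WP_set, Expr.ok_add, Expr.ok_mul, Expr.ok_var, Expr.ok_ofNat,
    Expr.val_add, Expr.val_mul, Expr.val_var, Expr.val_ofNat, h1, hG.v0, St.set_var, if_true,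
    if_neg (show (0 : ℕ) ≠ 3 by decide), hlt1, hlt2, hlt3, hz, true_and]
  set s1 := (((s.set 3 (d + 1)).set 20 (n + 1)).set 13 (16 * (n + 1) * (n + 1))).set 4 0 with hs1
  have hb1 : s1.Bdd (bnd n) := (((hb.set hlt1).set hlt2).set hlt3).set hz
  refine WP.for_ (fun i s' =>
    (s'.var 4 = 0 ∧ ∀ dd < i, ¬ ∃ ell anc, ElimOrder n dd A ell anc) ∨
      (s'.var 4 = 1 ∧ ∃ dd ≤ d, HForest n dd A (s'.arr 1)))
    (by decide) (by decide) (by decide) hb1 (Or.inl ⟨by simp [hs1], by simp⟩) ?_ ?_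
  · rintro i hi s2 hs2 hb2 hx hI
    have hi' : i < d + 1 := by simpa [hs1] using hi
    have hG2 : Graph n A s2 := hG.congr (by simp [hs2.1 0 (by decide), hs1])
      (by simp [hs2.2 0 (by decide), hs1])
    rw [WP_ite, Expr.val_var, WP_skip, WP_seq]
    refine ⟨trivial, fun h => ?_, fun h => ?_⟩
    · rcases hI with ⟨h4, -⟩ | hI
      · exact absurd h4 h
      · exact Or.inr (by simpa using hI)
    · rcases hI with ⟨-, hI⟩ | ⟨h4, -⟩
      · refine (try_spec hG2 hb2 (by omega) hx (by simp [hs2.1 13 (by decide), hs1]; ring)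
          (by simp [hs2.1 20 (by decide), hs1]) (hF i (by omega) hI)).mono hb2
          fun s3 hs3 hb3 h3 => ?_
        have c4 : s3.var 4 = 0 := by rw [hs3.1 4 (by decide), h]
        rw [WP_ite, WP_skip, WP_set]
        refine ⟨trivial, fun h5 => Or.inl ⟨by simp [c4], fun dd hdd => ?_⟩, fun h5 =>
          ⟨trivial, TD.lt_bnd (by simp), Or.inr ⟨by simp, i, by omega, h3.1 h5⟩⟩⟩
        rcases Nat.lt_succ_iff_lt_or_eq.1 hdd with h | rfl
        · exact hI dd h
        · exact h3.2 h5
      · omega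
  · intro s' hs' hb' hI
    have h3 : s1.var 3 = d + 1 := by simp [hs1]
    rw [h3] at hI
    exact hI.imp (fun h => ⟨h.1, h.2 d (by omega)⟩) id

theorem main_spec {d : ℕ} (hG : Graph n A s) (hb : s.Bdd (bnd n)) (h1 : s.var 1 = d) (hd : d ≤ n)
    (hF : ∀ dd ≤ d, (∀ dd' < dd, ¬ ∃ ell anc, ElimOrder n dd' A ell anc) → iters n dd ≤ F) :
    WP (bnd n) F mainC s fun s' =>
      (s'.arr 0 0 = 0 ∧ ¬ ∃ ell anc, ElimOrder n d A ell anc) ∨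
      (s'.arr 0 0 = 1 ∧ ∃ dd ≤ d, ∃ H, HForest n dd A H ∧
        ∀ u ∈ Finset.Icc 1 n, s'.arr 0 u = H u) := by
  rw [mainC, WP_seq]
  refine (search_spec hG hb h1 hd hF).mono hb fun s1 hs1 hb1 h => ?_
  have a0 : s1.var 0 = n := by rw [hs1.1 0 (by decide), hG.v0]
  rw [WP_seq, WP_put]
  refine ⟨trivial, trivial, TD.lt_bnd (by simp), hb1.1 _, ?_⟩
  rw [Expr.val_ofNat, Expr.val_var]
  set s2 := s1.put 0 0 (s1.var 4) with hs2
  have hb2 : s2.Bdd (bnd n) := hb1.put (hb1.1 _)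
  rw [WP_ite, WP_skip]
  refine ⟨trivial, fun h4 => ?_, fun h4 => ?_⟩
  · rcases h with ⟨h0, -⟩ | ⟨h1, dd, hdd, hH⟩
    · exact absurd h0 h4
    · refine WP.for_ (fun i s' => s'.arr 0 0 = 1 ∧ ∀ u, 1 ≤ u → u ≤ i → s'.arr 0 u = s1.arr 1 u)
        (by decide) (by decide) (by decide) hb2 ⟨by simp [hs2, h1], fun u _ _ => by omega⟩ ?_ ?_
      · rintro i hi s3 hs3 hb3 hx ⟨hI1, hI2⟩
        have hi' : i < n := by simpa [hs2, a0] using hi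
        have hlt : i + 1 < bnd n := TD.lt_bnd (by omega)
        have A1 : s3.arr 1 = s1.arr 1 := by simp [hs3.2 1 (by decide), hs2]
        simp only [WP_put, Expr.val_add, Expr.val_get, Expr.val_var, Expr.val_ofNat, Expr.ok_add,
          Expr.ok_get, Expr.ok_var, Expr.ok_ofNat, hx, hlt, A1, true_and, St.set_arr, St.put_arr,
          if_true, Function.update_apply]
        refine ⟨hb1.2 _ _, by simpa using hI1, fun u hu hui => ?_⟩
        split_ifs with h
        · rw [h]
        · exact hI2 u hu (by omega)
      · rintro s3 hs3 hb3 ⟨hI1, hI2⟩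
        have : s2.var 0 = n := by simp [hs2, a0]
        rw [this] at hI2
        exact Or.inr ⟨hI1, dd, hdd, s1.arr 1, hH, fun u hu =>
          hI2 u (Finset.mem_Icc.1 hu).1 (Finset.mem_Icc.1 hu).2⟩
  · rcases h with ⟨h0, hno⟩ | ⟨h1, -⟩
    · exact Or.inl ⟨by simp [hs2, h0], hno⟩
    · have h4 : s1.var 4 = 0 := h4
      omega

end

end TD

namespace TD

/-! ### Rooted forests and elimination orders -/

section Forest

variable {n : ℕ} {G : SimpleGraph (Fin n)}

/-- The adjacency relation on the numbers `1, …, n`. -/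
def Adj (G : SimpleGraph (Fin n)) (u x : ℕ) : Prop :=
  ∃ a b : Fin n, u = a + 1 ∧ x = b + 1 ∧ G.Adj a b

theorem adj_succ {a b : Fin n} : Adj G (a + 1) (b + 1) ↔ G.Adj a b := by
  constructor
  · rintro ⟨a', b', h1, h2, h⟩
    rwa [Fin.ext (show (a : ℕ) = a' by omega), Fin.ext (show (b : ℕ) = b' by omega)]
  · exact fun h => ⟨a, b, rfl, rfl, h⟩

theorem exists_fin {u : ℕ} (hu : u ∈ Finset.Icc 1 n) : ∃ a : Fin n, u = a + 1 := by
  have := Finset.mem_Icc.1 hu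
  exact ⟨⟨u - 1, by omega⟩, by simp; omega⟩

theorem fin_mem (a : Fin n) : (a : ℕ) + 1 ∈ Finset.Icc 1 n :=
  Finset.mem_Icc.2 ⟨by omega, a.2⟩

theorem isAncestor_antisymm {V : Type*} {F : RootedForest V} {a b : V} (h : F.IsAncestor a b)
    (h' : F.IsAncestor b a) : a = b := by
  rcases Relation.reflTransGen_iff_eq_or_transGen.1 h with h | h
  · exact h.symm
  · exact absurd (h.trans_left h') (F.wf.transGen.irrefl.irrefl a)

theorem isAncestor_total {V : Type*} {F : RootedForest V} {a b c : V} (h : F.IsAncestor a c)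
    (h' : F.IsAncestor b c) : F.IsAncestor a b ∨ F.IsAncestor b a := by
  have hU : Relator.RightUnique (Function.swap fun u v : V => F.parent v = some u) := by
    intro x y z hy hz
    simp only [Function.swap] at hy hz
    exact Option.some.inj (hy.symm.trans hz)
  have h1 := Relation.reflTransGen_swap.2 h
  have h2 := Relation.reflTransGen_swap.2 h'
  exact (Relation.ReflTransGen.total_of_right_unique hU h1 h2).symm.imp
    Relation.reflTransGen_swap.1 Relation.reflTransGen_swap.1

theorem vertexDepth_pos (F : RootedForest (Fin n)) (a : Fin n) : 0 < F.vertexDepth a :=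
  (Set.ncard_pos (Set.toFinite _)).2 ⟨a, Relation.ReflTransGen.refl⟩

theorem vertexDepth_mono {F : RootedForest (Fin n)} {a b : Fin n} (h : F.IsAncestor a b) :
    F.vertexDepth a ≤ F.vertexDepth b :=
  Set.ncard_le_ncard (fun _ hx => Relation.ReflTransGen.trans hx h) (Set.toFinite _)

/-- Nested finite sets of ancestors with equal cardinality coincide, so `b` is also an ancestor of
`a`. -/
theorem eq_of_vertexDepth_eq {F : RootedForest (Fin n)} {a b : Fin n} (h : F.IsAncestor a b)
    (he : F.vertexDepth a = F.vertexDepth b) : a = b := by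
  have := Set.eq_of_subset_of_ncard_le
    (fun x (hx : x ∈ {u | F.IsAncestor u a}) => (Relation.ReflTransGen.trans hx h :
      x ∈ {u | F.IsAncestor u b})) he.ge (Set.toFinite _)
  have hb : b ∈ {u | F.IsAncestor u a} := by
    rw [this]; exact Relation.ReflTransGen.refl
  exact isAncestor_antisymm h hb

theorem vertexDepth_le_depth (F : RootedForest (Fin n)) (a : Fin n) : F.vertexDepth a ≤ F.depth :=
  Finset.le_sup (Finset.mem_univ a)

theorem depth_le_card (F : RootedForest (Fin n)) : F.depth ≤ n := by
  refine Finset.sup_le fun a _ => ?_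
  have := Set.ncard_le_card {u | F.IsAncestor u a}
  rw [Nat.card_fin] at this
  exact this

/-- The height index is the vertex depth minus 1. Vertices are shifted by one because 0 is the
virtual root. -/
theorem exists_elimOrder_of_forest {F : RootedForest (Fin n)} (hF : F.IsElimForest G) {dd : ℕ}
    (hd : F.depth ≤ dd) : ∃ ell anc, ElimOrder n dd (Adj G) ell anc := by
  refine ⟨fun u => if h : u - 1 < n then F.vertexDepth ⟨u - 1, h⟩ - 1 else 0,
    fun u x => ∃ a b : Fin n, u = a + 1 ∧ x = b + 1 ∧ F.IsAncestor a b, ?_⟩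
  have hl : ∀ a : Fin n, (if h : (a : ℕ) + 1 - 1 < n then F.vertexDepth ⟨a + 1 - 1, h⟩ - 1 else 0) =
      F.vertexDepth a - 1 := fun a => by simp
  have hanc : ∀ a b : Fin n, (∃ a' b' : Fin n, (a : ℕ) + 1 = a' + 1 ∧ (b : ℕ) + 1 = b' + 1 ∧
      F.IsAncestor a' b') ↔ F.IsAncestor a b := by
    intro a b
    constructor
    · rintro ⟨a', b', h1, h2, h⟩
      rwa [Fin.ext (show (a : ℕ) = a' by omega), Fin.ext (show (b : ℕ) = b' by omega)]
    · exact fun h => ⟨a, b, rfl, rfl, h⟩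
  constructor
  · intro u hu
    obtain ⟨a, rfl⟩ := exists_fin hu
    rw [hl]
    have := vertexDepth_pos F a
    have := vertexDepth_le_depth F a
    omega
  · intro u hu
    obtain ⟨a, rfl⟩ := exists_fin hu
    exact (hanc a a).2 Relation.ReflTransGen.refl
  · intro u hu x hx h
    obtain ⟨a, rfl⟩ := exists_fin hu
    obtain ⟨b, rfl⟩ := exists_fin hx
    rw [hanc, hanc]
    exact hF a b (adj_succ.1 h)
  · intro u hu x hx h
    obtain ⟨a, rfl⟩ := exists_fin hu
    obtain ⟨b, rfl⟩ := exists_fin hx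
    rw [hl, hl]
    have h := adj_succ.1 h
    have := vertexDepth_pos F a
    have := vertexDepth_pos F b
    intro he
    rcases hF a b h with h' | h'
    · exact h.ne (eq_of_vertexDepth_eq h' (by omega))
    · exact h.ne (eq_of_vertexDepth_eq h' (by omega)).symm
  · intro u hu x hx h
    obtain ⟨a, rfl⟩ := exists_fin hu
    obtain ⟨b, rfl⟩ := exists_fin hx
    rw [hanc] at h
    rw [hl, hl]
    exact Nat.sub_le_sub_right (vertexDepth_mono h) 1
  · intro u hu x hx h
    obtain ⟨a, rfl⟩ := exists_fin hu
    obtain ⟨b, rfl⟩ := exists_fin hx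
    rw [hanc] at h
    rw [hl, hl]
    have := vertexDepth_pos F a
    have := vertexDepth_pos F b
    intro he
    rw [eq_of_vertexDepth_eq h (by omega)]
  · intro u hu x hx y hy
    obtain ⟨a, rfl⟩ := exists_fin hu
    obtain ⟨b, rfl⟩ := exists_fin hx
    obtain ⟨c, rfl⟩ := exists_fin hy
    rw [hanc, hanc, hanc]
    exact Relation.ReflTransGen.trans
  · intro u hu x hx y hy
    obtain ⟨a, rfl⟩ := exists_fin hu
    obtain ⟨b, rfl⟩ := exists_fin hx
    obtain ⟨c, rfl⟩ := exists_fin hy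
    rw [hanc, hanc, hanc, hl, hl]
    intro h h' he
    rcases isAncestor_total h h' with h1 | h1
    · exact h1
    · have := vertexDepth_mono h1
      have := vertexDepth_pos F a
      have := vertexDepth_pos F b
      rw [eq_of_vertexDepth_eq h1 (by omega)]
      exact Relation.ReflTransGen.refl

theorem HForest.exists_forest {dd : ℕ} {H : ℕ → ℕ} (h : HForest n dd (Adj G) H) :
    ∃ F : RootedForest (Fin n), F.IsElimForest G ∧ F.depth ≤ dd ∧
      ∀ a : Fin n, F.parentCode a = H (a + 1) := by
  obtain ⟨ell, hl, hlt⟩ := h.ell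
  have hle : ∀ a : Fin n, H (a + 1) ≠ 0 → H (a + 1) - 1 < n := fun a ha => by
    have := h.le _ (fin_mem a); omega
  let par : Fin n → Option (Fin n) := fun a =>
    if ha : H (a + 1) = 0 then none else some ⟨H (a + 1) - 1, hle a ha⟩
  have hpar : ∀ a b, par a = some b ↔ H (a + 1) = b + 1 := by
    intro a b
    by_cases ha : H (a + 1) = 0
    · simp [par, ha]
    · simp only [par, ha, dif_neg, not_false_eq_true, Option.some.injEq, Fin.ext_iff]
      omega
  have hell : ∀ a b, par a = some b → ell (b + 1) < ell (a + 1) := fun a b hab => by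
    have h1 := (hpar a b).1 hab
    have := hlt _ (fin_mem a) (by omega)
    rwa [h1] at this
  let F : RootedForest (Fin n) := ⟨par, Subrelation.wf (r := InvImage (· < ·) fun a : Fin n =>
    ell (a + 1)) (fun hab => hell _ _ hab) (InvImage.wf _ wellFounded_lt)⟩
  have hanc : ∀ k, ∀ a b : Fin n, H^[k] (a + 1) = b + 1 → F.IsAncestor b a := by
    intro k
    induction k with
    | zero =>
      intro a b hab
      rw [Fin.ext (show (a : ℕ) = b by simpa using hab)]
      exact Relation.ReflTransGen.refl
    | succ k ih =>
      intro a b hab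
      rw [Function.iterate_succ_apply] at hab
      by_cases ha : H (a + 1) = 0
      · rw [ha, Function.iterate_fixed h.zero] at hab
        omega
      · have hc : H (a + 1) = (⟨H (a + 1) - 1, hle a ha⟩ : Fin n) + 1 := by
          simp only; omega
        rw [hc] at hab
        exact Relation.ReflTransGen.tail (ih _ _ hab) ((hpar _ _).2 hc)
  -- A child has at most one ancestor more than its parent, while `ell` grows strictly along the
  -- forest.
  have hdep : ∀ N, ∀ a : Fin n, ell (a + 1) < N → F.vertexDepth a ≤ ell (a + 1) + 1 := by
    intro N
    induction N with
    | zero => intro a ha; omega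
    | succ N ih =>
      intro a ha
      cases hp : par a with
      | none =>
        have : {u | F.IsAncestor u a} = {a} := by
          ext u
          simp only [Set.mem_ofPred_eq, Set.mem_singleton_iff]
          constructor
          · intro hu
            rcases Relation.ReflTransGen.cases_tail hu with hu | ⟨c, _, hc⟩
            · exact hu.symm
            · have hc : par a = some c := hc
              rw [hp] at hc; cases hc
          · rintro rfl; exact Relation.ReflTransGen.refl
        rw [RootedForest.vertexDepth, this, Set.ncard_singleton]
        omega
      | some b =>
        have hb := hell a b hp
        have : {u | F.IsAncestor u a} ⊆ insert a {u | F.IsAncestor u b} := by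
          intro u hu
          rcases Relation.ReflTransGen.cases_tail hu with hu | ⟨c, hc', hc⟩
          · exact Or.inl hu.symm
          · have hc : par a = some c := hc
            rw [hp] at hc; cases hc
            exact Or.inr hc'
        have h1 := Set.ncard_le_ncard this (Set.toFinite _)
        have h2 := Set.ncard_insert_le a {u | F.IsAncestor u b}
        have h3 := ih b (by omega)
        simp only [RootedForest.vertexDepth] at h3 ⊢
        omega
  refine ⟨F, fun a b hab => ?_, Finset.sup_le fun a _ => ?_, fun a => ?_⟩
  · obtain ⟨k, hk | hk⟩ := h.comp _ (fin_mem a) _ (fin_mem b) (adj_succ.2 hab)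
    · exact Or.inr (hanc k a b hk)
    · exact Or.inl (hanc k b a hk)
  · have := hdep _ a (Nat.lt_succ_self _)
    have := hl _ (fin_mem a)
    omega
  · rw [RootedForest.parentCode]
    change (match par a with | none => 0 | some u => u.val + 1) = _
    by_cases ha : H (a + 1) = 0
    · have : par a = none := by simp [par, ha]
      rw [this, ha]
    · have : par a = some ⟨H (a + 1) - 1, hle a ha⟩ := by simp [par, ha]
      rw [this]
      simp only
      omega

theorem exists_forest_depth_eq_treedepth {T : RootedForest (Fin n)} (hT : T.IsElimForest G) :
    ∃ F : RootedForest (Fin n), F.IsElimForest G ∧ F.depth = G.treedepth :=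
  Nat.sInf_mem (s := {h | ∃ F : RootedForest (Fin n), F.IsElimForest G ∧ F.depth = h})
    ⟨_, T, hT, rfl⟩

/-- No forest on `n` vertices is deeper than `n`, so cutting `d` down to `min d n` does not weaken
the negative answer. -/
theorem lt_treedepth {T : RootedForest (Fin n)} (hT : T.IsElimForest G) {d : ℕ}
    (h : ¬ ∃ ell anc, ElimOrder n (min d n) (Adj G) ell anc) : d < G.treedepth := by
  by_contra hd
  obtain ⟨F, hF, hFd⟩ := exists_forest_depth_eq_treedepth hT
  exact h (exists_elimOrder_of_forest hF (le_min (by omega) (depth_le_card F)))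

end Forest

/-! ### The input -/

section Input

variable {n : ℕ} (G : SimpleGraph (Fin n)) (T : RootedForest (Fin n)) (d : ℕ)

theorem encodeInput_zero : (encodeInput G T d).getD 0 0 = n := by simp [encodeInput]

theorem encodeInput_one : (encodeInput G T d).getD 1 0 = d := by simp [encodeInput]

open Classical in
theorem encodeInput_le (i : ℕ) (hi : i ≠ 1) : (encodeInput G T d).getD i 0 ≤ n + 1 := by
  match i, hi with
  | 0, _ => rw [encodeInput_zero]; omega
  | i + 2, _ =>
    simp only [encodeInput, List.cons_append, List.nil_append, List.getD_cons_succ]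
    generalize hl : (List.ofFn T.parentCode ++ List.ofFn fun e : Fin (n * n) =>
      if G.Adj e.divNat e.modNat then 1 else 0) = l
    rw [List.getD_eq_getElem?_getD]
    cases h : l[i]? with
    | none => simp
    | some x =>
      have hx := List.mem_of_getElem? h
      rw [← hl, List.mem_append, List.mem_ofFn, List.mem_ofFn] at hx
      rcases hx with ⟨a, rfl⟩ | ⟨a, rfl⟩
      · simp only [Option.getD_some, RootedForest.parentCode]
        split <;> omega
      · simp only [Option.getD_some]
        split_ifs <;> omega

theorem encodeInput_adj (a b : Fin n) :
    (encodeInput G T d).getD ((a + 1) * n + (b + 1) + 1) 0 ≠ 0 ↔ G.Adj a b := by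
  have hlt : (a : ℕ) * n + b < n * n := by
    have := Nat.mul_le_mul_right n (Nat.succ_le_of_lt a.2)
    have h := b.2
    rw [Nat.succ_mul] at this
    omega
  have h1 : ((a : ℕ) + 1) * n + (b + 1) + 1 = (n + (a * n + b)) + 2 := by ring
  rw [h1]
  simp only [encodeInput, List.cons_append, List.nil_append, List.getD_cons_succ]
  rw [List.getD_append_right _ _ _ _ (by simp), List.length_ofFn, Nat.add_sub_cancel_left,
    List.getD_eq_getElem _ _ (by simpa using hlt), List.getElem_ofFn]
  have h2 : (⟨a * n + b, hlt⟩ : Fin (n * n)).divNat = a := by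
    ext
    simp only [Fin.coe_divNat]
    rw [Nat.mul_comm, Nat.mul_add_div (by have := a.2; omega), Nat.div_eq_of_lt b.2, add_zero]
  have h3 : (⟨a * n + b, hlt⟩ : Fin (n * n)).modNat = b := by
    ext
    simp only [Fin.coe_modNat]
    rw [Nat.mul_comm, Nat.mul_add_mod, Nat.mod_eq_of_lt b.2]
  rw [h2, h3]
  simp

end Input

end TD

namespace TD

/-! ### The complete program and its resource bounds -/

open WordRAM

/-- Loads `n` and `min d n`, and computes `bnd n`. -/
def prologue : Prog := .seq (.const 3 0) <| .seq (.load 0 3) <| .seq (.const 3 1) <|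
  .seq (.load 2 3) <| .seq (.op .lt 5 2 0) <| .seq (.ite 5 .skip (.op .add 2 0 7)) <|
  .seq (.store 3 2) <| .seq (.const 3 2) <| .seq (.op .add 5 0 3) <| .seq (.op .mul 5 5 5) <|
  .seq (.const 3 64) (.op .mul 1 5 3)

/-- The input number `d` may fill a whole word; replacing it by `min d n`, in its memory cell too,
brings every value below `bnd n`. Register 7 is still 0, so adding it copies `n`. -/
theorem prologue_exec {w n d : ℕ} {l : List ℕ} (hw : bnd n ^ 8 ≤ 2 ^ w) (h0 : l.getD 0 0 = n)
    (h1 : l.getD 1 0 = d) : ∃ t σ, Exec w (16 * bnd n) prologue (State.ofList l) t σ ∧ t ≤ 20 ∧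
      σ.reg 0 = n ∧ σ.reg 2 = min d n ∧ σ.reg 1 = bnd n ∧ (∀ x, σ.reg (2 * (x + 2)) = 0) ∧
      σ.mem 1 = min d n ∧ ∀ i ≠ 1, σ.mem i = l.getD i 0 := by
  have hb := le_bnd (n := n)
  have hbw : bnd n < 2 ^ w := lt_of_lt_of_le (by
    calc bnd n = bnd n ^ 1 := (pow_one _).symm
      _ < bnd n ^ 8 := Nat.pow_lt_pow_right (by omega) (by norm_num)) hw
  have hdef : (n + 2) * (n + 2) * 64 = bnd n := by unfold bnd; ring
  have e0 : 0 % 2 ^ w = 0 := Nat.zero_mod _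
  have e1 : 1 % 2 ^ w = 1 := Nat.mod_eq_of_lt (by omega)
  have e2 : 2 % 2 ^ w = 2 := Nat.mod_eq_of_lt (by omega)
  have e64 : 64 % 2 ^ w = 64 := Nat.mod_eq_of_lt (by omega)
  have e3 : (n + 2) % 2 ^ w = n + 2 := Nat.mod_eq_of_lt (by nlinarith)
  have e4 : (n + 2) * (n + 2) % 2 ^ w = (n + 2) * (n + 2) := Nat.mod_eq_of_lt (by nlinarith)
  have e5 : (n + 2) * (n + 2) * 64 % 2 ^ w = bnd n := by rw [hdef, Nat.mod_eq_of_lt hbw]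
  have e6 : n % 2 ^ w = n := Nat.mod_eq_of_lt (by nlinarith)
  have hx2 : ∀ x : ℕ, 2 * (x + 2) ≠ 0 ∧ 2 * (x + 2) ≠ 1 ∧ 2 * (x + 2) ≠ 2 ∧ 2 * (x + 2) ≠ 3 ∧
    2 * (x + 2) ≠ 5 := fun x => by omega
  have h1' : l[1]?.getD 0 = d := by rw [← h1, List.getD_eq_getElem?_getD]
  have h0' : l[0]?.getD 0 = n := by rw [← h0, List.getD_eq_getElem?_getD]
  by_cases hd : d < n
  · refine ⟨_, _, .seq (.const _ _ _) (.seq (.load _ _ _ ?_) (.seq (.const _ _ _)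
      (.seq (.load _ _ _ ?_) (.seq (.op _ _ _ _ _) (.seq (.iteTrue ?_ (.skip _))
      (.seq (.store _ _ _ ?_) (.seq (.const _ _ _) (.seq (.op _ _ _ _ _) (.seq (.op _ _ _ _ _)
      (.seq (.const _ _ _) (.op _ _ _ _ _))))))))))), by omega, ?_⟩
    all_goals simp [State.setReg, State.setMem, State.ofList, BinOp.eval, e0, e1, e2, e64,
      Function.update_apply, h1', h0', hd, e3, e4, e5, hx2]
    · omega
    · omega
    · omega
    · exact ⟨by omega, fun i hi hi' => absurd hi' hi⟩
  · refine ⟨_, _, .seq (.const _ _ _) (.seq (.load _ _ _ ?_) (.seq (.const _ _ _)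
      (.seq (.load _ _ _ ?_) (.seq (.op _ _ _ _ _) (.seq (.iteFalse ?_ (.op _ _ _ _ _))
      (.seq (.store _ _ _ ?_) (.seq (.const _ _ _) (.seq (.op _ _ _ _ _) (.seq (.op _ _ _ _ _)
      (.seq (.const _ _ _) (.op _ _ _ _ _))))))))))), by omega, ?_⟩
    all_goals simp [State.setReg, State.setMem, State.ofList, BinOp.eval, e0, e1, e2, e64,
      Function.update_apply, h1', h0', hd, e3, e4, e5, e6, hx2]
    · omega
    · omega
    · omega
    · exact ⟨by omega, fun i hi hi' => absurd hi' hi⟩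

/-- Since `bnd n` is at most `2 ^ (10 + 2 * Nat.log 2 n)`, its eighth power has exponent at most `80
+ 16 * Nat.log 2 n`. -/
theorem bnd_pow_le {n w : ℕ} (hw : 80 * (Nat.log 2 n + 1) ≤ w) : bnd n ^ 8 ≤ 2 ^ w := by
  have h1 : n + 2 ≤ 2 ^ (Nat.log 2 n + 2) := by
    have := Nat.lt_pow_succ_log_self (b := 2) (by norm_num) n
    have h2 : 1 ≤ 2 ^ Nat.log 2 n := Nat.one_le_two_pow
    simp only [pow_succ] at this ⊢
    omega
  calc bnd n ^ 8 ≤ (2 ^ 6 * (2 ^ (Nat.log 2 n + 2)) ^ 2) ^ 8 := by unfold bnd; gcongr; norm_num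
    _ = 2 ^ (80 + 16 * Nat.log 2 n) := by rw [← pow_mul, ← pow_add, ← pow_mul]; congr 1; ring
    _ ≤ 2 ^ w := Nat.pow_le_pow_right (by norm_num) (by omega)

theorem iters_mono {n dd dd' : ℕ} (h : dd ≤ dd') : iters n dd ≤ iters n dd' := by
  unfold iters
  have : (4 ^ (2 * dd)) ^ (dd + 2) ≤ (4 ^ (2 * dd')) ^ (dd' + 2) :=
    (Nat.pow_le_pow_right (by positivity) (by omega)).trans
      (Nat.pow_le_pow_left (Nat.pow_le_pow_right (by norm_num) (by omega)) _)
  gcongr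

/-- The exponent of 2 is `4 * dd * (dd + 2)`; both `dd * dd` and `dd` are at most `d * k`, which
gives 12. -/
theorem iters_le {n dd d k : ℕ} (hn : dd ≤ n) (hd : dd ≤ d) (hk : dd ≤ k) :
    iters n dd + 1 ≤ 4 * (n + 1) ^ 3 * 2 ^ (12 * (d * k)) := by
  have h1 : dd * dd ≤ d * k := Nat.mul_le_mul hd hk
  have h2 : dd ≤ d * k := (Nat.le_mul_self dd).trans h1
  have h3 : (4 ^ (2 * dd)) ^ (dd + 2) ≤ 2 ^ (12 * (d * k)) := by
    rw [show (4 : ℕ) = 2 ^ 2 by norm_num, ← pow_mul, ← pow_mul]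
    exact Nat.pow_le_pow_right (by norm_num) (by nlinarith)
  have h4 : 1 ≤ 2 ^ (12 * (d * k)) := Nat.one_le_two_pow
  unfold iters
  generalize 2 ^ (12 * (d * k)) = X at *
  generalize (4 ^ (2 * dd)) ^ (dd + 2) = Y at *
  calc n + (dd + 2) * (Y * ((n + 1) * (n + 1))) + 1 + 1
      ≤ (n + 2) * X + (n + 2) * (X * ((n + 1) * (n + 1))) := by
        have : (dd + 2) * (Y * ((n + 1) * (n + 1))) ≤ (n + 2) * (X * ((n + 1) * (n + 1))) := by
          gcongr
        have : (n + 2) * 1 ≤ (n + 2) * X := Nat.mul_le_mul_left _ h4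
        omega
    _ ≤ 2 * (n + 1) * (X * ((n + 1) * (n + 1))) + 2 * (n + 1) * (X * ((n + 1) * (n + 1))) := by
        have h5 : n + 2 ≤ 2 * (n + 1) := by omega
        have h6 : X ≤ X * ((n + 1) * (n + 1)) := Nat.le_mul_of_pos_right _ (by positivity)
        exact Nat.add_le_add (Nat.mul_le_mul h5 h6) (Nat.mul_le_mul_right _ h5)
    _ = 4 * (n + 1) ^ 3 * X := by ring

/-- The program proper, run on the state after the prologue. -/
theorem main_exec {n d k w : ℕ} {G : SimpleGraph (Fin n)} {T : RootedForest (Fin n)}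
    (hT : T.IsElimForest G) (hk : T.depth ≤ k) (hw : bnd n ^ 8 ≤ 2 ^ w) {σ : State}
    (h0 : σ.reg 0 = n) (h2 : σ.reg 2 = min d n) (h1 : σ.reg 1 = bnd n)
    (hz : ∀ x, σ.reg (2 * (x + 2)) = 0) (hm1 : σ.mem 1 = min d n)
    (hm : ∀ i ≠ 1, σ.mem i = (encodeInput G T d).getD i 0) :
    ∃ t σ', Exec w (16 * bnd n) mainC.comp σ t σ' ∧
      t ≤ mainC.cost (bnd n) (iters n (min (min d n) k)) ∧
      ((AnswersNo σ' ∧ d < G.treedepth) ∨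
        ∃ F : RootedForest (Fin n), F.IsElimForest G ∧ F.depth ≤ d ∧ AnswersForest σ' F) := by
  have hbn := le_bnd (n := n)
  have hlen : ∀ i ≥ bnd n, σ.mem i = 0 := by
    intro i hi
    rw [hm i (by omega), List.getD_eq_default]
    simp only [encodeInput, List.length_append, List.length_cons, List.length_nil, List.length_ofFn]
    have : 2 + n + n * n ≤ bnd n := by unfold bnd; nlinarith
    omega
  have hmb : ∀ i, σ.mem i < bnd n := by
    intro i
    by_cases hi : i = 1
    · rw [hi, hm1]; exact lt_bnd (by omega)
    · rw [hm i hi]; exact (encodeInput_le G T d i hi).trans_lt (lt_bnd (by omega))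
  let s : St := ⟨fun x => σ.reg (2 * x), fun a i => σ.mem (a * bnd n + i)⟩
  have hb : s.Bdd (bnd n) := by
    refine ⟨fun x => ?_, fun a i => hmb _⟩
    match x with
    | 0 => exact (show σ.reg 0 < bnd n by rw [h0]; exact lt_bnd (by omega))
    | 1 => exact (show σ.reg 2 < bnd n by rw [h2]; exact lt_bnd (by omega))
    | x + 2 => exact (hz x).trans_lt (by omega)
  have hrel : Rel (bnd n) s σ := ⟨fun _ => rfl, h1, fun _ _ _ _ => rfl⟩
  have hG : Graph n (Adj G) s := by
    refine ⟨h0, fun u hu x hx => ?_, fun u x => ?_, fun u => ?_⟩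
    · obtain ⟨a, rfl⟩ := exists_fin hu
      obtain ⟨b, rfl⟩ := exists_fin hx
      rw [adj_succ, ← encodeInput_adj G T d]
      have : (a + 1) * n + (b + 1) + 1 ≠ 1 := by omega
      simp only [s, zero_mul, zero_add]
      rw [hm _ this]
    · rintro ⟨a, b, h1, h2, h⟩
      exact ⟨b, a, h2, h1, h.symm⟩
    · rintro ⟨a, b, h1, h2, h⟩
      exact h.ne (Fin.ext (by omega))
  -- The forest `T` gives an elimination order of depth `T.depth ≤ k`, so no `dd > k` is tried: the
  -- search would have succeeded before.
  obtain ⟨j, hj, s', hbs, hQ⟩ := main_spec (F := iters n (min (min d n) k)) hG hb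
    (show s.var 1 = min d n from h2) (min_le_right d n) (fun dd hdd hno => by
      refine iters_mono (le_min hdd ?_)
      by_contra hlt
      exact hno T.depth (by omega) (exists_elimOrder_of_forest hT le_rfl))
  obtain ⟨t, σ', hex, hr, ht⟩ := mainC.comp_exec hbn hw hbs (by decide) hb σ hrel
  have hmem : ∀ i < bnd n, σ'.mem i = s'.arr 0 i := fun i hi => by
    simpa using hr.2.2 0 (by omega) i hi
  refine ⟨t, σ', hex, ht.trans (mainC.costAt_le hj hb), ?_⟩
  rcases hQ with ⟨hq, hno⟩ | ⟨hq, dd, hdd, H, hH, hout⟩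
  · exact Or.inl ⟨(hmem 0 (by omega)).trans hq, lt_treedepth hT hno⟩
  · obtain ⟨F, hF, hFd, hcode⟩ := hH.exists_forest
    refine Or.inr ⟨F, hF, by omega, (hmem 0 (by omega)).trans hq, fun a => ?_⟩
    rw [hcode, add_comm, hmem _ (lt_bnd (by have := a.2; omega)), hout _ (fin_mem a)]

set_option maxRecDepth 20000 in
theorem whlDepth_mainC : mainC.whlDepth = 1 := by rfl

theorem cost_mainC : ∃ A L : ℕ, ∀ K F : ℕ, 1 ≤ K → mainC.cost K F ≤ A * (K ^ L * (F + 1)) := by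
  obtain ⟨A, hA⟩ := mainC.cost_le
  rw [whlDepth_mainC] at hA
  exact ⟨A, _, fun K F hK => (hA K F hK).trans_eq (by rw [pow_one])⟩

theorem time_le {n dd d k A L C t t' : ℕ} (hn : dd ≤ n) (hd : dd ≤ d) (hk : dd ≤ k) (ht : t ≤ 20)
    (ht' : t' ≤ A * (bnd n ^ L * (iters n dd + 1))) (h12 : 12 ≤ C) (hL : 2 * L + 3 ≤ C)
    (hA : 20 + A * (256 ^ L * 4) ≤ C) : t + t' ≤ C * 2 ^ (C * (d * k)) * (n + 1) ^ C := by
  have hK : bnd n ≤ 256 * (n + 1) ^ 2 := by unfold bnd; nlinarith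
  have h3 := iters_le hn hd hk
  have hX : 2 ^ (12 * (d * k)) ≤ 2 ^ (C * (d * k)) :=
    Nat.pow_le_pow_right (by norm_num) (Nat.mul_le_mul_right _ h12)
  have hN : (n + 1) ^ (2 * L + 3) ≤ (n + 1) ^ C := Nat.pow_le_pow_right (by omega) hL
  have h5 : t' ≤ A * (256 ^ L * 4) * (2 ^ (C * (d * k)) * (n + 1) ^ C) := by
    calc t' ≤ A * (bnd n ^ L * (iters n dd + 1)) := ht'
      _ ≤ A * ((256 * (n + 1) ^ 2) ^ L * (4 * (n + 1) ^ 3 * 2 ^ (12 * (d * k)))) := by gcongr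
      _ = A * (256 ^ L * 4) * (2 ^ (12 * (d * k)) * (n + 1) ^ (2 * L + 3)) := by
        rw [mul_pow, ← pow_mul, pow_add]; ring
      _ ≤ _ := by gcongr
  have h6 : 1 ≤ 2 ^ (C * (d * k)) * (n + 1) ^ C := Nat.one_le_iff_ne_zero.2 (by positivity)
  rw [mul_assoc]
  generalize 2 ^ (C * (d * k)) * (n + 1) ^ C = X at *
  generalize A * (256 ^ L * 4) = B at *
  calc t + t' ≤ 20 * X + B * X := by omega
    _ = (20 + B) * X := by ring
    _ ≤ C * X := Nat.mul_le_mul_right _ hA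

end TD

theorem mainTheorem3 :
    ∃ (P : WordRAM.Prog) (c C : ℕ), 0 < c ∧
      ∀ (n : ℕ) (G : SimpleGraph (Fin n)) (T : RootedForest (Fin n)) (k d w : ℕ),
        T.IsElimForest G → T.depth ≤ k →
        c * (Nat.log 2 n + 1) ≤ w → d < 2 ^ w →
        ∃ (t S : ℕ) (s : WordRAM.State),
          WordRAM.Exec w S P (WordRAM.State.ofList (encodeInput G T d)) t s ∧
          t ≤ C * 2 ^ (C * (d * k)) * (n + 1) ^ C ∧
          S ≤ C * (n + 1) ^ C ∧
          ((AnswersNo s ∧ d < G.treedepth) ∨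
            ∃ F : RootedForest (Fin n),
              F.IsElimForest G ∧ F.depth ≤ d ∧ AnswersForest s F) := by
  obtain ⟨A, L, hA⟩ := TD.cost_mainC
  -- The summands of `C` are the factor of the running time, the exponent of `n + 1` in it, and `16
  -- * 64 * 4` from `16 * bnd n ≤ 4096 * (n + 1) ^ 2`; the last also exceeds the 12 in the exponent
  -- of 2.
  refine ⟨.seq TD.prologue TD.mainC.comp, 80, 20 + A * (256 ^ L * 4) + (2 * L + 3) + 4096,
    by norm_num, ?_⟩
  intro n G T k d w hT hk hw _
  have hw8 := TD.bnd_pow_le hw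
  obtain ⟨t1, σ, hx1, ht1, h0, h2, h1, hz, hm1, hm⟩ := TD.prologue_exec hw8
    (TD.encodeInput_zero G T d) (TD.encodeInput_one G T d)
  obtain ⟨t2, σ', hx2, ht2, hans⟩ := TD.main_exec hT hk hw8 h0 h2 h1 hz hm1 hm
  have h256 := TD.le_bnd (n := n)
  refine ⟨t1 + t2, 16 * TD.bnd n, σ', .seq hx1 hx2, ?_, ?_, hans⟩
  · exact TD.time_le ((min_le_left _ _).trans (min_le_right _ _))
      ((min_le_left _ _).trans (min_le_left _ _)) (min_le_right _ _) ht1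
      (ht2.trans (hA _ _ (by omega))) (by omega) (by omega) (by omega)
  · calc 16 * TD.bnd n ≤ 4096 * (n + 1) ^ 2 := by unfold TD.bnd; nlinarith
      _ ≤ _ := Nat.mul_le_mul (by omega) (Nat.pow_le_pow_right (by omega) (by omega))
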